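/- Let $(M^n,g)$ be a smooth Riemannian manifold (without boundary, Hausdorff, second countable) and let $k\in\mathbb N$. For $\phi\in C^\infty(M)$ put $\Delta_\phi f=\Delta f-g(\nabla\phi,\nabla f)$ and $R_\phi=R+2\Delta\phi-|\nabla\phi|^2$, let $[\phi]=\{\phi+\omega:\omega\in C^\infty(M)\}$ be the weighted conformal class of $\phi$, and for $w\in\mathbb R$ let $$\mathcal E[w]=\{f:[\phi]\to C^\infty(M)\ :\ f(\psi-v)=e^{wv}f(\psi)\ \text{ for all }\psi\in[\phi],\ v\in C^\infty(M)\}$$ be the space of conformal densities of weight $w$. A normal weighted ambient space of $(M,g,\phi)$ (with parameter $\lambda=0$) consists of an open neighbourhood $W$ of $M\times\{0\}$ in $M\times\mathbb R$ whose fibres over $M$ are intervals, and of a smooth family of Riemannian metrics $g_u(x)$ and a smooth function $\phi_u(x)$, $(x,u)\in W$, with $(g_0,\phi_0)=(g,\phi)$, such that the Lorentzian metric $\widetilde g=2\,du\,dv+g_u$ and the function $\widetilde\phi=\phi_u-v$ on $\{(v,x,u):(x,u)\in W\}\subset\mathbb R\times M\times\mathbb R$ satisfy $$\mathrm{Ric}_{\widetilde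 g}+\widetilde\nabla^2\widetilde\phi=O(u^\infty),\qquad \widetilde\Delta\widetilde\phi-|\widetilde\nabla\widetilde\phi|^2=O(u^\infty)$$ at $u=0$. Write $\widetilde\Delta_\phi F=\widetilde\Delta F-\widetilde g(\widetilde\nabla\widetilde\phi,\widetilde\nabla F)$. Then there are linear operators $L_{2k,\phi}:C^\infty(M)\to C^\infty(M)$, one for each $\phi\in C^\infty(M)$, such that: 1. $L_{2k,\phi}=\left(\Delta_\phi-\tfrac14R_\phi\right)^k$. 2. (Conformal invariance) $f\mapsto\big(\psi\mapsto L_{2k,\psi}(f(\psi))\big)$ is a well-defined linear map $\mathcal E[-1/2]\to\mathcal E[-1/2]$. 3. (Formal self-adjointness) $\int_M (L_{2k,\phi}f)\,h\,e^{-\phi}\,\mathrm{dvol}_g=\int_M f\,(L_{2k,\phi}h)\,e^{-\phi}\,\mathrm{dvol}_g$ for all compactly supported $f,h\in C^\infty(M)$. 4. (Leading term) $L_{2k,\phi}-\Delta_\phi^k$ is a linear differential operator of order less than $2k$ (it vanishes for $k=0$). 5. (Ambient construction) For every normal weighted ambient space of $(M,g,\phi)$, every $f\in C^\infty(M)$ and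 every smooth extension $f_u$ of $f$ to $W$ (so $f_0=f$), $$L_{2k,\phi}f=e^{\frac12v}\,\widetilde\Delta_\phi^{\,k}\big(e^{-\frac12v}f_u\big)\Big|_{u=0}.$$ -/

import Mathlib

set_option maxSynthPendingDepth 3

open scoped Manifold ContDiff Topology
open MeasureTheory

noncomputable section

namespace WeightedGJMS

/-! ### Pseudo-Riemannian geometry in a coordinate space

`G : E → E →L[ℝ] E →L[ℝ] ℝ` is the coordinate expression of a metric of arbitrary signature. -/

section Coordinates

variable {E : Type*} [NormedAddCommGroup E] [NormedSpace ℝ E]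

/-- Christoffel symbols of the first kind:
`(X, Y, Z) ↦ ½ (∂_X G(Y, Z) + ∂_Y G(X, Z) - ∂_Z G(X, Y))`. -/
def christoffelLower (G : E → E →L[ℝ] E →L[ℝ] ℝ) (y : E) : E →L[ℝ] E →L[ℝ] E →L[ℝ] ℝ :=
  let flip₂ : (E →L[ℝ] E →L[ℝ] ℝ) →L[ℝ] (E →L[ℝ] E →L[ℝ] ℝ) :=
    (ContinuousLinearMap.flipₗᵢ ℝ E E ℝ).toContinuousLinearEquiv.toContinuousLinearMap
  (2⁻¹ : ℝ) • (fderiv ℝ G y + (fderiv ℝ G y).flip - flip₂ ∘L (fderiv ℝ G y).flip)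

theorem christoffelLower_apply (G : E → E →L[ℝ] E →L[ℝ] ℝ) (y X Y Z : E) :
    christoffelLower G y X Y Z =
      2⁻¹ * (fderiv ℝ G y X Y Z + fderiv ℝ G y Y X Z - fderiv ℝ G y Z X Y) := rfl

/-- Christoffel symbols of the second kind, `Γ(X, Y)`: the index is raised with the inverse of
the isomorphism `E → E*` given by the metric. -/
def christoffel (G : E → E →L[ℝ] E →L[ℝ] ℝ) (y : E) : E →L[ℝ] E →L[ℝ] E :=
  (ContinuousLinearMap.compL ℝ E (E →L[ℝ] ℝ) E (G y).inverse) ∘L christoffelLower G y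

theorem christoffel_apply (G : E → E →L[ℝ] E →L[ℝ] ℝ) (y X Y : E) :
    christoffel G y X Y = (G y).inverse (christoffelLower G y X Y) := rfl

/-- The endomorphism `X ↦ R(X, Y) Z` of the Levi-Civita curvature
`R(X, Y) Z = ∇_X ∇_Y Z - ∇_Y ∇_X Z - ∇_[X, Y] Z`. -/
def curvatureEnd (G : E → E →L[ℝ] E →L[ℝ] ℝ) (y Y Z : E) : E →L[ℝ] E :=
  ((fderiv ℝ (christoffel G) y).flip Y).flip Z - (fderiv ℝ (christoffel G) y Y).flip Z
    + (christoffel G y).flip (christoffel G y Y Z)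
    - (christoffel G y Y) ∘L ((christoffel G y).flip Z)

theorem curvatureEnd_apply (G : E → E →L[ℝ] E →L[ℝ] ℝ) (y X Y Z : E) :
    curvatureEnd G y Y Z X =
      fderiv ℝ (christoffel G) y X Y Z - fderiv ℝ (christoffel G) y Y X Z
        + christoffel G y X (christoffel G y Y Z)
        - christoffel G y Y (christoffel G y X Z) := rfl

/-- The Ricci tensor `Ric(Y, Z) = tr (X ↦ R(X, Y) Z)`. -/
def ricciForm (G : E → E →L[ℝ] E →L[ℝ] ℝ) (y : E) : LinearMap.BilinForm ℝ E :=
  LinearMap.mk₂ ℝ (fun Y Z => LinearMap.trace ℝ E (curvatureEnd G y Y Z : E →ₗ[ℝ] E))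
    (fun Y Y' Z => by
      rw [← map_add]; congr 1; ext X; simp [curvatureEnd_apply]; abel)
    (fun c Y Z => by
      rw [← map_smul]; congr 1; ext X; simp [curvatureEnd_apply, smul_sub, smul_add])
    (fun Y Z Z' => by
      rw [← map_add]; congr 1; ext X; simp [curvatureEnd_apply]; abel)
    (fun c Y Z => by
      rw [← map_smul]; congr 1; ext X; simp [curvatureEnd_apply, smul_sub, smul_add])

theorem ricciForm_apply (G : E → E →L[ℝ] E →L[ℝ] ℝ) (y Y Z : E) :
    ricciForm G y Y Z = LinearMap.trace ℝ E (curvatureEnd G y Y Z : E →ₗ[ℝ] E) := rfl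

/-- The Hessian `∇²f(X, Y) = ∂_X ∂_Y f - df(Γ(X, Y))`. -/
def hessianForm (G : E → E →L[ℝ] E →L[ℝ] ℝ) (f : E → ℝ) (y : E) : LinearMap.BilinForm ℝ E :=
  LinearMap.mk₂ ℝ (fun X Y => fderiv ℝ (fderiv ℝ f) y X Y - fderiv ℝ f y (christoffel G y X Y))
    (fun X X' Y => by simp; ring) (fun c X Y => by simp; ring)
    (fun X Y Y' => by simp; ring) (fun c X Y => by simp; ring)

theorem hessianForm_apply (G : E → E →L[ℝ] E →L[ℝ] ℝ) (f : E → ℝ) (y X Y : E) :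
    hessianForm G f y X Y =
      fderiv ℝ (fderiv ℝ f) y X Y - fderiv ℝ f y (christoffel G y X Y) := rfl

/-- The trace `B^{ij} T_{ij}` of a bilinear form `T` with respect to a metric `B`. -/
def metricTrace [FiniteDimensional ℝ E] (B : E →L[ℝ] E →L[ℝ] ℝ) (T : LinearMap.BilinForm ℝ E) :
    ℝ :=
  LinearMap.trace ℝ E
    ((B.inverse : (E →L[ℝ] ℝ) →ₗ[ℝ] E) ∘ₗ
      (LinearMap.toContinuousLinearMap : (E →ₗ[ℝ] ℝ) ≃ₗ[ℝ] (E →L[ℝ] ℝ)).toLinearMap ∘ₗ T)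

end Coordinates

/-! ### Pseudo-Riemannian geometry on a manifold without boundary

A metric is a field `g` of bilinear forms on the tangent spaces. Every object at `x` is computed in
the preferred chart at `x`; Mathlib identifies `TangentSpace I x` with the model space `E` through
the differential of that chart at `x`. -/

section Geometry

variable {E : Type*} [NormedAddCommGroup E] [NormedSpace ℝ E]
  {H : Type*} [TopologicalSpace H] (I : ModelWithCorners ℝ E H)
  {M : Type*} [TopologicalSpace M] [ChartedSpace H M]

/-- The expression of the metric `g` in the chart at `x`: its pullback under the inverse chart. -/
def chartMetric (g : ∀ x : M, TangentSpace I x →L[ℝ] TangentSpace I x →L[ℝ] ℝ) (x : M) :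
    E → E →L[ℝ] E →L[ℝ] ℝ := fun y =>
  let gz : E →L[ℝ] E →L[ℝ] ℝ := g ((extChartAt I x).symm y)
  let dz : E →L[ℝ] E := mfderiv 𝓘(ℝ, E) I (extChartAt I x).symm y
  gz.bilinearComp dz dz

/-- The Ricci tensor of `g` at `x`. -/
def ricci (g : ∀ x : M, TangentSpace I x →L[ℝ] TangentSpace I x →L[ℝ] ℝ) (x : M) :
    LinearMap.BilinForm ℝ E :=
  ricciForm (chartMetric I g x) (extChartAt I x x)

/-- The Hessian `∇²f` at `x`. -/
def hessian (g : ∀ x : M, TangentSpace I x →L[ℝ] TangentSpace I x →L[ℝ] ℝ) (f : M → ℝ) (x : M) :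
    LinearMap.BilinForm ℝ E :=
  hessianForm (chartMetric I g x) (f ∘ (extChartAt I x).symm) (extChartAt I x x)

/-- The inner product `g(∇f, ∇h)` of gradients. -/
def gradInner (g : ∀ x : M, TangentSpace I x →L[ℝ] TangentSpace I x →L[ℝ] ℝ) (f h : M → ℝ)
    (x : M) : ℝ :=
  fderiv ℝ (f ∘ (extChartAt I x).symm) (extChartAt I x x)
    ((chartMetric I g x (extChartAt I x x)).inverse
      (fderiv ℝ (h ∘ (extChartAt I x).symm) (extChartAt I x x)))

variable [FiniteDimensional ℝ E]

/-- The scalar curvature `R`. -/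
def scalarCurvature (g : ∀ x : M, TangentSpace I x →L[ℝ] TangentSpace I x →L[ℝ] ℝ) (x : M) : ℝ :=
  metricTrace (chartMetric I g x (extChartAt I x x)) (ricci I g x)

/-- The Laplacian `Δf = tr_g ∇²f`. -/
def laplacian (g : ∀ x : M, TangentSpace I x →L[ℝ] TangentSpace I x →L[ℝ] ℝ) (f : M → ℝ)
    (x : M) : ℝ :=
  metricTrace (chartMetric I g x (extChartAt I x x)) (hessian I g f x)

/-- The weighted Laplacian `Δ_φ f = Δf - g(∇φ, ∇f)`. -/
def weightedLaplacian (g : ∀ x : M, TangentSpace I x →L[ℝ] TangentSpace I x →L[ℝ] ℝ)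
    (φ f : M → ℝ) (x : M) : ℝ :=
  laplacian I g f x - gradInner I g φ f x

/-- The weighted scalar curvature `R_φ = R + 2Δφ - |∇φ|²` (with parameter `λ = 0`). -/
def weightedScalarCurvature (g : ∀ x : M, TangentSpace I x →L[ℝ] TangentSpace I x →L[ℝ] ℝ)
    (φ : M → ℝ) (x : M) : ℝ :=
  scalarCurvature I g x + 2 * laplacian I g φ x - gradInner I g φ φ x

/-- The tensor `P_φ = Ric + ∇²φ` (with parameter `λ = 0`). -/
def weightedP (g : ∀ x : M, TangentSpace I x →L[ℝ] TangentSpace I x →L[ℝ] ℝ)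
    (φ : M → ℝ) (x : M) : LinearMap.BilinForm ℝ E :=
  ricci I g x + hessian I g φ x

/-- The function `F_φ = Δφ - |∇φ|²` (with parameter `λ = 0`). -/
def weightedF (g : ∀ x : M, TangentSpace I x →L[ℝ] TangentSpace I x →L[ℝ] ℝ)
    (φ : M → ℝ) (x : M) : ℝ :=
  laplacian I g φ x - gradInner I g φ φ x

/-- The second order operator `Δ_φ - ¼ R_φ`. -/
def gjmsFactor (g : ∀ x : M, TangentSpace I x →L[ℝ] TangentSpace I x →L[ℝ] ℝ)
    (φ f : M → ℝ) (x : M) : ℝ :=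
  weightedLaplacian I g φ f x - 1 / 4 * weightedScalarCurvature I g φ x * f x

end Geometry

/-- A linear endomorphism `D` of a commutative algebra `A` (here `A = C^∞(M)`) is a differential
operator of order `< m`: for `m = 0` it vanishes, and for `m + 1` all of its commutators with
multiplication operators are of order `< m`. On `C^∞(M)` these are the usual linear differential
operators with smooth coefficients. -/
def IsDiffOpOfOrderLT {A : Type*} [CommRing A] [Algebra ℝ A] : ℕ → Module.End ℝ A → Prop
  | 0, D => D = 0
  | m + 1, D => ∀ a : A,
      IsDiffOpOfOrderLT m (D * LinearMap.mulLeft ℝ a - LinearMap.mulLeft ℝ a * D)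

section Manifold

variable {n : ℕ} {M : Type*} [TopologicalSpace M] [ChartedSpace (EuclideanSpace ℝ (Fin n)) M]

/-- Smooth real-valued functions on the `n`-manifold `M`. -/
abbrev SmoothFn (n : ℕ) (M : Type*) [TopologicalSpace M]
    [ChartedSpace (EuclideanSpace ℝ (Fin n)) M] : Type _ :=
  C^∞⟮𝓡 n, M; 𝓘(ℝ, ℝ), ℝ⟯

/-- Smooth Riemannian metrics on the `n`-manifold `M`. -/
abbrev RMetric (n : ℕ) (M : Type*) [TopologicalSpace M]
    [ChartedSpace (EuclideanSpace ℝ (Fin n)) M] [IsManifold (𝓡 n) ∞ M] : Type _ :=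
  Bundle.ContMDiffRiemannianMetric (𝓡 n) ∞ (EuclideanSpace ℝ (Fin n))
    (fun x : M => TangentSpace (𝓡 n) x)

/-! ### The Riemannian measure -/

/-- The Riemannian measure on the domain of the chart at `x`, namely `√(det g_{ij}) dy¹ ⋯ dyⁿ`
in the coordinates of the chart, extended by zero to `M`. -/
def chartVolume [MeasurableSpace M]
    (g : ∀ x : M, TangentSpace (𝓡 n) x →L[ℝ] TangentSpace (𝓡 n) x →L[ℝ] ℝ) (x : M) : Measure M :=
  ((volume.restrict (extChartAt (𝓡 n) x).target).withDensity fun y =>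
    ENNReal.ofReal (Real.sqrt (Matrix.det (Matrix.of fun i j : Fin n =>
      chartMetric (𝓡 n) g x y (EuclideanSpace.single i 1) (EuclideanSpace.single j 1))))).map
    (extChartAt (𝓡 n) x).symm

/-- The Riemannian measure `dvol_g`: the smallest measure that dominates the Riemannian measure of
each chart. As the chart measures agree on overlaps, on a second countable manifold it restricts to
the chart measure on the domain of each chart. -/
def riemannianVolume [MeasurableSpace M]
    (g : ∀ x : M, TangentSpace (𝓡 n) x →L[ℝ] TangentSpace (𝓡 n) x →L[ℝ] ℝ) : Measure M :=
  ⨆ x : M, chartVolume g x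

/-- The weighted measure `e^{-φ} dvol_g`. -/
def weightedVolume [MeasurableSpace M]
    (g : ∀ x : M, TangentSpace (𝓡 n) x →L[ℝ] TangentSpace (𝓡 n) x →L[ℝ] ℝ) (φ : M → ℝ) :
    Measure M :=
  (riemannianVolume g).withDensity fun x => ENNReal.ofReal (Real.exp (-φ x))

/-! ### The conformal class and conformal densities -/

/-- The weighted conformal class `[φ] = {φ + w : w ∈ C^∞(M)}`. -/
def conformalClass (φ : SmoothFn n M) : Set (SmoothFn n M) := {ψ | ∃ w : SmoothFn n M, ψ = φ + w}

/-- Conformal densities of weight `w`: assignments `f : [φ] → C^∞(M)` with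
`f(ψ - v)(x) = e^{w v(x)} f(ψ)(x)` for `v ∈ C^∞(M)`. The sign of `v` is that of the fibre
coordinate `v` of the cone and of the ambient space, in which the potential is `φ - v`. -/
def ConformalDensity (φ : SmoothFn n M) (w : ℝ) :
    Submodule ℝ (conformalClass φ → SmoothFn n M) where
  carrier := {f | ∀ (ψ ψ' : conformalClass φ) (v : SmoothFn n M),
    (ψ' : SmoothFn n M) = (ψ : SmoothFn n M) - v → ∀ x, f ψ' x = Real.exp (w * v x) * f ψ x}
  add_mem' := by
    intro f h hf hh ψ ψ' v hv x
    have e1 := hf ψ ψ' v hv x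
    have e2 := hh ψ ψ' v hv x
    simp only [Pi.add_apply, ContMDiffMap.coe_add, e1, e2]
    ring
  zero_mem' := by
    intro ψ ψ' v _ x
    simp
  smul_mem' := by
    intro c f hf ψ ψ' v hv x
    have e1 := hf ψ ψ' v hv x
    simp only [Pi.smul_apply, ContMDiffMap.coe_smul, smul_eq_mul, e1]
    ring

/-! ### Normal ambient spaces (with parameter `λ = 0`) -/

/-- The model with corners of the ambient manifold `ℝ × M × ℝ` with coordinates `(v, x, u)`. -/
abbrev ambientModel (n : ℕ) :=
  𝓘(ℝ, ℝ).prod ((𝓡 n).prod 𝓘(ℝ, ℝ))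

/-- The metric `2 du dv + g_u` on `ℝ × M × ℝ`. -/
def ambientMetric (gu : ∀ x : M, ℝ → TangentSpace (𝓡 n) x →L[ℝ] TangentSpace (𝓡 n) x →L[ℝ] ℝ)
    (p : ℝ × M × ℝ) :
    TangentSpace (ambientModel n) p →L[ℝ] TangentSpace (ambientModel n) p →L[ℝ] ℝ :=
  let dv : ℝ × EuclideanSpace ℝ (Fin n) × ℝ →L[ℝ] ℝ := ContinuousLinearMap.fst ℝ _ _
  let pr : ℝ × EuclideanSpace ℝ (Fin n) × ℝ →L[ℝ] EuclideanSpace ℝ (Fin n) :=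
    ContinuousLinearMap.fst ℝ _ _ ∘L ContinuousLinearMap.snd ℝ _ _
  let du : ℝ × EuclideanSpace ℝ (Fin n) × ℝ →L[ℝ] ℝ :=
    ContinuousLinearMap.snd ℝ _ _ ∘L ContinuousLinearMap.snd ℝ _ _
  let gx : EuclideanSpace ℝ (Fin n) →L[ℝ] EuclideanSpace ℝ (Fin n) →L[ℝ] ℝ := gu p.2.1 p.2.2
  dv.smulRight du + du.smulRight dv + gx.bilinearComp pr pr

/-- The function `φ_u - v` on `ℝ × M × ℝ`. -/
def ambientPotential (φu : M × ℝ → ℝ) (p : ℝ × M × ℝ) : ℝ := φu p.2 - p.1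

/-- A normal weighted ambient space of `(M, g, [φ], λ = 0)` relative to `(g, φ)`. It lives on
`{(v, x, u) : (x, u) ∈ dom}`, an open neighbourhood of `{u = 0}` that is invariant under the
dilations `v ↦ v - s`, carries the metric `2 du dv + g_u` and the potential `φ_u - v`, and
satisfies `P̃_φ = O(u^∞)` and `F̃_φ = O(u^∞)`. The values outside the domain are irrelevant. -/
structure NormalAmbientSpace [IsManifold (𝓡 n) ∞ M] (g : RMetric n M) (φ : SmoothFn n M) where
  dom : Set (M × ℝ)
  isOpen_dom : IsOpen dom
  zero_mem : ∀ x : M, (x, (0 : ℝ)) ∈ dom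
  interval : ∀ x : M, {u : ℝ | (x, u) ∈ dom}.OrdConnected
  gu : ∀ x : M, ℝ → TangentSpace (𝓡 n) x →L[ℝ] TangentSpace (𝓡 n) x →L[ℝ] ℝ
  φu : M × ℝ → ℝ
  gu_symm : ∀ (x : M) (u : ℝ), (x, u) ∈ dom → ∀ X Y, gu x u X Y = gu x u Y X
  gu_pos : ∀ (x : M) (u : ℝ), (x, u) ∈ dom → ∀ X, X ≠ 0 → 0 < gu x u X X
  smooth_metric : ContMDiffOn (ambientModel n)
    ((ambientModel n).prod 𝓘(ℝ, (ℝ × EuclideanSpace ℝ (Fin n) × ℝ) →L[ℝ]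
      (ℝ × EuclideanSpace ℝ (Fin n) × ℝ) →L[ℝ] ℝ)) ∞
    (fun p : ℝ × M × ℝ => Bundle.TotalSpace.mk'
      ((ℝ × EuclideanSpace ℝ (Fin n) × ℝ) →L[ℝ] (ℝ × EuclideanSpace ℝ (Fin n) × ℝ) →L[ℝ] ℝ)
      (E := fun p : ℝ × M × ℝ => TangentSpace (ambientModel n) p →L[ℝ]
        TangentSpace (ambientModel n) p →L[ℝ] ℝ)
      p (ambientMetric gu p)) {p | p.2 ∈ dom}
  smooth_potential : ContMDiffOn ((𝓡 n).prod 𝓘(ℝ, ℝ)) 𝓘(ℝ, ℝ) ∞ φu dom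
  gu_zero : ∀ x : M, gu x 0 = g.inner x
  φu_zero : ∀ x : M, φu (x, 0) = φ x
  P_vanishes : ∀ (v : ℝ) (x : M) (X Y : ℝ × EuclideanSpace ℝ (Fin n) × ℝ) (N : ℕ),
    (fun u : ℝ => weightedP (ambientModel n) (ambientMetric gu) (ambientPotential φu) (v, x, u) X Y)
      =O[𝓝 0] fun u : ℝ => u ^ N
  F_vanishes : ∀ (v : ℝ) (x : M) (N : ℕ),
    (fun u : ℝ => weightedF (ambientModel n) (ambientMetric gu) (ambientPotential φu) (v, x, u))
      =O[𝓝 0] fun u : ℝ => u ^ N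

/-- The weighted Laplacian `Δ̃_φ` of a normal ambient space. -/
def NormalAmbientSpace.weightedLaplacian [IsManifold (𝓡 n) ∞ M] {g : RMetric n M}
    {φ : SmoothFn n M} (S : NormalAmbientSpace g φ) (F : ℝ × M × ℝ → ℝ) : ℝ × M × ℝ → ℝ :=
  WeightedGJMS.weightedLaplacian (ambientModel n) (ambientMetric S.gu) (ambientPotential S.φu) F

end Manifold

end WeightedGJMS

end

open WeightedGJMS

/-!
Everything follows from the factorisation `L_{2k,φ} = (Δ_φ - ¼ R_φ)^k`, so the properties only have
to be checked for the single operator `Δ_φ - ¼ R_φ`.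

Since the metric does not change within the weighted conformal class, `Δ_{φ-v}(e^{-v/2} f)` differs
from `e^{-v/2} Δ_φ f` by the potential `-¼ (2 Δ_φ v + |∇v|²)`, and this is `¼ (R_{φ-v} - R_φ)`; so
the operator is conformally covariant, mapping weight `-1/2` to weight `-1/2`. Self-adjointness is
Green's identity: in a chart `Δ_φ` is the divergence of the gradient with respect to the density
`√(det g) e^{-φ}`, and a partition of unity reduces to functions supported in one chart.

On the ambient space, `Δ̃_φ(e^{-v/2} f_u)` is again homogeneous in `v`: it is
`e^{-v/2} (Δ_{φ_u} f_u + (½ ∂_u φ - ¼ tr ∂_u g) f_u)`, without any `u`-derivative of `f_u`. At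
`u = 0` the normality equations express the trace of `∂_u g` through the scalar curvature and `Δφ`,
and then `∂_u φ` through these and `|∇φ|²`; together they turn the potential into `-¼ R_φ`.
Iterating this `k` times gives the ambient formula, whatever the extension `f_u` is.
-/

noncomputable section

namespace WeightedGJMS

/-! ### Metrics and curvature in coordinates -/

section Calculus

variable {E F F' F'' : Type*} [NormedAddCommGroup E] [NormedSpace ℝ E]
  [NormedAddCommGroup F] [NormedSpace ℝ F] [NormedAddCommGroup F'] [NormedSpace ℝ F']
  [NormedAddCommGroup F''] [NormedSpace ℝ F'']

theorem hasFDerivAt_clm_apply_const {A : E → F →L[ℝ] F'} {A' : E →L[ℝ] F →L[ℝ] F'} {y : E}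
    (hA : HasFDerivAt A A' y) (X : F) : HasFDerivAt (fun z => A z X) (A'.flip X) y :=
  (ContinuousLinearMap.apply ℝ F' X).hasFDerivAt.comp y hA

theorem hasFDerivAt_clm_apply_const₂ {A : E → F →L[ℝ] F' →L[ℝ] F''}
    {A' : E →L[ℝ] F →L[ℝ] F' →L[ℝ] F''} {y : E} (hA : HasFDerivAt A A' y) (X : F) (Y : F') :
    HasFDerivAt (fun z => A z X Y) ((A'.flip X).flip Y) y :=
  hasFDerivAt_clm_apply_const (hasFDerivAt_clm_apply_const hA X) Y

theorem fderiv_clm_apply_const₂ {A : E → F →L[ℝ] F' →L[ℝ] F''} {y : E}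
    (hA : DifferentiableAt ℝ A y) (W : E) (X : F) (Y : F') :
    fderiv ℝ (fun z => A z X Y) y W = fderiv ℝ A y W X Y := by
  rw [(hasFDerivAt_clm_apply_const₂ hA.hasFDerivAt X Y).fderiv]; rfl

variable {f : E → F} {U : Set E} {y : E}

theorem contDiffOn_fderiv (hU : IsOpen U) (hf : ContDiffOn ℝ ∞ f U) :
    ContDiffOn ℝ ∞ (fderiv ℝ f) U :=
  hf.fderiv_of_isOpen hU (by simp)

theorem contDiffAt_two_of_contDiffOn (hU : IsOpen U) (hf : ContDiffOn ℝ ∞ f U) (hy : y ∈ U) :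
    ContDiffAt ℝ 2 f y :=
  (hf.contDiffAt (hU.mem_nhds hy)).of_le ENat.LEInfty.out

theorem differentiableAt_of_contDiffOn (hU : IsOpen U) (hf : ContDiffOn ℝ ∞ f U) (hy : y ∈ U) :
    DifferentiableAt ℝ f y :=
  (hf.contDiffAt (hU.mem_nhds hy)).differentiableAt (by simp)

theorem differentiableAt_fderiv (hf : ContDiffAt ℝ 2 f y) : DifferentiableAt ℝ (fderiv ℝ f) y :=
  (hf.fderiv_right (m := 1) le_rfl).differentiableAt one_ne_zero

theorem eventually_differentiableAt (hf : ContDiffAt ℝ 2 f y) :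
    ∀ᶠ z in 𝓝 y, DifferentiableAt ℝ f z :=
  (hf.eventually (by simp)).mono fun _ hz => hz.differentiableAt two_ne_zero

theorem fderiv_fderiv_comm (hf : ContDiffAt ℝ 2 f y) (X Y : E) :
    fderiv ℝ (fderiv ℝ f) y X Y = fderiv ℝ (fderiv ℝ f) y Y X :=
  hf.isSymmSndFDerivAt (by rw [minSmoothness_of_isRCLikeNormedField]) X Y

theorem fderiv_fderiv_comp {Φ : E → F} {f : F → F'} (hf : ContDiffAt ℝ 2 f (Φ y))
    (hΦ : ContDiffAt ℝ 2 Φ y) (X Y : E) :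
    fderiv ℝ (fderiv ℝ (f ∘ Φ)) y X Y =
      fderiv ℝ (fderiv ℝ f) (Φ y) (fderiv ℝ Φ y X) (fderiv ℝ Φ y Y)
        + fderiv ℝ f (Φ y) (fderiv ℝ (fderiv ℝ Φ) y X Y) := by
  have hΦ_deriv := (hΦ.differentiableAt two_ne_zero).hasFDerivAt
  have chain_rule : fderiv ℝ (f ∘ Φ) =ᶠ[𝓝 y] fun z => fderiv ℝ f (Φ z) ∘L fderiv ℝ Φ z := by
    filter_upwards [hΦ.continuousAt.eventually (eventually_differentiableAt hf),
      eventually_differentiableAt hΦ] with z hfz hΦz using fderiv_comp z hfz hΦz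
  have fderiv_comp_deriv : HasFDerivAt (fun z => fderiv ℝ f (Φ z))
      (fderiv ℝ (fderiv ℝ f) (Φ y) ∘L fderiv ℝ Φ y) y :=
    (differentiableAt_fderiv hf).hasFDerivAt.comp y hΦ_deriv
  rw [chain_rule.fderiv_eq,
    (fderiv_comp_deriv.clm_comp (differentiableAt_fderiv hΦ).hasFDerivAt).fderiv]
  simp [add_comm]

end Calculus

section Coordinates

variable {E : Type*} [NormedAddCommGroup E] [NormedSpace ℝ E]

/-- `G` is a smooth pseudo-Riemannian metric on the open set `U`. Nondegeneracy is invertibility of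
the map `E → E*`, which in infinite dimension makes the metric strong. -/
structure IsMetricOn (G : E → E →L[ℝ] E →L[ℝ] ℝ) (U : Set E) : Prop where
  isOpen : IsOpen U
  contDiffOn : ContDiffOn ℝ ∞ G U
  symm : ∀ y ∈ U, ∀ X Y, G y X Y = G y Y X
  isInvertible : ∀ y ∈ U, (G y).IsInvertible

namespace IsMetricOn

variable {G : E → E →L[ℝ] E →L[ℝ] ℝ} {U : Set E} {y : E}

theorem mono {V : Set E} (hG : IsMetricOn G U) (hV : IsOpen V) (hVU : V ⊆ U) : IsMetricOn G V :=
  ⟨hV, hG.contDiffOn.mono hVU, fun y hy => hG.symm y (hVU hy),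
    fun y hy => hG.isInvertible y (hVU hy)⟩

theorem differentiableAt (hG : IsMetricOn G U) (hy : y ∈ U) : DifferentiableAt ℝ G y :=
  differentiableAt_of_contDiffOn hG.isOpen hG.contDiffOn hy

theorem fderiv_symm (hG : IsMetricOn G U) (hy : y ∈ U) (W X Y : E) :
    fderiv ℝ G y W X Y = fderiv ℝ G y W Y X := by
  have symm_nhds : (fun z => G z X Y) =ᶠ[𝓝 y] fun z => G z Y X := by
    filter_upwards [hG.isOpen.mem_nhds hy] with z hz using hG.symm z hz X Y
  rw [← fderiv_clm_apply_const₂ (hG.differentiableAt hy), symm_nhds.fderiv_eq,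
    fderiv_clm_apply_const₂ (hG.differentiableAt hy)]

theorem christoffelLower_symm (hG : IsMetricOn G U) (hy : y ∈ U) (X Y Z : E) :
    christoffelLower G y X Y Z = christoffelLower G y Y X Z := by
  rw [christoffelLower_apply, christoffelLower_apply, hG.fderiv_symm hy Z X Y]; ring

theorem christoffel_symm (hG : IsMetricOn G U) (hy : y ∈ U) (X Y : E) :
    christoffel G y X Y = christoffel G y Y X := by
  rw [christoffel_apply, christoffel_apply]
  exact congrArg _ (ContinuousLinearMap.ext fun Z => hG.christoffelLower_symm hy X Y Z)

theorem apply_inverse (hG : IsMetricOn G U) (hy : y ∈ U) (α : E →L[ℝ] ℝ) (X : E) :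
    G y ((G y).inverse α) X = α X := by
  rw [(hG.isInvertible y hy).self_apply_inverse]

theorem apply_inverse_comm (hG : IsMetricOn G U) (hy : y ∈ U) (α β : E →L[ℝ] ℝ) :
    α ((G y).inverse β) = β ((G y).inverse α) := by
  rw [← hG.apply_inverse hy α, hG.symm y hy, hG.apply_inverse hy]

variable [FiniteDimensional ℝ E]

theorem contDiffOn_inverse (hG : IsMetricOn G U) : ContDiffOn ℝ ∞ (fun y => (G y).inverse) U := by
  have := FiniteDimensional.complete ℝ E
  exact fun y hy => (hG.isInvertible y hy).contDiffAt_map_inverse.comp_contDiffWithinAt y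
    (hG.contDiffOn y hy)

theorem contDiffOn_christoffelLower (hG : IsMetricOn G U) :
    ContDiffOn ℝ ∞ (christoffelLower G) U := by
  have hDG := contDiffOn_fderiv hG.isOpen hG.contDiffOn
  simp only [contDiffOn_clm_apply] at hDG ⊢
  intro X Y Z
  simp only [christoffelLower_apply]
  exact contDiffOn_const.mul (((hDG X Y Z).add (hDG Y X Z)).sub (hDG Z X Y))

theorem contDiffOn_christoffel (hG : IsMetricOn G U) : ContDiffOn ℝ ∞ (christoffel G) U := by
  have hΓ := hG.contDiffOn_christoffelLower
  rw [contDiffOn_clm_apply] at hΓ ⊢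
  exact fun X => contDiffOn_clm_apply.2 fun Y =>
    hG.contDiffOn_inverse.clm_apply (contDiffOn_clm_apply.1 (hΓ X) Y)

theorem differentiableAt_christoffel (hG : IsMetricOn G U) (hy : y ∈ U) :
    DifferentiableAt ℝ (christoffel G) y :=
  differentiableAt_of_contDiffOn hG.isOpen hG.contDiffOn_christoffel hy

theorem contDiffOn_curvatureEnd (hG : IsMetricOn G U) (X Y Z : E) :
    ContDiffOn ℝ ∞ (fun y => curvatureEnd G y Y Z X) U := by
  have hΓ := hG.contDiffOn_christoffel
  have hDΓ := contDiffOn_fderiv hG.isOpen hΓ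
  rw [contDiffOn_clm_apply] at hΓ
  simp only [contDiffOn_clm_apply] at hDΓ
  have hΓ_apply : ∀ X Y, ContDiffOn ℝ ∞ (fun y => christoffel G y X Y) U := fun X Y =>
    contDiffOn_clm_apply.1 (hΓ X) Y
  simp only [curvatureEnd_apply]
  exact (((hDΓ X Y Z).sub (hDΓ Y X Z)).add ((hΓ X).clm_apply (hΓ_apply Y Z))).sub
    ((hΓ Y).clm_apply (hΓ_apply X Z))

end IsMetricOn

theorem isInvertible_of_nondegenerate [FiniteDimensional ℝ E] {B : E →L[ℝ] E →L[ℝ] ℝ}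
    (hB : ∀ X, (∀ Y, B X Y = 0) → X = 0) : B.IsInvertible := by
  have injective : Function.Injective (B : E →ₗ[ℝ] E →L[ℝ] ℝ) :=
    (injective_iff_map_eq_zero _).2 fun X hX => hB X fun Y => DFunLike.congr_fun hX Y
  have finrank_eq : Module.finrank ℝ E = Module.finrank ℝ (E →L[ℝ] ℝ) := by
    rw [← (LinearMap.toContinuousLinearMap : (E →ₗ[ℝ] ℝ) ≃ₗ[ℝ] (E →L[ℝ] ℝ)).finrank_eq]
    exact (Subspace.dual_finrank_eq (K := ℝ) (V := E)).symm
  exact ⟨(LinearEquiv.ofInjectiveOfFinrankEq _ injective finrank_eq).toContinuousLinearEquiv, rfl⟩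

section Trace

theorem trace_eq_sum_coord {ι : Type*} [Fintype ι] (b : Module.Basis ι ℝ E) (T : E →ₗ[ℝ] E) :
    LinearMap.trace ℝ E T = ∑ i, b.coord i (T (b i)) := by
  classical
  rw [LinearMap.trace_eq_matrix_trace ℝ b, Matrix.trace]
  simp [LinearMap.toMatrix_apply]

variable [FiniteDimensional ℝ E] {V : Type*} [NormedAddCommGroup V] [NormedSpace ℝ V] {U : Set V}

theorem contDiffOn_trace {T : V → E →ₗ[ℝ] E} (hT : ∀ X, ContDiffOn ℝ ∞ (fun y => T y X) U) :
    ContDiffOn ℝ ∞ (fun y => LinearMap.trace ℝ E (T y)) U := by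
  simp only [trace_eq_sum_coord (Module.finBasis ℝ E)]
  exact ContDiffOn.sum fun i _ => (LinearMap.toContinuousLinearMap
    ((Module.finBasis ℝ E).coord i)).contDiff.comp_contDiffOn (hT _)

theorem metricTrace_add (B : E →L[ℝ] E →L[ℝ] ℝ) (T T' : LinearMap.BilinForm ℝ E) :
    metricTrace B (T + T') = metricTrace B T + metricTrace B T' := by
  simp only [metricTrace, LinearMap.comp_add, map_add]

theorem metricTrace_sub (B : E →L[ℝ] E →L[ℝ] ℝ) (T T' : LinearMap.BilinForm ℝ E) :
    metricTrace B (T - T') = metricTrace B T - metricTrace B T' := by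
  simp only [metricTrace, LinearMap.comp_sub, map_sub]

theorem metricTrace_smul (B : E →L[ℝ] E →L[ℝ] ℝ) (c : ℝ) (T : LinearMap.BilinForm ℝ E) :
    metricTrace B (c • T) = c * metricTrace B T := by
  simp only [metricTrace, LinearMap.comp_smul, map_smul, smul_eq_mul]

theorem metricTrace_smulRight (B : E →L[ℝ] E →L[ℝ] ℝ) (α β : E →L[ℝ] ℝ) :
    metricTrace B ((α : E →ₗ[ℝ] ℝ).smulRight (β : E →ₗ[ℝ] ℝ)) = α (B.inverse β) := by
  have raise_index : (B.inverse : (E →L[ℝ] ℝ) →ₗ[ℝ] E) ∘ₗ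
      (LinearMap.toContinuousLinearMap : (E →ₗ[ℝ] ℝ) ≃ₗ[ℝ] (E →L[ℝ] ℝ)).toLinearMap ∘ₗ
        (α : E →ₗ[ℝ] ℝ).smulRight (β : E →ₗ[ℝ] ℝ) =
      (α : E →ₗ[ℝ] ℝ).smulRight (B.inverse β) := by
    ext X
    exact B.inverse.map_smul (α X) β
  rw [metricTrace, raise_index, LinearMap.trace_smulRight]
  rfl

theorem contDiffOn_metricTrace {B : V → E →L[ℝ] E →L[ℝ] ℝ} {T : V → LinearMap.BilinForm ℝ E}
    (hB : ContDiffOn ℝ ∞ (fun y => (B y).inverse) U)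
    (hT : ∀ X Y, ContDiffOn ℝ ∞ (fun y => T y X Y) U) :
    ContDiffOn ℝ ∞ (fun y => metricTrace (B y) (T y)) U :=
  contDiffOn_trace fun X => hB.clm_apply (contDiffOn_clm_apply.2 fun Y => hT X Y)

end Trace

section Operators

variable {U : Set E} {φ φ' f f' h : E → ℝ} {y : E}

/-- The inner product `g(∇f, ∇h)` of gradients in coordinates. -/
def coordGradInner (G : E → E →L[ℝ] E →L[ℝ] ℝ) (f h : E → ℝ) (y : E) : ℝ :=
  fderiv ℝ f y ((G y).inverse (fderiv ℝ h y))

theorem hessianForm_congr (G : E → E →L[ℝ] E →L[ℝ] ℝ) (hf : f =ᶠ[𝓝 y] f') :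
    hessianForm G f y = hessianForm G f' y := by
  ext X Y
  rw [hessianForm_apply, hessianForm_apply, hf.fderiv_eq, hf.fderiv.fderiv_eq]

theorem coordGradInner_congr (G : E → E →L[ℝ] E →L[ℝ] ℝ) (hf : f =ᶠ[𝓝 y] f')
    (hφ : φ =ᶠ[𝓝 y] φ') : coordGradInner G f φ y = coordGradInner G f' φ' y := by
  rw [coordGradInner, coordGradInner, hf.fderiv_eq, hφ.fderiv_eq]

variable [FiniteDimensional ℝ E]

/-- The Laplacian `Δf` in coordinates. -/
def coordLaplacian (G : E → E →L[ℝ] E →L[ℝ] ℝ) (f : E → ℝ) (y : E) : ℝ :=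
  metricTrace (G y) (hessianForm G f y)

/-- The scalar curvature `R` in coordinates. -/
def coordScalarCurvature (G : E → E →L[ℝ] E →L[ℝ] ℝ) (y : E) : ℝ :=
  metricTrace (G y) (ricciForm G y)

/-- The weighted Laplacian `Δ_φ f = Δf - g(∇φ, ∇f)` in coordinates. -/
def coordWeightedLaplacian (G : E → E →L[ℝ] E →L[ℝ] ℝ) (φ f : E → ℝ) (y : E) : ℝ :=
  coordLaplacian G f y - coordGradInner G φ f y

/-- The weighted scalar curvature `R_φ = R + 2Δφ - |∇φ|²` in coordinates. -/
def coordWeightedScalarCurvature (G : E → E →L[ℝ] E →L[ℝ] ℝ) (φ : E → ℝ) (y : E) : ℝ :=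
  coordScalarCurvature G y + 2 * coordLaplacian G φ y - coordGradInner G φ φ y

/-- The operator `Δ_φ - ¼ R_φ` in coordinates. -/
def coordGjmsFactor (G : E → E →L[ℝ] E →L[ℝ] ℝ) (φ f : E → ℝ) (y : E) : ℝ :=
  coordWeightedLaplacian G φ f y - 1 / 4 * coordWeightedScalarCurvature G φ y * f y

variable {G : E → E →L[ℝ] E →L[ℝ] ℝ}

theorem coordLaplacian_congr (G : E → E →L[ℝ] E →L[ℝ] ℝ) (hf : f =ᶠ[𝓝 y] f') :
    coordLaplacian G f y = coordLaplacian G f' y := by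
  rw [coordLaplacian, coordLaplacian, hessianForm_congr G hf]

namespace IsMetricOn

theorem contDiffOn_hessianForm (hG : IsMetricOn G U) (hf : ContDiffOn ℝ ∞ f U) (X Y : E) :
    ContDiffOn ℝ ∞ (fun y => hessianForm G f y X Y) U := by
  have hDf := contDiffOn_fderiv hG.isOpen hf
  have hD2f := contDiffOn_fderiv hG.isOpen hDf
  have hΓ := hG.contDiffOn_christoffel
  simp only [contDiffOn_clm_apply] at hD2f
  exact (hD2f X Y).sub
    (hDf.clm_apply (contDiffOn_clm_apply.1 (contDiffOn_clm_apply.1 hΓ X) Y))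

theorem contDiffOn_coordLaplacian (hG : IsMetricOn G U) (hf : ContDiffOn ℝ ∞ f U) :
    ContDiffOn ℝ ∞ (coordLaplacian G f) U :=
  contDiffOn_metricTrace hG.contDiffOn_inverse (hG.contDiffOn_hessianForm hf)

theorem contDiffOn_coordGradInner (hG : IsMetricOn G U) (hf : ContDiffOn ℝ ∞ f U)
    (hh : ContDiffOn ℝ ∞ h U) : ContDiffOn ℝ ∞ (coordGradInner G f h) U :=
  (contDiffOn_fderiv hG.isOpen hf).clm_apply
    (hG.contDiffOn_inverse.clm_apply (contDiffOn_fderiv hG.isOpen hh))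

theorem contDiffOn_coordScalarCurvature (hG : IsMetricOn G U) :
    ContDiffOn ℝ ∞ (coordScalarCurvature G) U :=
  contDiffOn_metricTrace hG.contDiffOn_inverse fun Y Z =>
    contDiffOn_trace fun X => hG.contDiffOn_curvatureEnd X Y Z

end IsMetricOn

end Operators

end Coordinates

/-! ### Naturality under local isometries -/

section Naturality

variable {E E' : Type*} [NormedAddCommGroup E] [NormedSpace ℝ E] [NormedAddCommGroup E']
  [NormedSpace ℝ E']

/-- `Φ` is a smooth local isometry from `(U, G)` to `(V, G')`. -/
structure IsIsometryOn (G : E → E →L[ℝ] E →L[ℝ] ℝ) (G' : E' → E' →L[ℝ] E' →L[ℝ] ℝ) (Φ : E → E')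
    (U : Set E) (V : Set E') : Prop where
  source : IsMetricOn G U
  target : IsMetricOn G' V
  contDiffOn : ContDiffOn ℝ ∞ Φ U
  mapsTo : Set.MapsTo Φ U V
  isInvertible : ∀ y ∈ U, (fderiv ℝ Φ y).IsInvertible
  pullback : ∀ y ∈ U, ∀ X Y, G y X Y = G' (Φ y) (fderiv ℝ Φ y X) (fderiv ℝ Φ y Y)

namespace IsIsometryOn

variable {G : E → E →L[ℝ] E →L[ℝ] ℝ} {G' : E' → E' →L[ℝ] E' →L[ℝ] ℝ} {Φ : E → E'} {U : Set E}
  {V : Set E'} {f k : E' → ℝ} {y : E}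

theorem contDiffAt_two (h : IsIsometryOn G G' Φ U V) (hy : y ∈ U) : ContDiffAt ℝ 2 Φ y :=
  contDiffAt_two_of_contDiffOn h.source.isOpen h.contDiffOn hy

theorem contDiffAt_two_fderiv (h : IsIsometryOn G G' Φ U V) (hy : y ∈ U) :
    ContDiffAt ℝ 2 (fderiv ℝ Φ) y :=
  contDiffAt_two_of_contDiffOn h.source.isOpen (contDiffOn_fderiv h.source.isOpen h.contDiffOn) hy

theorem hasFDerivAt (h : IsIsometryOn G G' Φ U V) (hy : y ∈ U) :
    HasFDerivAt Φ (fderiv ℝ Φ y) y :=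
  ((h.contDiffAt_two hy).differentiableAt two_ne_zero).hasFDerivAt

theorem hasFDerivAt_fderiv_apply (h : IsIsometryOn G G' Φ U V) (hy : y ∈ U) (X : E) :
    HasFDerivAt (fun z => fderiv ℝ Φ z X) ((fderiv ℝ (fderiv ℝ Φ) y).flip X) y :=
  hasFDerivAt_clm_apply_const (differentiableAt_fderiv (h.contDiffAt_two hy)).hasFDerivAt X

theorem fderiv_metric (h : IsIsometryOn G G' Φ U V) (hy : y ∈ U) (W X Y : E) :
    fderiv ℝ G y W X Y =
      fderiv ℝ G' (Φ y) (fderiv ℝ Φ y W) (fderiv ℝ Φ y X) (fderiv ℝ Φ y Y)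
      + G' (Φ y) (fderiv ℝ (fderiv ℝ Φ) y W X) (fderiv ℝ Φ y Y)
      + G' (Φ y) (fderiv ℝ Φ y X) (fderiv ℝ (fderiv ℝ Φ) y W Y) := by
  have metric_comp : HasFDerivAt (fun z => G' (Φ z)) (fderiv ℝ G' (Φ y) ∘L fderiv ℝ Φ y) y :=
    (h.target.differentiableAt (h.mapsTo hy)).hasFDerivAt.comp y (h.hasFDerivAt hy)
  have pullback_nhds : (fun z => G z X Y) =ᶠ[𝓝 y]
      fun z => G' (Φ z) (fderiv ℝ Φ z X) (fderiv ℝ Φ z Y) := by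
    filter_upwards [h.source.isOpen.mem_nhds hy] with z hz using h.pullback z hz X Y
  rw [← fderiv_clm_apply_const₂ (h.source.differentiableAt hy), pullback_nhds.fderiv_eq,
    ((metric_comp.clm_apply (h.hasFDerivAt_fderiv_apply hy X)).clm_apply
      (h.hasFDerivAt_fderiv_apply hy Y)).fderiv]
  simp
  ring

theorem christoffelLower_eq (h : IsIsometryOn G G' Φ U V) (hy : y ∈ U) (X Y Z : E) :
    christoffelLower G y X Y Z =
      christoffelLower G' (Φ y) (fderiv ℝ Φ y X) (fderiv ℝ Φ y Y) (fderiv ℝ Φ y Z)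
      + G' (Φ y) (fderiv ℝ (fderiv ℝ Φ) y X Y) (fderiv ℝ Φ y Z) := by
  have second_deriv_comm := fderiv_fderiv_comm (h.contDiffAt_two hy)
  simp only [christoffelLower_apply, h.fderiv_metric hy]
  rw [second_deriv_comm Y X, second_deriv_comm Z X, second_deriv_comm Z Y,
    h.target.symm _ (h.mapsTo hy) (fderiv ℝ Φ y Y) (fderiv ℝ (fderiv ℝ Φ) y X Z)]
  ring

theorem map_christoffel (h : IsIsometryOn G G' Φ U V) (hy : y ∈ U) (X Y : E) :
    fderiv ℝ Φ y (christoffel G y X Y) =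
      christoffel G' (Φ y) (fderiv ℝ Φ y X) (fderiv ℝ Φ y Y) + fderiv ℝ (fderiv ℝ Φ) y X Y := by
  rw [christoffel_apply G', ← sub_eq_iff_eq_add, eq_comm,
    (h.target.isInvertible _ (h.mapsTo hy)).inverse_apply_eq]
  ext Z
  obtain ⟨Z, rfl⟩ := (h.isInvertible y hy).surjective Z
  rw [map_sub, _root_.sub_apply, ← h.pullback y hy, christoffel_apply, h.source.apply_inverse hy,
    h.christoffelLower_eq hy]
  ring

theorem hessianForm_comp (h : IsIsometryOn G G' Φ U V) (hy : y ∈ U) (hf : ContDiffAt ℝ 2 f (Φ y))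
    (X Y : E) :
    hessianForm G (f ∘ Φ) y X Y = hessianForm G' f (Φ y) (fderiv ℝ Φ y X) (fderiv ℝ Φ y Y) := by
  rw [hessianForm_apply, hessianForm_apply, fderiv_fderiv_comp hf (h.contDiffAt_two hy),
    fderiv_comp y (hf.differentiableAt two_ne_zero) (h.hasFDerivAt hy).differentiableAt,
    ContinuousLinearMap.comp_apply, h.map_christoffel hy, map_add]
  ring

theorem map_inverse_comp (h : IsIsometryOn G G' Φ U V) (hy : y ∈ U) (α : E' →L[ℝ] ℝ) :
    fderiv ℝ Φ y ((G y).inverse (α ∘L fderiv ℝ Φ y)) = (G' (Φ y)).inverse α := by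
  rw [eq_comm, (h.target.isInvertible _ (h.mapsTo hy)).inverse_apply_eq]
  ext Z
  obtain ⟨Z, rfl⟩ := (h.isInvertible y hy).surjective Z
  rw [← h.pullback y hy, h.source.apply_inverse hy]
  rfl

theorem coordGradInner_comp (h : IsIsometryOn G G' Φ U V) (hy : y ∈ U)
    (hf : DifferentiableAt ℝ f (Φ y)) (hk : DifferentiableAt ℝ k (Φ y)) :
    coordGradInner G (f ∘ Φ) (k ∘ Φ) y = coordGradInner G' f k (Φ y) := by
  have hΦ := (h.hasFDerivAt hy).differentiableAt
  rw [coordGradInner, coordGradInner, fderiv_comp y hf hΦ, fderiv_comp y hk hΦ,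
    ContinuousLinearMap.comp_apply, h.map_inverse_comp hy]

variable [FiniteDimensional ℝ E]

theorem metricTrace_eq [FiniteDimensional ℝ E'] (h : IsIsometryOn G G' Φ U V) (hy : y ∈ U)
    {T : LinearMap.BilinForm ℝ E} {T' : LinearMap.BilinForm ℝ E'}
    (hT : ∀ X Y, T X Y = T' (fderiv ℝ Φ y X) (fderiv ℝ Φ y Y)) :
    metricTrace (G y) T = metricTrace (G' (Φ y)) T' := by
  obtain ⟨e, he⟩ := h.isInvertible y hy
  rw [metricTrace, metricTrace, ← LinearMap.trace_conj' _ e.toLinearEquiv]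
  congr 1
  ext X
  have pullback_covector : LinearMap.toContinuousLinearMap (T (e.symm X)) =
      LinearMap.toContinuousLinearMap (T' X) ∘L fderiv ℝ Φ y := by
    ext Z
    simp [hT, ← he]
  have := h.map_inverse_comp hy (LinearMap.toContinuousLinearMap (T' X))
  rw [← pullback_covector, ← he] at this
  simpa [LinearEquiv.conj_apply] using this

variable [FiniteDimensional ℝ E']

theorem fderiv_map_christoffel (h : IsIsometryOn G G' Φ U V) (hy : y ∈ U) (W X Y : E) :
    fderiv ℝ (fderiv ℝ Φ) y W (christoffel G y X Y)
        + fderiv ℝ Φ y (fderiv ℝ (christoffel G) y W X Y) =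
      fderiv ℝ (christoffel G') (Φ y) (fderiv ℝ Φ y W) (fderiv ℝ Φ y X) (fderiv ℝ Φ y Y)
        + christoffel G' (Φ y) (fderiv ℝ (fderiv ℝ Φ) y W X) (fderiv ℝ Φ y Y)
        + christoffel G' (Φ y) (fderiv ℝ Φ y X) (fderiv ℝ (fderiv ℝ Φ) y W Y)
        + fderiv ℝ (fderiv ℝ (fderiv ℝ Φ)) y W X Y := by
  have lhs_deriv := (differentiableAt_fderiv (h.contDiffAt_two hy)).hasFDerivAt.clm_apply
    (hasFDerivAt_clm_apply_const₂ (h.source.differentiableAt_christoffel hy).hasFDerivAt X Y)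
  have christoffel_comp := (h.target.differentiableAt_christoffel (h.mapsTo hy)).hasFDerivAt.comp y
    (h.hasFDerivAt hy)
  have rhs_deriv := ((christoffel_comp.clm_apply (h.hasFDerivAt_fderiv_apply hy X)).clm_apply
    (h.hasFDerivAt_fderiv_apply hy Y)).add (hasFDerivAt_clm_apply_const₂
      (differentiableAt_fderiv (h.contDiffAt_two_fderiv hy)).hasFDerivAt X Y)
  have map_christoffel_nhds : (fun z => fderiv ℝ Φ z (christoffel G z X Y)) =ᶠ[𝓝 y]
      fun z => christoffel G' (Φ z) (fderiv ℝ Φ z X) (fderiv ℝ Φ z Y)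
        + fderiv ℝ (fderiv ℝ Φ) z X Y := by
    filter_upwards [h.source.isOpen.mem_nhds hy] with z hz using h.map_christoffel hz X Y
  have := DFunLike.congr_fun
    ((lhs_deriv.congr_of_eventuallyEq map_christoffel_nhds.symm).unique rhs_deriv) W
  simp only [add_apply, ContinuousLinearMap.comp_apply, ContinuousLinearMap.flip_apply,
    Function.comp_apply] at this
  rw [add_comm, this]
  abel

theorem map_curvatureEnd (h : IsIsometryOn G G' Φ U V) (hy : y ∈ U) (X Y Z : E) :
    fderiv ℝ Φ y (curvatureEnd G y Y Z X) =
      curvatureEnd G' (Φ y) (fderiv ℝ Φ y Y) (fderiv ℝ Φ y Z) (fderiv ℝ Φ y X) := by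
  simp only [curvatureEnd_apply, map_add, map_sub, h.map_christoffel hy,
    eq_sub_of_add_eq' (h.fderiv_map_christoffel hy _ _ _)]
  rw [fderiv_fderiv_comm (h.contDiffAt_two_fderiv hy) Y X,
    fderiv_fderiv_comm (h.contDiffAt_two hy) Y X]
  abel

theorem ricciForm_eq (h : IsIsometryOn G G' Φ U V) (hy : y ∈ U) (Y Z : E) :
    ricciForm G y Y Z = ricciForm G' (Φ y) (fderiv ℝ Φ y Y) (fderiv ℝ Φ y Z) := by
  obtain ⟨e, he⟩ := h.isInvertible y hy
  rw [ricciForm_apply, ricciForm_apply, ← LinearMap.trace_conj' _ e.toLinearEquiv]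
  congr 1
  ext X
  have := h.map_curvatureEnd hy (e.symm X) Y Z
  rw [← he] at this ⊢
  simpa [LinearEquiv.conj_apply] using this

theorem coordLaplacian_comp (h : IsIsometryOn G G' Φ U V) (hy : y ∈ U)
    (hf : ContDiffAt ℝ 2 f (Φ y)) : coordLaplacian G (f ∘ Φ) y = coordLaplacian G' f (Φ y) :=
  h.metricTrace_eq hy (h.hessianForm_comp hy hf)

theorem coordScalarCurvature_eq (h : IsIsometryOn G G' Φ U V) (hy : y ∈ U) :
    coordScalarCurvature G y = coordScalarCurvature G' (Φ y) :=
  h.metricTrace_eq hy (h.ricciForm_eq hy)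

end IsIsometryOn

end Naturality

/-! ### Conformal change of the weight in coordinates -/

section Leibniz

variable {E : Type*} [NormedAddCommGroup E] [NormedSpace ℝ E]
  {G : E → E →L[ℝ] E →L[ℝ] ℝ} {U : Set E} {φ v f f' h : E → ℝ} {y : E}

theorem IsMetricOn.coordGradInner_comm (hG : IsMetricOn G U) (f h : E → ℝ) (hy : y ∈ U) :
    coordGradInner G f h y = coordGradInner G h f y :=
  hG.apply_inverse_comm hy _ _

theorem coordGradInner_sub_left (hf : DifferentiableAt ℝ f y) (hf' : DifferentiableAt ℝ f' y) :
    coordGradInner G (f - f') h y = coordGradInner G f h y - coordGradInner G f' h y := by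
  rw [coordGradInner, fderiv_sub hf hf']
  rfl

theorem coordGradInner_add_right (hf : DifferentiableAt ℝ f y) (hf' : DifferentiableAt ℝ f' y) :
    coordGradInner G h (f + f') y = coordGradInner G h f y + coordGradInner G h f' y := by
  simp only [coordGradInner, fderiv_add hf hf', map_add]

theorem coordGradInner_sub_right (hf : DifferentiableAt ℝ f y) (hf' : DifferentiableAt ℝ f' y) :
    coordGradInner G h (f - f') y = coordGradInner G h f y - coordGradInner G h f' y := by
  simp only [coordGradInner, fderiv_sub hf hf', map_sub]

theorem coordGradInner_const_mul_right (hf : DifferentiableAt ℝ f y) (c : ℝ) :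
    coordGradInner G h (fun z => c * f z) y = c * coordGradInner G h f y := by
  simp only [coordGradInner, fderiv_const_mul hf, map_smul, smul_eq_mul]

theorem coordGradInner_mul_right (hf : DifferentiableAt ℝ f y) (hf' : DifferentiableAt ℝ f' y) :
    coordGradInner G h (f * f') y =
      f y * coordGradInner G h f' y + f' y * coordGradInner G h f y := by
  simp only [coordGradInner, fderiv_mul hf hf', map_add, map_smul, smul_eq_mul]

theorem coordGradInner_exp_right (hf : DifferentiableAt ℝ f y) :
    coordGradInner G h (fun z => Real.exp (f z)) y = Real.exp (f y) * coordGradInner G h f y := by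
  simp only [coordGradInner, fderiv_exp hf, map_smul, smul_eq_mul]

theorem hessianForm_add (hf : ContDiffAt ℝ 2 f y) (hf' : ContDiffAt ℝ 2 f' y) :
    hessianForm G (f + f') y = hessianForm G f y + hessianForm G f' y := by
  have fderiv_nhds : fderiv ℝ (f + f') =ᶠ[𝓝 y] fderiv ℝ f + fderiv ℝ f' := by
    filter_upwards [eventually_differentiableAt hf, eventually_differentiableAt hf'] with z hz hz'
    exact fderiv_add hz hz'
  ext X Y
  rw [hessianForm_apply, fderiv_nhds.fderiv_eq, fderiv_nhds.eq_of_nhds,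
    fderiv_add (differentiableAt_fderiv hf) (differentiableAt_fderiv hf')]
  simp only [LinearMap.add_apply, hessianForm_apply, add_apply, Pi.add_apply]
  ring

theorem hessianForm_mul (hf : ContDiffAt ℝ 2 f y) (hf' : ContDiffAt ℝ 2 f' y) (X Y : E) :
    hessianForm G (f * f') y X Y = f y * hessianForm G f' y X Y + f' y * hessianForm G f y X Y
      + (fderiv ℝ f y X * fderiv ℝ f' y Y + fderiv ℝ f' y X * fderiv ℝ f y Y) := by
  have fderiv_nhds : fderiv ℝ (f * f') =ᶠ[𝓝 y]
      fun z => f z • fderiv ℝ f' z + f' z • fderiv ℝ f z := by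
    filter_upwards [eventually_differentiableAt hf, eventually_differentiableAt hf'] with z hz hz'
    exact fderiv_mul hz hz'
  have second_deriv : HasFDerivAt (fun z => f z • fderiv ℝ f' z + f' z • fderiv ℝ f z) _ y :=
    ((hf.differentiableAt two_ne_zero).hasFDerivAt.smul
      (differentiableAt_fderiv hf').hasFDerivAt).add
    ((hf'.differentiableAt two_ne_zero).hasFDerivAt.smul (differentiableAt_fderiv hf).hasFDerivAt)
  rw [hessianForm_apply, hessianForm_apply, hessianForm_apply, fderiv_nhds.fderiv_eq,
    second_deriv.fderiv, fderiv_nhds.eq_of_nhds]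
  simp
  ring

theorem hessianForm_const_mul (hf : ContDiffAt ℝ 2 f y) (c : ℝ) :
    hessianForm G (fun z => c * f z) y = c • hessianForm G f y := by
  have fderiv_nhds : fderiv ℝ (fun z => c * f z) =ᶠ[𝓝 y] c • fderiv ℝ f := by
    filter_upwards [eventually_differentiableAt hf] with z hz using fderiv_const_mul hz c
  ext X Y
  rw [hessianForm_apply, fderiv_nhds.fderiv_eq, fderiv_nhds.eq_of_nhds,
    fderiv_const_smul (differentiableAt_fderiv hf)]
  simp [hessianForm_apply, mul_sub]

theorem hessianForm_sub (hf : ContDiffAt ℝ 2 f y) (hf' : ContDiffAt ℝ 2 f' y) :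
    hessianForm G (f - f') y = hessianForm G f y - hessianForm G f' y := by
  have sub_eq : f - f' = f + fun z => -1 * f' z := by
    ext z
    simp [sub_eq_add_neg]
  rw [sub_eq, hessianForm_add hf (contDiffAt_const.mul hf'), hessianForm_const_mul hf',
    neg_one_smul, sub_eq_add_neg]

theorem hessianForm_exp (hf : ContDiffAt ℝ 2 f y) (X Y : E) :
    hessianForm G (fun z => Real.exp (f z)) y X Y =
      Real.exp (f y) * (hessianForm G f y X Y + fderiv ℝ f y X * fderiv ℝ f y Y) := by
  have fderiv_nhds : fderiv ℝ (fun z => Real.exp (f z)) =ᶠ[𝓝 y]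
      fun z => Real.exp (f z) • fderiv ℝ f z := by
    filter_upwards [eventually_differentiableAt hf] with z hz using fderiv_exp hz
  have second_deriv : HasFDerivAt (fun z => Real.exp (f z) • fderiv ℝ f z) _ y :=
    (hf.differentiableAt two_ne_zero).hasFDerivAt.exp.smul (differentiableAt_fderiv hf).hasFDerivAt
  rw [hessianForm_apply, hessianForm_apply, fderiv_nhds.fderiv_eq, second_deriv.fderiv,
    fderiv_nhds.eq_of_nhds]
  simp
  ring

variable [FiniteDimensional ℝ E]

theorem coordLaplacian_add (hf : ContDiffAt ℝ 2 f y) (hf' : ContDiffAt ℝ 2 f' y) :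
    coordLaplacian G (f + f') y = coordLaplacian G f y + coordLaplacian G f' y := by
  rw [coordLaplacian, hessianForm_add hf hf', metricTrace_add]
  rfl

theorem coordLaplacian_sub (hf : ContDiffAt ℝ 2 f y) (hf' : ContDiffAt ℝ 2 f' y) :
    coordLaplacian G (f - f') y = coordLaplacian G f y - coordLaplacian G f' y := by
  rw [coordLaplacian, hessianForm_sub hf hf', metricTrace_sub]
  rfl

theorem coordLaplacian_const_mul (hf : ContDiffAt ℝ 2 f y) (c : ℝ) :
    coordLaplacian G (fun z => c * f z) y = c * coordLaplacian G f y := by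
  rw [coordLaplacian, hessianForm_const_mul hf, metricTrace_smul]
  rfl

theorem coordLaplacian_mul (hf : ContDiffAt ℝ 2 f y) (hf' : ContDiffAt ℝ 2 f' y) :
    coordLaplacian G (f * f') y = f y * coordLaplacian G f' y + f' y * coordLaplacian G f y
      + (coordGradInner G f f' y + coordGradInner G f' f y) := by
  have hessian_eq : hessianForm G (f * f') y =
      f y • hessianForm G f' y + f' y • hessianForm G f y
        + ((fderiv ℝ f y : E →ₗ[ℝ] ℝ).smulRight (fderiv ℝ f' y : E →ₗ[ℝ] ℝ)
          + (fderiv ℝ f' y : E →ₗ[ℝ] ℝ).smulRight (fderiv ℝ f y : E →ₗ[ℝ] ℝ)) :=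
    LinearMap.ext₂ (hessianForm_mul hf hf')
  rw [coordLaplacian, hessian_eq, metricTrace_add, metricTrace_add, metricTrace_add,
    metricTrace_smul, metricTrace_smul, metricTrace_smulRight, metricTrace_smulRight]
  rfl

theorem coordLaplacian_exp (hf : ContDiffAt ℝ 2 f y) :
    coordLaplacian G (fun z => Real.exp (f z)) y =
      Real.exp (f y) * (coordLaplacian G f y + coordGradInner G f f y) := by
  have hessian_eq : hessianForm G (fun z => Real.exp (f z)) y = Real.exp (f y) •
      (hessianForm G f y + (fderiv ℝ f y : E →ₗ[ℝ] ℝ).smulRight (fderiv ℝ f y : E →ₗ[ℝ] ℝ)) :=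
    LinearMap.ext₂ (hessianForm_exp hf)
  rw [coordLaplacian, hessian_eq, metricTrace_smul, metricTrace_add, metricTrace_smulRight]
  rfl

theorem coordWeightedLaplacian_add (hf : ContDiffAt ℝ 2 f y) (hf' : ContDiffAt ℝ 2 f' y) :
    coordWeightedLaplacian G φ (f + f') y =
      coordWeightedLaplacian G φ f y + coordWeightedLaplacian G φ f' y := by
  rw [coordWeightedLaplacian, coordLaplacian_add hf hf', coordGradInner_add_right
    (hf.differentiableAt two_ne_zero) (hf'.differentiableAt two_ne_zero), add_sub_add_comm]
  rfl

theorem coordWeightedLaplacian_const_mul (hf : ContDiffAt ℝ 2 f y) (c : ℝ) :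
    coordWeightedLaplacian G φ (fun z => c * f z) y = c * coordWeightedLaplacian G φ f y := by
  rw [coordWeightedLaplacian, coordLaplacian_const_mul hf,
    coordGradInner_const_mul_right (hf.differentiableAt two_ne_zero), ← mul_sub]
  rfl

theorem coordWeightedLaplacian_mul (hf : ContDiffAt ℝ 2 f y) (hf' : ContDiffAt ℝ 2 f' y) :
    coordWeightedLaplacian G φ (f * f') y = f y * coordWeightedLaplacian G φ f' y
      + f' y * coordWeightedLaplacian G φ f y
      + (coordGradInner G f f' y + coordGradInner G f' f y) := by
  simp only [coordWeightedLaplacian, coordLaplacian_mul hf hf', coordGradInner_mul_right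
    (hf.differentiableAt two_ne_zero) (hf'.differentiableAt two_ne_zero)]
  ring

namespace IsMetricOn

theorem coordWeightedScalarCurvature_sub (hG : IsMetricOn G U) (hy : y ∈ U)
    (hφ : ContDiffAt ℝ 2 φ y) (hv : ContDiffAt ℝ 2 v y) :
    coordWeightedScalarCurvature G (φ - v) y = coordWeightedScalarCurvature G φ y
      - (2 * coordWeightedLaplacian G φ v y + coordGradInner G v v y) := by
  have hDφ := hφ.differentiableAt two_ne_zero
  have hDv := hv.differentiableAt two_ne_zero
  simp only [coordWeightedScalarCurvature, coordWeightedLaplacian, coordLaplacian_sub hφ hv,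
    coordGradInner_sub_left hDφ hDv, coordGradInner_sub_right hDφ hDv,
    hG.coordGradInner_comm v φ hy]
  ring

theorem coordWeightedLaplacian_exp_mul (hG : IsMetricOn G U) (hy : y ∈ U)
    (hφ : ContDiffAt ℝ 2 φ y) (hv : ContDiffAt ℝ 2 v y) (hf : ContDiffAt ℝ 2 f y) :
    coordWeightedLaplacian G (φ - v) ((fun z => Real.exp (-1 / 2 * v z)) * f) y =
      Real.exp (-1 / 2 * v y) * (coordWeightedLaplacian G φ f y
        - 1 / 4 * (2 * coordWeightedLaplacian G φ v y + coordGradInner G v v y) * f y) := by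
  have hφ_diff := hφ.differentiableAt two_ne_zero
  have hv_diff := hv.differentiableAt two_ne_zero
  have hf_diff := hf.differentiableAt two_ne_zero
  have hw : ContDiffAt ℝ 2 (fun z => -1 / 2 * v z) y := contDiffAt_const.mul hv
  have hw_diff := hw.differentiableAt two_ne_zero
  have grad_exp : ∀ h, coordGradInner G h (fun z => Real.exp (-1 / 2 * v z)) y =
      Real.exp (-1 / 2 * v y) * (-1 / 2 * coordGradInner G h v y) := fun h => by
    rw [coordGradInner_exp_right hw_diff, coordGradInner_const_mul_right hv_diff]
  have laplacian_exp : coordLaplacian G (fun z => Real.exp (-1 / 2 * v z)) y =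
      Real.exp (-1 / 2 * v y) *
        (-1 / 2 * coordLaplacian G v y + 1 / 4 * coordGradInner G v v y) := by
    rw [coordLaplacian_exp hw, coordLaplacian_const_mul hv, coordGradInner_const_mul_right hv_diff,
      hG.coordGradInner_comm _ v hy, coordGradInner_const_mul_right hv_diff]
    ring
  simp only [coordWeightedLaplacian, coordLaplacian_mul hw.exp hf, laplacian_exp,
    coordGradInner_mul_right hw_diff.exp hf_diff, coordGradInner_sub_left hφ_diff hv_diff, grad_exp,
    hG.coordGradInner_comm (fun z => Real.exp (-1 / 2 * v z)) f hy, hG.coordGradInner_comm f v hy]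
  ring

/-- The two corrections, `-¼ (2 Δ_φ v + |∇v|²)` from the Laplacian and `-(2 Δ_φ v + |∇v|²)` from
`R_φ`, cancel exactly because of the factor `¼`. -/
theorem coordGjmsFactor_conformal (hG : IsMetricOn G U) (hy : y ∈ U) (hφ : ContDiffAt ℝ 2 φ y)
    (hv : ContDiffAt ℝ 2 v y) (hf : ContDiffAt ℝ 2 f y) :
    coordGjmsFactor G (φ - v) ((fun z => Real.exp (-1 / 2 * v z)) * f) y =
      Real.exp (-1 / 2 * v y) * coordGjmsFactor G φ f y := by
  rw [coordGjmsFactor, hG.coordWeightedLaplacian_exp_mul hy hφ hv hf,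
    hG.coordWeightedScalarCurvature_sub hy hφ hv, Pi.mul_apply, coordGjmsFactor]
  ring

end IsMetricOn

end Leibniz

/-! ### Chart expressions of a smooth metric -/

section Manifold

variable {E : Type*} [NormedAddCommGroup E] [NormedSpace ℝ E]
  {H : Type*} [TopologicalSpace H] (I : ModelWithCorners ℝ E H)
  {M : Type*} [TopologicalSpace M] [ChartedSpace H M]

/-- `g` restricts to a smooth pseudo-Riemannian metric on the open set `S`. -/
structure IsSmoothMetricOn [IsManifold I ∞ M]
    (g : ∀ x : M, TangentSpace I x →L[ℝ] TangentSpace I x →L[ℝ] ℝ) (S : Set M) : Prop where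
  isOpen : IsOpen S
  contMDiffOn : ContMDiffOn I (I.prod 𝓘(ℝ, E →L[ℝ] E →L[ℝ] ℝ)) ∞
    (fun x : M => Bundle.TotalSpace.mk' (E →L[ℝ] E →L[ℝ] ℝ)
      (E := fun x : M => TangentSpace I x →L[ℝ] TangentSpace I x →L[ℝ] ℝ) x (g x)) S
  symm : ∀ x ∈ S, ∀ X Y, g x X Y = g x Y X
  nondegenerate : ∀ x ∈ S, ∀ X, (∀ Y, g x X Y = 0) → X = 0

/-- The part of the range of the chart at `x` that corresponds to `S`. -/
def chartSet (x : M) (S : Set M) : Set E :=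
  (extChartAt I x).target ∩ (extChartAt I x).symm ⁻¹' S

/-- The differential of the inverse of the chart at `x`, as an endomorphism of the model space. -/
def chartDeriv (x : M) (y : E) : E →L[ℝ] E :=
  mfderiv 𝓘(ℝ, E) I (extChartAt I x).symm y

variable {I}

theorem mem_chartSet {x z : M} {S : Set M} (hz : z ∈ S) (hx : z ∈ (extChartAt I x).source) :
    extChartAt I x z ∈ chartSet I x S :=
  ⟨(extChartAt I x).map_source hx, by rwa [Set.mem_preimage, (extChartAt I x).left_inv hx]⟩

theorem chartMetric_apply (g : ∀ x : M, TangentSpace I x →L[ℝ] TangentSpace I x →L[ℝ] ℝ) (x : M)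
    (y X Y : E) : chartMetric I g x y X Y =
      (show E →L[ℝ] E →L[ℝ] ℝ from g ((extChartAt I x).symm y)) (chartDeriv I x y X)
        (chartDeriv I x y Y) := rfl

theorem weightedLaplacian_congr [FiniteDimensional ℝ E]
    {g : ∀ x : M, TangentSpace I x →L[ℝ] TangentSpace I x →L[ℝ] ℝ}
    {φ f f' : M → ℝ} {x : M} (hf : f =ᶠ[𝓝 x] f') :
    weightedLaplacian I g φ f x = weightedLaplacian I g φ f' x := by
  have expr_nhds : f ∘ (extChartAt I x).symm =ᶠ[𝓝 (extChartAt I x x)]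
      f' ∘ (extChartAt I x).symm := by
    have symm_tendsto := continuousAt_extChartAt_symm (I := I) x
    rw [ContinuousAt, extChartAt_to_inv] at symm_tendsto
    exact symm_tendsto.eventually hf
  exact congrArg₂ (· - ·) (coordLaplacian_congr _ expr_nhds)
    (coordGradInner_congr _ Filter.EventuallyEq.rfl expr_nhds)

section

variable [IsManifold I ∞ M]

theorem contDiffOn_comp_symm {f : M → ℝ} {S : Set M} (hf : ContMDiffOn I 𝓘(ℝ, ℝ) ∞ f S) (x : M) :
    ContDiffOn ℝ ∞ (f ∘ (extChartAt I x).symm) (chartSet I x S) :=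
  contMDiffOn_iff_contDiffOn.1
    (hf.comp ((contMDiffOn_extChartAt_symm x).mono Set.inter_subset_left) Set.inter_subset_right)

theorem contMDiffOn_of_forall_chart {S : Set M} (hS : IsOpen S) {F : M → ℝ} {F' : M → E → ℝ}
    (hF' : ∀ x, ContDiffOn ℝ ∞ (F' x) (chartSet I x S))
    (hF : ∀ x z, z ∈ S → z ∈ (extChartAt I x).source → F z = F' x (extChartAt I x z)) :
    ContMDiffOn I 𝓘(ℝ, ℝ) ∞ F S := by
  intro x hx
  have smooth_near : ContMDiffOn I 𝓘(ℝ, ℝ) ∞ F (S ∩ (extChartAt I x).source) := by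
    refine ((contMDiffOn_iff_contDiffOn.2 (hF' x)).comp
      ((contMDiffOn_extChartAt (n := ∞)).mono fun z hz => ?_) fun z hz =>
        mem_chartSet hz.1 hz.2).congr fun z hz => hF x z hz.1 hz.2
    rw [← extChartAt_source I]
    exact hz.2
  exact (smooth_near.contMDiffAt ((hS.inter (isOpen_extChartAt_source x)).mem_nhds
    ⟨hx, mem_extChartAt_source x⟩)).contMDiffWithinAt

end

variable [I.Boundaryless]

theorem isOpen_chartSet (x : M) {S : Set M} (hS : IsOpen S) : IsOpen (chartSet I x S) :=
  (continuousOn_extChartAt_symm x).isOpen_inter_preimage (isOpen_extChartAt_target x) hS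

theorem comp_symm_comp_chartChange_eventuallyEq (f : M → ℝ) {x z : M}
    (hx : z ∈ (extChartAt I x).source) :
    (f ∘ (extChartAt I x).symm) ∘ (extChartAt I x ∘ (extChartAt I z).symm)
      =ᶠ[𝓝 (extChartAt I z z)] f ∘ (extChartAt I z).symm := by
  filter_upwards [(isOpen_chartSet z (isOpen_extChartAt_source x)).mem_nhds
    (mem_chartSet hx (mem_extChartAt_source z))] with y hy
  exact congrArg f ((extChartAt I x).left_inv hy.2)

variable [IsManifold I ∞ M]

theorem mdifferentiableAt_extChartAt_symm {x : M} {y : E} (hy : y ∈ (extChartAt I x).target) :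
    MDifferentiableAt 𝓘(ℝ, E) I (extChartAt I x).symm y :=
  ((contMDiffOn_extChartAt_symm (n := ∞) x).contMDiffAt
    ((isOpen_extChartAt_target x).mem_nhds hy)).mdifferentiableAt (by simp)

theorem isInvertible_chartDeriv {x : M} {y : E} (hy : y ∈ (extChartAt I x).target) :
    (chartDeriv I x y).IsInvertible := by
  have : IsManifold I 1 M := IsManifold.of_le (n := ∞) (by simp)
  have isInvertible_within := isInvertible_mfderivWithin_extChartAt_symm hy
  rwa [I.range_eq_univ, mfderivWithin_univ] at isInvertible_within

theorem contMDiffOn_chartDeriv (x : M) (X : E) :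
    ContMDiffOn 𝓘(ℝ, E) I.tangent ∞ (fun y => Bundle.TotalSpace.mk' E
      (E := TangentSpace I) ((extChartAt I x).symm y) (chartDeriv I x y X))
      (extChartAt I x).target := by
  have tangentMap_smooth := (contMDiffOn_extChartAt_symm (I := I) (n := ∞)
    x).contMDiffOn_tangentMapWithin (m := ∞) (by simp) (isOpen_extChartAt_target x).uniqueMDiffOn
  have const_smooth : ContMDiffOn 𝓘(ℝ, E) 𝓘(ℝ, E).tangent ∞ (fun y => Bundle.TotalSpace.mk' E
      (E := TangentSpace 𝓘(ℝ, E)) y X) (extChartAt I x).target :=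
    contMDiffOn_vectorSpace_iff_contDiffOn.2 contDiffOn_const
  refine (tangentMap_smooth.comp const_smooth fun y hy => hy).congr fun y hy => ?_
  simp only [Function.comp_apply, tangentMapWithin]
  rw [mfderivWithin_of_isOpen (isOpen_extChartAt_target x) hy]
  rfl

theorem chartDeriv_eq_comp_fderiv_chartChange {x x' : M} {y : E}
    (hy : y ∈ chartSet I x (extChartAt I x').source) :
    chartDeriv I x y = chartDeriv I x' (extChartAt I x' ((extChartAt I x).symm y)) ∘L
      fderiv ℝ (extChartAt I x' ∘ (extChartAt I x).symm) y := by
  have isOpen_overlap := isOpen_chartSet (I := I) x (isOpen_extChartAt_source (I := I) x')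
  have symm_nhds : (extChartAt I x).symm =ᶠ[𝓝 y]
      (extChartAt I x').symm ∘ (extChartAt I x' ∘ (extChartAt I x).symm) := by
    filter_upwards [isOpen_overlap.mem_nhds hy] with z hz
    exact ((extChartAt I x').left_inv hz.2).symm
  have chartChange_deriv := (differentiableAt_of_contDiffOn isOpen_overlap
    (contDiffOn_ext_coord_change (I := I) x' x) hy).hasFDerivAt
  exact ((HasMFDerivAt.comp y (mdifferentiableAt_extChartAt_symm
    ((extChartAt I x').map_source hy.2)).hasMFDerivAt
      chartChange_deriv.hasMFDerivAt).congr_of_eventuallyEq symm_nhds).mfderiv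

theorem isInvertible_fderiv_chartChange {x x' : M} {y : E}
    (hy : y ∈ chartSet I x (extChartAt I x').source) :
    (fderiv ℝ (extChartAt I x' ∘ (extChartAt I x).symm) y).IsInvertible := by
  have hx' := isInvertible_chartDeriv ((extChartAt I x').map_source hy.2)
  have fderiv_eq := congrArg
    ((chartDeriv I x' (extChartAt I x' ((extChartAt I x).symm y))).inverse ∘L ·)
    (chartDeriv_eq_comp_fderiv_chartChange hy)
  rw [← ContinuousLinearMap.comp_assoc, hx'.inverse_comp_self, ContinuousLinearMap.id_comp]
    at fderiv_eq
  rw [← fderiv_eq]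
  exact hx'.inverse.comp (isInvertible_chartDeriv hy.1)

variable [FiniteDimensional ℝ E] {g : ∀ x : M, TangentSpace I x →L[ℝ] TangentSpace I x →L[ℝ] ℝ}
  {S : Set M}

namespace IsSmoothMetricOn

theorem contDiffOn_chartMetric (hg : IsSmoothMetricOn I g S) (x : M) :
    ContDiffOn ℝ ∞ (chartMetric I g x) (chartSet I x S) := by
  refine contDiffOn_clm_apply.2 fun X => contDiffOn_clm_apply.2 fun Y => ?_
  have metric_smooth := hg.contMDiffOn.comp ((contMDiffOn_extChartAt_symm x).mono
    Set.inter_subset_left) (Set.inter_subset_right : chartSet I x S ⊆ _)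
  have section_smooth : ContMDiffOn 𝓘(ℝ, E) (I.prod 𝓘(ℝ)) ∞
      (fun y => Bundle.TotalSpace.mk' ℝ (E := Bundle.Trivial M ℝ) ((extChartAt I x).symm y)
        (chartMetric I g x y X Y)) (chartSet I x S) :=
    ContMDiffOn.clm_bundle_apply₂ (F₁ := E) (F₂ := E) metric_smooth
      ((contMDiffOn_chartDeriv x X).mono Set.inter_subset_left)
      ((contMDiffOn_chartDeriv x Y).mono Set.inter_subset_left)
  exact contMDiffOn_iff_contDiffOn.1 fun y hy =>
    (Bundle.contMDiffWithinAt_totalSpace.1 (section_smooth y hy)).2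

theorem isMetricOn_chartMetric (hg : IsSmoothMetricOn I g S) (x : M) :
    IsMetricOn (chartMetric I g x) (chartSet I x S) where
  isOpen := isOpen_chartSet x hg.isOpen
  contDiffOn := hg.contDiffOn_chartMetric x
  symm y hy X Y := hg.symm _ hy.2 _ _
  isInvertible y hy := by
    have hd := isInvertible_chartDeriv hy.1
    refine isInvertible_of_nondegenerate fun X hX =>
      hd.injective ((hg.nondegenerate _ hy.2 _ fun Z => ?_).trans (map_zero _).symm)
    obtain ⟨Y, rfl⟩ := hd.surjective Z
    exact hX Y

theorem isIsometryOn_chartChange (hg : IsSmoothMetricOn I g S) (x x' : M) :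
    IsIsometryOn (chartMetric I g x) (chartMetric I g x')
      (extChartAt I x' ∘ (extChartAt I x).symm)
      (chartSet I x (S ∩ (extChartAt I x').source)) (chartSet I x' S) where
  source := (hg.isMetricOn_chartMetric x).mono
    (isOpen_chartSet x (hg.isOpen.inter (isOpen_extChartAt_source x'))) fun _ hy => ⟨hy.1, hy.2.1⟩
  target := hg.isMetricOn_chartMetric x'
  contDiffOn := (contDiffOn_ext_coord_change x' x).mono fun _ hy => ⟨hy.1, hy.2.2⟩
  mapsTo _ hy := mem_chartSet hy.2.1 hy.2.2
  isInvertible _ hy := isInvertible_fderiv_chartChange ⟨hy.1, hy.2.2⟩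
  pullback y hy X Y := by
    rw [chartMetric_apply, chartMetric_apply,
      chartDeriv_eq_comp_fderiv_chartChange ⟨hy.1, hy.2.2⟩, Function.comp_apply,
      (extChartAt I x').left_inv hy.2.2]
    rfl

variable {φ f h : M → ℝ} {x z : M}

theorem laplacian_eq (hg : IsSmoothMetricOn I g S) (hf : ContMDiffOn I 𝓘(ℝ, ℝ) ∞ f S) (hz : z ∈ S)
    (hx : z ∈ (extChartAt I x).source) : laplacian I g f z =
      coordLaplacian (chartMetric I g x) (f ∘ (extChartAt I x).symm) (extChartAt I x z) := by
  have isometry := hg.isIsometryOn_chartChange z x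
  have hz' : extChartAt I z z ∈ chartSet I z (S ∩ (extChartAt I x).source) :=
    mem_chartSet ⟨hz, hx⟩ (mem_extChartAt_source z)
  have naturality := isometry.coordLaplacian_comp hz' (contDiffAt_two_of_contDiffOn
    (isOpen_chartSet x hg.isOpen) (contDiffOn_comp_symm hf x) (isometry.mapsTo hz'))
  rwa [coordLaplacian_congr _ (comp_symm_comp_chartChange_eventuallyEq f hx),
    Function.comp_apply, extChartAt_to_inv] at naturality

theorem gradInner_eq (hg : IsSmoothMetricOn I g S) (hf : ContMDiffOn I 𝓘(ℝ, ℝ) ∞ f S)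
    (hh : ContMDiffOn I 𝓘(ℝ, ℝ) ∞ h S) (hz : z ∈ S)
    (hx : z ∈ (extChartAt I x).source) : gradInner I g f h z =
      coordGradInner (chartMetric I g x) (f ∘ (extChartAt I x).symm)
        (h ∘ (extChartAt I x).symm) (extChartAt I x z) := by
  have isometry := hg.isIsometryOn_chartChange z x
  have hz' : extChartAt I z z ∈ chartSet I z (S ∩ (extChartAt I x).source) :=
    mem_chartSet ⟨hz, hx⟩ (mem_extChartAt_source z)
  have differentiable : ∀ {f : M → ℝ}, ContMDiffOn I 𝓘(ℝ, ℝ) ∞ f S → _ := fun hf =>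
    differentiableAt_of_contDiffOn (isOpen_chartSet x hg.isOpen) (contDiffOn_comp_symm hf x)
      (isometry.mapsTo hz')
  have naturality := isometry.coordGradInner_comp hz' (differentiable hf) (differentiable hh)
  rwa [coordGradInner_congr _ (comp_symm_comp_chartChange_eventuallyEq f hx)
    (comp_symm_comp_chartChange_eventuallyEq h hx), Function.comp_apply,
    extChartAt_to_inv] at naturality

theorem scalarCurvature_eq (hg : IsSmoothMetricOn I g S) (hz : z ∈ S)
    (hx : z ∈ (extChartAt I x).source) : scalarCurvature I g z =
      coordScalarCurvature (chartMetric I g x) (extChartAt I x z) := by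
  have naturality := (hg.isIsometryOn_chartChange z x).coordScalarCurvature_eq
    (mem_chartSet ⟨hz, hx⟩ (mem_extChartAt_source z))
  rwa [Function.comp_apply, extChartAt_to_inv] at naturality

theorem contMDiffOn_laplacian (hg : IsSmoothMetricOn I g S) (hf : ContMDiffOn I 𝓘(ℝ, ℝ) ∞ f S) :
    ContMDiffOn I 𝓘(ℝ, ℝ) ∞ (laplacian I g f) S :=
  contMDiffOn_of_forall_chart hg.isOpen
    (fun x => (hg.isMetricOn_chartMetric x).contDiffOn_coordLaplacian (contDiffOn_comp_symm hf x))
    fun _ _ hz hx => hg.laplacian_eq hf hz hx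

theorem contMDiffOn_gradInner (hg : IsSmoothMetricOn I g S) (hf : ContMDiffOn I 𝓘(ℝ, ℝ) ∞ f S)
    (hh : ContMDiffOn I 𝓘(ℝ, ℝ) ∞ h S) : ContMDiffOn I 𝓘(ℝ, ℝ) ∞ (gradInner I g f h) S :=
  contMDiffOn_of_forall_chart hg.isOpen
    (fun x => (hg.isMetricOn_chartMetric x).contDiffOn_coordGradInner (contDiffOn_comp_symm hf x)
      (contDiffOn_comp_symm hh x))
    fun _ _ hz hx => hg.gradInner_eq hf hh hz hx

theorem contMDiffOn_scalarCurvature (hg : IsSmoothMetricOn I g S) :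
    ContMDiffOn I 𝓘(ℝ, ℝ) ∞ (scalarCurvature I g) S :=
  contMDiffOn_of_forall_chart hg.isOpen
    (fun x => (hg.isMetricOn_chartMetric x).contDiffOn_coordScalarCurvature)
    fun _ _ hz hx => hg.scalarCurvature_eq hz hx

theorem contMDiffOn_weightedLaplacian (hg : IsSmoothMetricOn I g S)
    (hφ : ContMDiffOn I 𝓘(ℝ, ℝ) ∞ φ S) (hf : ContMDiffOn I 𝓘(ℝ, ℝ) ∞ f S) :
    ContMDiffOn I 𝓘(ℝ, ℝ) ∞ (weightedLaplacian I g φ f) S :=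
  (hg.contMDiffOn_laplacian hf).sub (hg.contMDiffOn_gradInner hφ hf)

theorem contMDiffOn_weightedScalarCurvature (hg : IsSmoothMetricOn I g S)
    (hφ : ContMDiffOn I 𝓘(ℝ, ℝ) ∞ φ S) :
    ContMDiffOn I 𝓘(ℝ, ℝ) ∞ (weightedScalarCurvature I g φ) S :=
  (hg.contMDiffOn_scalarCurvature.add (contMDiffOn_const.mul (hg.contMDiffOn_laplacian hφ))).sub
    (hg.contMDiffOn_gradInner hφ hφ)

end IsSmoothMetricOn

end Manifold

/-! ### The curvature of the ambient metric -/

section FirstOrderProducts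

variable {E F K : Type*} [NormedAddCommGroup E] [NormedSpace ℝ E] [NormedAddCommGroup F]
  [NormedSpace ℝ F] [NormedAddCommGroup K] [NormedSpace ℝ K] {f : E × F → K} {y : E} {z : F}

theorem fderiv_comp_prodMk_left (hf : DifferentiableAt ℝ f (y, z)) (X : E) :
    fderiv ℝ (fun y => f (y, z)) y X = fderiv ℝ f (y, z) (X, 0) := by
  have slice_deriv : HasFDerivAt (fun y => f (y, z))
      (fderiv ℝ f (y, z) ∘L ContinuousLinearMap.inl ℝ E F) y :=
    HasFDerivAt.comp y (f := fun y => (y, z)) hf.hasFDerivAt (hasFDerivAt_prodMk_left y z)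
  rw [slice_deriv.fderiv]
  rfl

end FirstOrderProducts

section AmbientCoordinates

variable {E : Type*} [NormedAddCommGroup E] [NormedSpace ℝ E]

/-- The inclusion of the tangent space of `M` into that of the ambient space `ℝ × M × ℝ`. -/
def midIncl (E : Type*) [NormedAddCommGroup E] [NormedSpace ℝ E] : E →L[ℝ] ℝ × E × ℝ :=
  ContinuousLinearMap.inr ℝ ℝ (E × ℝ) ∘L ContinuousLinearMap.inl ℝ E ℝ

@[simp]
theorem midIncl_apply (X : E) : midIncl E X = (0, X, 0) := rfl

theorem hasFDerivAt_slice (v u : ℝ) (y : E) :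
    HasFDerivAt (fun y : E => ((v, y, u) : ℝ × E × ℝ)) (midIncl E) y :=
  (hasFDerivAt_prodMk_right v (y, u)).comp y (hasFDerivAt_prodMk_left y u)

theorem fderiv_midIncl {F : Type*} [NormedAddCommGroup F] [NormedSpace ℝ F] {f : ℝ × E × ℝ → F}
    {v u : ℝ} {y : E} (hf : DifferentiableAt ℝ f (v, y, u)) (X : E) :
    fderiv ℝ f (v, y, u) (midIncl E X) = fderiv ℝ (fun y => f (v, y, u)) y X := by
  have slice_deriv : HasFDerivAt (fun y => f (v, y, u))
      (fderiv ℝ f (v, y, u) ∘L midIncl E) y :=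
    HasFDerivAt.comp y (f := fun y => ((v, y, u) : ℝ × E × ℝ)) hf.hasFDerivAt
      (hasFDerivAt_slice v u y)
  rw [slice_deriv.fderiv]
  rfl

theorem fderiv_fderiv_midIncl {f : ℝ × E × ℝ → ℝ} {v u : ℝ} {y : E}
    (hf : ContDiffAt ℝ 2 f (v, y, u)) (X Y : E) :
    fderiv ℝ (fderiv ℝ f) (v, y, u) (midIncl E X) (midIncl E Y) =
      fderiv ℝ (fderiv ℝ fun y => f (v, y, u)) y X Y := by
  have slice_nhds : fderiv ℝ (fun y => f (v, y, u)) =ᶠ[𝓝 y]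
      fun z => fderiv ℝ f (v, z, u) ∘L midIncl E := by
    filter_upwards [(hasFDerivAt_slice v u y).continuousAt.eventually
      (eventually_differentiableAt hf)] with z hz
    ext X
    exact (fderiv_midIncl hz X).symm
  have slice_deriv : HasFDerivAt (fun z => fderiv ℝ f (v, z, u))
      (fderiv ℝ (fderiv ℝ f) (v, y, u) ∘L midIncl E) y :=
    HasFDerivAt.comp y (f := fun y => ((v, y, u) : ℝ × E × ℝ))
      (differentiableAt_fderiv hf).hasFDerivAt (hasFDerivAt_slice v u y)
  rw [slice_nhds.fderiv_eq, (slice_deriv.clm_comp (hasFDerivAt_const _ _)).fderiv]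
  simp

theorem trace_prod {V V' : Type*} [AddCommGroup V] [Module ℝ V] [FiniteDimensional ℝ V]
    [AddCommGroup V'] [Module ℝ V'] [FiniteDimensional ℝ V'] (T : V × V' →ₗ[ℝ] V × V') :
    LinearMap.trace ℝ (V × V') T =
      LinearMap.trace ℝ V (LinearMap.fst ℝ V V' ∘ₗ T ∘ₗ LinearMap.inl ℝ V V') +
      LinearMap.trace ℝ V' (LinearMap.snd ℝ V V' ∘ₗ T ∘ₗ LinearMap.inr ℝ V V') := by
  have split : T = (T ∘ₗ LinearMap.inl ℝ V V') ∘ₗ LinearMap.fst ℝ V V' +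
      (T ∘ₗ LinearMap.inr ℝ V V') ∘ₗ LinearMap.snd ℝ V V' := by
    refine LinearMap.ext fun X => ?_
    simp only [LinearMap.add_apply, LinearMap.comp_apply, ← map_add]
    congr 1
    ext <;> simp
  conv_lhs => rw [split]
  rw [map_add, LinearMap.trace_comp_comm' _ (T ∘ₗ LinearMap.inl ℝ V V'),
    LinearMap.trace_comp_comm' _ (T ∘ₗ LinearMap.inr ℝ V V')]

theorem trace_real (T : ℝ →ₗ[ℝ] ℝ) : LinearMap.trace ℝ ℝ T = T 1 := by
  rw [trace_eq_sum_coord (Module.Basis.singleton Unit ℝ)]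
  simp

/-- `G` is the metric `2 du dv + γ_u` on `ℝ × W`. -/
structure IsAmbientOn (G : ℝ × E × ℝ → (ℝ × E × ℝ) →L[ℝ] (ℝ × E × ℝ) →L[ℝ] ℝ)
    (γ : E × ℝ → E →L[ℝ] E →L[ℝ] ℝ) (W : Set (E × ℝ)) : Prop where
  isOpen : IsOpen W
  isMetricOn : IsMetricOn G {q | q.2 ∈ W}
  apply_eq : ∀ q : ℝ × E × ℝ, q.2 ∈ W → ∀ X Y : ℝ × E × ℝ,
    G q X Y = X.1 * Y.2.2 + X.2.2 * Y.1 + γ q.2 X.2.1 Y.2.1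

variable [FiniteDimensional ℝ E]

/-- The trace `γ^{ij} ∂_u γ_{ij}` of the variation of a one-parameter family `γ_u` of metrics. -/
def variationTrace (γ : E × ℝ → E →L[ℝ] E →L[ℝ] ℝ) (w : E × ℝ) : ℝ :=
  metricTrace (γ w) (fderiv ℝ γ w (0, 1)).toBilinForm

theorem trace_ambient (T : ℝ × E × ℝ →ₗ[ℝ] ℝ × E × ℝ) :
    LinearMap.trace ℝ (ℝ × E × ℝ) T = (T (1, 0, 0)).1 + (T (0, 0, 1)).2.2 +
      LinearMap.trace ℝ E (LinearMap.fst ℝ E ℝ ∘ₗ LinearMap.snd ℝ ℝ (E × ℝ) ∘ₗ T ∘ₗ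
        (midIncl E : E →ₗ[ℝ] ℝ × E × ℝ)) := by
  rw [trace_prod, trace_prod, trace_real, trace_real, add_comm (LinearMap.trace ℝ E _),
    ← add_assoc]
  rfl

namespace IsAmbientOn

variable {G : ℝ × E × ℝ → (ℝ × E × ℝ) →L[ℝ] (ℝ × E × ℝ) →L[ℝ] ℝ}
  {γ : E × ℝ → E →L[ℝ] E →L[ℝ] ℝ} {W : Set (E × ℝ)} {v u : ℝ} {y : E} {q : ℝ × E × ℝ}

theorem contDiffOn (h : IsAmbientOn G γ W) : ContDiffOn ℝ ∞ γ W := by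
  refine contDiffOn_clm_apply.2 fun X => contDiffOn_clm_apply.2 fun Y => ?_
  have contDiffOn_zero : ContDiffOn ℝ ∞ (fun w : E × ℝ => G (0, w)) W :=
    h.isMetricOn.contDiffOn.comp (by fun_prop) fun w hw => hw
  refine (contDiffOn_clm_apply.1 (contDiffOn_clm_apply.1 contDiffOn_zero (midIncl E X))
    (midIncl E Y)).congr fun w hw => ?_
  rw [h.apply_eq _ hw]
  simp

theorem differentiableAt (h : IsAmbientOn G γ W) {w : E × ℝ} (hw : w ∈ W) :
    DifferentiableAt ℝ γ w :=
  differentiableAt_of_contDiffOn h.isOpen h.contDiffOn hw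

theorem isMetricOn_slice (h : IsAmbientOn G γ W) (u : ℝ) :
    IsMetricOn (fun y => γ (y, u)) {y | (y, u) ∈ W} where
  isOpen := h.isOpen.preimage (by fun_prop)
  contDiffOn := h.contDiffOn.comp (by fun_prop) fun _ hy => hy
  symm y hy X Y := by
    simpa [h.apply_eq (0, y, u) hy] using
      h.isMetricOn.symm (0, y, u) hy (midIncl E X) (midIncl E Y)
  isInvertible y hy := by
    refine isInvertible_of_nondegenerate fun X hX => ?_
    have mid_null : G (0, y, u) (midIncl E X) = 0 := by
      refine ContinuousLinearMap.ext fun Y => ?_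
      simp [h.apply_eq (0, y, u) hy, hX]
    simpa using (h.isMetricOn.isInvertible (0, y, u) hy).injective
      (mid_null.trans (map_zero _).symm)

theorem fderiv_apply (h : IsAmbientOn G γ W) (hq : q.2 ∈ W) (D X Y : ℝ × E × ℝ) :
    fderiv ℝ G q D X Y = fderiv ℝ γ q.2 D.2 X.2.1 Y.2.1 := by
  have apply_nhds : (fun q => G q X Y) =ᶠ[𝓝 q]
      fun q => X.1 * Y.2.2 + X.2.2 * Y.1 + γ q.2 X.2.1 Y.2.1 := by
    filter_upwards [h.isMetricOn.isOpen.mem_nhds hq] with z hz using h.apply_eq z hz X Y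
  have family_deriv : HasFDerivAt (fun q : ℝ × E × ℝ => γ q.2 X.2.1 Y.2.1) _ q :=
    (hasFDerivAt_clm_apply_const₂ (h.differentiableAt hq).hasFDerivAt X.2.1 Y.2.1).comp q
      hasFDerivAt_snd
  rw [← fderiv_clm_apply_const₂ (h.isMetricOn.differentiableAt hq), apply_nhds.fderiv_eq,
    (family_deriv.const_add _).fderiv]
  rfl

theorem christoffelLower_apply (h : IsAmbientOn G γ W) (hq : q.2 ∈ W) (X Y Z : ℝ × E × ℝ) :
    christoffelLower G q X Y Z =
      2⁻¹ * (fderiv ℝ γ q.2 X.2 Y.2.1 Z.2.1 + fderiv ℝ γ q.2 Y.2 X.2.1 Z.2.1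
        - fderiv ℝ γ q.2 Z.2 X.2.1 Y.2.1) := by
  rw [WeightedGJMS.christoffelLower_apply, h.fderiv_apply hq, h.fderiv_apply hq,
    h.fderiv_apply hq]

theorem inverse_apply (h : IsAmbientOn G γ W) (hq : q.2 ∈ W) (α : (ℝ × E × ℝ) →L[ℝ] ℝ) :
    (G q).inverse α = (α (0, 0, 1), (γ q.2).inverse (α ∘L midIncl E), α (1, 0, 0)) := by
  rw [(h.isMetricOn.isInvertible q hq).inverse_apply_eq]
  refine ContinuousLinearMap.ext fun X => ?_
  have apply_split : α X = X.1 * α (1, 0, 0) + X.2.2 * α (0, 0, 1) + α (midIncl E X.2.1) := by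
    rw [← smul_eq_mul, ← smul_eq_mul, ← map_smul, ← map_smul, ← map_add, ← map_add]
    congr 1
    ext <;> simp
  rw [h.apply_eq q hq, (h.isMetricOn_slice q.2.2).apply_inverse (y := q.2.1) hq, apply_split,
    mul_comm (α _), mul_comm (α _), add_comm (X.1 * _)]
  rfl

theorem christoffel_snd_snd (h : IsAmbientOn G γ W) (hq : q.2 ∈ W) (X Y : ℝ × E × ℝ) :
    (christoffel G q X Y).2.2 = 0 := by
  have middle_zero : ((0 : E), (0 : ℝ)) = 0 := rfl
  rw [christoffel_apply, h.inverse_apply hq]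
  refine (h.christoffelLower_apply hq X Y (1, 0, 0)).trans ?_
  simp [middle_zero]

theorem christoffel_fst (h : IsAmbientOn G γ W) (hq : q.2 ∈ W) (Y : ℝ × E × ℝ) :
    christoffel G q (1, 0, 0) Y = 0 := by
  have lower_eq_zero : christoffelLower G q (1, 0, 0) Y = 0 := by
    refine ContinuousLinearMap.ext fun Z => ?_
    have middle_zero : ((0 : E), (0 : ℝ)) = 0 := rfl
    rw [h.christoffelLower_apply hq]
    simp [middle_zero]
  rw [christoffel_apply, lower_eq_zero, map_zero]

theorem christoffel_mid (h : IsAmbientOn G γ W) (hy : (y, u) ∈ W) (b : ℝ) (X Y : E) :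
    christoffel G (v, y, u) (midIncl E X) (b, Y, 0) =
      (-(2⁻¹ * fderiv ℝ γ (y, u) (0, 1) X Y), christoffel (fun y => γ (y, u)) y X Y, 0) := by
  have hq : ((v, y, u) : ℝ × E × ℝ).2 ∈ W := hy
  have lower_slice : christoffelLower G (v, y, u) (midIncl E X) (b, Y, 0) ∘L midIncl E =
      christoffelLower (fun y => γ (y, u)) y X Y := by
    ext Z
    have fderiv_slice := fderiv_comp_prodMk_left (h.differentiableAt hy)
    rw [ContinuousLinearMap.comp_apply, h.christoffelLower_apply hq,
      WeightedGJMS.christoffelLower_apply, fderiv_slice, fderiv_slice, fderiv_slice]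
    rfl
  have last_eq := h.christoffel_snd_snd hq (midIncl E X) (b, Y, 0)
  rw [christoffel_apply, h.inverse_apply hq] at last_eq ⊢
  simp only at last_eq
  rw [last_eq, lower_slice, h.christoffelLower_apply hq, christoffel_apply]
  simp

theorem metricTrace_eq (h : IsAmbientOn G γ W) (hq : q.2 ∈ W)
    {T : LinearMap.BilinForm ℝ (ℝ × E × ℝ)} {T' : LinearMap.BilinForm ℝ E}
    (hT : ∀ X Y, T (midIncl E X) (midIncl E Y) = T' X Y) :
    metricTrace (G q) T = T (1, 0, 0) (0, 0, 1) + T (0, 0, 1) (1, 0, 0)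
      + metricTrace (γ q.2) T' := by
  rw [metricTrace, trace_ambient, metricTrace]
  simp only [LinearMap.comp_apply, ContinuousLinearMap.coe_coe, LinearEquiv.coe_coe,
    h.inverse_apply hq]
  congr 2
  ext X
  simp only [LinearMap.comp_apply, ContinuousLinearMap.coe_coe, LinearEquiv.coe_coe,
    h.inverse_apply hq, LinearMap.snd_apply, LinearMap.fst_apply]
  congr 1
  ext Y
  exact hT X Y

end IsAmbientOn

end AmbientCoordinates

namespace IsAmbientOn

variable {E : Type*} [NormedAddCommGroup E] [NormedSpace ℝ E] [FiniteDimensional ℝ E]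
  {G : ℝ × E × ℝ → (ℝ × E × ℝ) →L[ℝ] (ℝ × E × ℝ) →L[ℝ] ℝ}
  {γ : E × ℝ → E →L[ℝ] E →L[ℝ] ℝ} {W : Set (E × ℝ)} {v u : ℝ} {y : E} {q : ℝ × E × ℝ}
  {F K : ℝ × E × ℝ → ℝ}

theorem differentiableAt_christoffel_apply (h : IsAmbientOn G γ W) (hq : q.2 ∈ W)
    (X Y : ℝ × E × ℝ) : DifferentiableAt ℝ (fun q => christoffel G q X Y) q :=
  (hasFDerivAt_clm_apply_const₂
    (h.isMetricOn.differentiableAt_christoffel hq).hasFDerivAt X Y).differentiableAt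

theorem fderiv_christoffel_apply (h : IsAmbientOn G γ W) (hq : q.2 ∈ W) (D X Y : ℝ × E × ℝ) :
    fderiv ℝ (christoffel G) q D X Y = fderiv ℝ (fun q => christoffel G q X Y) q D :=
  (fderiv_clm_apply_const₂ (h.isMetricOn.differentiableAt_christoffel hq) D X Y).symm

theorem fderiv_christoffel_snd_snd (h : IsAmbientOn G γ W) (hq : q.2 ∈ W) (D X Y : ℝ × E × ℝ) :
    (fderiv ℝ (christoffel G) q D X Y).2.2 = 0 := by
  have last_nhds : (fun q => (christoffel G q X Y).2.2) =ᶠ[𝓝 q] fun _ => 0 := by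
    filter_upwards [h.isMetricOn.isOpen.mem_nhds hq] with z hz using h.christoffel_snd_snd hz X Y
  have hΓ := h.differentiableAt_christoffel_apply hq X Y
  have last_deriv := last_nhds.fderiv_eq (𝕜 := ℝ)
  rw [fderiv.snd hΓ.snd, fderiv.snd hΓ, fderiv_const_apply] at last_deriv
  rw [h.fderiv_christoffel_apply hq]
  exact congrArg (fun T : (ℝ × E × ℝ) →L[ℝ] ℝ => T D) last_deriv

theorem fderiv_christoffel_mid (h : IsAmbientOn G γ W) (hy : (y, u) ∈ W) (X Y Z : E) :
    (fderiv ℝ (christoffel G) (v, y, u) (midIncl E X) (midIncl E Y) (midIncl E Z)).2.1 =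
      fderiv ℝ (christoffel fun y => γ (y, u)) y X Y Z := by
  have slice := h.isMetricOn_slice u
  have hΓ := h.differentiableAt_christoffel_apply (q := (v, y, u)) hy (midIncl E Y) (midIncl E Z)
  have middle_nhds : (fun y => (christoffel G (v, y, u) (midIncl E Y) (midIncl E Z)).2.1) =ᶠ[𝓝 y]
      fun z => christoffel (fun y => γ (y, u)) z Y Z := by
    filter_upwards [slice.isOpen.mem_nhds hy] with z hz
    exact congrArg (fun p : ℝ × E × ℝ => p.2.1) (h.christoffel_mid hz 0 Y Z)
  rw [h.fderiv_christoffel_apply hy,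
    ← fderiv_clm_apply_const₂ (slice.differentiableAt_christoffel hy), ← middle_nhds.fderiv_eq,
    ← fderiv_midIncl hΓ.snd.fst, fderiv.fst hΓ.snd, fderiv.snd hΓ]
  rfl

theorem curvatureEnd_fst (h : IsAmbientOn G γ W) (hy : (y, u) ∈ W) (Y Z : E) :
    curvatureEnd G (v, y, u) (midIncl E Y) (midIncl E Z) (1, 0, 0) = 0 := by
  have hq : ((v, y, u) : ℝ × E × ℝ).2 ∈ W := hy
  have deriv_along_fst :
      fderiv ℝ (christoffel G) (v, y, u) (1, 0, 0) (midIncl E Y) (midIncl E Z) = 0 := by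
    have christoffel_const : (fun v => christoffel G (v, y, u) (midIncl E Y) (midIncl E Z)) =
        fun _ =>
          (-(2⁻¹ * fderiv ℝ γ (y, u) (0, 1) Y Z), christoffel (fun y => γ (y, u)) y Y Z, 0) :=
      funext fun v => h.christoffel_mid hy 0 Y Z
    refine (h.fderiv_christoffel_apply hq _ _ _).trans ((fderiv_comp_prodMk_left
      (h.differentiableAt_christoffel_apply hq _ _) 1).symm.trans ?_)
    rw [christoffel_const, fderiv_const_apply]
    rfl
  have deriv_of_fst :
      fderiv ℝ (christoffel G) (v, y, u) (midIncl E Y) (1, 0, 0) (midIncl E Z) = 0 := by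
    have christoffel_zero : (fun q => christoffel G q (1, 0, 0) (midIncl E Z)) =ᶠ[𝓝 (v, y, u)]
        fun _ => 0 := by
      filter_upwards [h.isMetricOn.isOpen.mem_nhds hq] with z hz using h.christoffel_fst hz _
    rw [h.fderiv_christoffel_apply hq, christoffel_zero.fderiv_eq, fderiv_const_apply]
    rfl
  rw [curvatureEnd_apply, deriv_along_fst, deriv_of_fst, h.christoffel_fst hq,
    h.christoffel_fst hq, map_zero, sub_zero, add_zero, sub_zero]

theorem curvatureEnd_snd_snd (h : IsAmbientOn G γ W) (hq : q.2 ∈ W) (X Y Z : ℝ × E × ℝ) :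
    (curvatureEnd G q Y Z X).2.2 = 0 := by
  simp only [curvatureEnd_apply, Prod.snd_add, Prod.snd_sub, h.fderiv_christoffel_snd_snd hq,
    h.christoffel_snd_snd hq, sub_zero, add_zero]

theorem ricciForm_mid (h : IsAmbientOn G γ W) (hy : (y, u) ∈ W) (Y Z : E) :
    ricciForm G (v, y, u) (midIncl E Y) (midIncl E Z) =
      ricciForm (fun y => γ (y, u)) y Y Z := by
  have christoffel_mid_mid (X Y : E) : christoffel G (v, y, u) (midIncl E X) (midIncl E Y) =
      (-(2⁻¹ * fderiv ℝ γ (y, u) (0, 1) X Y), christoffel (fun y => γ (y, u)) y X Y, 0) :=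
    h.christoffel_mid hy 0 X Y
  rw [ricciForm_apply, trace_ambient, ricciForm_apply, ContinuousLinearMap.coe_coe,
    h.curvatureEnd_fst hy, h.curvatureEnd_snd_snd (q := (v, y, u)) hy, Prod.fst_zero, zero_add,
    zero_add]
  congr 1
  ext X
  simp only [LinearMap.comp_apply, ContinuousLinearMap.coe_coe, LinearMap.snd_apply,
    LinearMap.fst_apply, curvatureEnd_apply, christoffel_mid_mid, h.christoffel_mid hy,
    Prod.snd_add, Prod.snd_sub, Prod.fst_add, Prod.fst_sub, h.fderiv_christoffel_mid hy]

theorem hessianForm_mid (h : IsAmbientOn G γ W) (hF : ContDiffAt ℝ 2 F (v, y, u))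
    (hy : (y, u) ∈ W) (X Y : E) :
    hessianForm G F (v, y, u) (midIncl E X) (midIncl E Y) =
      hessianForm (fun y => γ (y, u)) (fun y => F (v, y, u)) y X Y
        + 2⁻¹ * fderiv ℝ γ (y, u) (0, 1) X Y * fderiv ℝ F (v, y, u) (1, 0, 0) := by
  have christoffel_split : christoffel G (v, y, u) (midIncl E X) (midIncl E Y) =
      (-(2⁻¹ * fderiv ℝ γ (y, u) (0, 1) X Y)) • ((1, 0, 0) : ℝ × E × ℝ)
        + midIncl E (christoffel (fun y => γ (y, u)) y X Y) := by
    refine (h.christoffel_mid hy 0 X Y).trans ?_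
    simp
  rw [hessianForm_apply, hessianForm_apply, fderiv_fderiv_midIncl hF, christoffel_split, map_add,
    map_smul, fderiv_midIncl (hF.differentiableAt two_ne_zero), smul_eq_mul]
  ring

theorem coordLaplacian_eq (h : IsAmbientOn G γ W) (hF : ContDiffAt ℝ 2 F (v, y, u))
    (hy : (y, u) ∈ W) :
    coordLaplacian G F (v, y, u) =
      2 * fderiv ℝ (fderiv ℝ F) (v, y, u) (0, 0, 1) (1, 0, 0)
      + coordLaplacian (fun y => γ (y, u)) (fun y => F (v, y, u)) y
      + 2⁻¹ * fderiv ℝ F (v, y, u) (1, 0, 0) * variationTrace γ (y, u) := by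
  have hq : ((v, y, u) : ℝ × E × ℝ).2 ∈ W := hy
  have hessian_mid : ∀ X Y, hessianForm G F (v, y, u) (midIncl E X) (midIncl E Y) =
      (hessianForm (fun y => γ (y, u)) (fun y => F (v, y, u)) y
        + (2⁻¹ * fderiv ℝ F (v, y, u) (1, 0, 0)) •
          (fderiv ℝ γ (y, u) (0, 1)).toBilinForm) X Y := fun X Y => by
    rw [h.hessianForm_mid hF hy, LinearMap.add_apply, LinearMap.add_apply, LinearMap.smul_apply,
      LinearMap.smul_apply, smul_eq_mul, ContinuousLinearMap.toBilinForm_apply]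
    ring
  rw [coordLaplacian, h.metricTrace_eq hq hessian_mid, metricTrace_add, metricTrace_smul,
    hessianForm_apply, hessianForm_apply, h.isMetricOn.christoffel_symm hq (0, 0, 1),
    h.christoffel_fst hq, fderiv_fderiv_comm hF (1, 0, 0), map_zero, coordLaplacian,
    variationTrace]
  ring

theorem coordLaplacian_of_fderiv_fst (h : IsAmbientOn G γ W) (hF : ContDiffAt ℝ 2 F (v, y, u))
    (hy : (y, u) ∈ W) {a b : ℝ}
    (hv : ∀ᶠ q in 𝓝 (v, y, u), fderiv ℝ F q (1, 0, 0) = a * F q + b) :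
    coordLaplacian G F (v, y, u) =
      2 * (a * fderiv ℝ F (v, y, u) (0, 0, 1))
      + coordLaplacian (fun y => γ (y, u)) (fun y => F (v, y, u)) y
      + 2⁻¹ * (a * F (v, y, u) + b) * variationTrace γ (y, u) := by
  have mixed_deriv : fderiv ℝ (fderiv ℝ F) (v, y, u) (0, 0, 1) (1, 0, 0) =
      a * fderiv ℝ F (v, y, u) (0, 0, 1) := by
    have apply_deriv := (hasFDerivAt_clm_apply_const (differentiableAt_fderiv hF).hasFDerivAt
      (1, 0, 0)).fderiv
    rw [Filter.EventuallyEq.fderiv_eq hv, fderiv_add_const,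
      fderiv_const_mul (hF.differentiableAt two_ne_zero)] at apply_deriv
    exact (congrArg (fun T : (ℝ × E × ℝ) →L[ℝ] ℝ => T (0, 0, 1)) apply_deriv).symm
  rw [h.coordLaplacian_eq hF hy, mixed_deriv, hv.self_of_nhds]

theorem coordGradInner_eq (h : IsAmbientOn G γ W) (hF : DifferentiableAt ℝ F (v, y, u))
    (hK : DifferentiableAt ℝ K (v, y, u)) (hy : (y, u) ∈ W) :
    coordGradInner G F K (v, y, u) =
      coordGradInner (fun y => γ (y, u)) (fun y => F (v, y, u)) (fun y => K (v, y, u)) y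
      + fderiv ℝ F (v, y, u) (1, 0, 0) * fderiv ℝ K (v, y, u) (0, 0, 1)
      + fderiv ℝ F (v, y, u) (0, 0, 1) * fderiv ℝ K (v, y, u) (1, 0, 0) := by
  have fderiv_slice : fderiv ℝ K (v, y, u) ∘L midIncl E = fderiv ℝ (fun y => K (v, y, u)) y :=
    ContinuousLinearMap.ext fun X => fderiv_midIncl hK X
  have grad_split : (G (v, y, u)).inverse (fderiv ℝ K (v, y, u)) =
      fderiv ℝ K (v, y, u) (0, 0, 1) • (1, 0, 0)
        + midIncl E ((γ (y, u)).inverse (fderiv ℝ K (v, y, u) ∘L midIncl E))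
        + fderiv ℝ K (v, y, u) (1, 0, 0) • (0, 0, 1) := by
    rw [h.inverse_apply (q := (v, y, u)) hy]
    simp
  rw [coordGradInner, grad_split, map_add, map_add, map_smul, map_smul, fderiv_midIncl hF,
    fderiv_slice, coordGradInner, smul_eq_mul, smul_eq_mul]
  ring

end IsAmbientOn

/-! ### The ambient Laplacian on homogeneous functions -/

section AmbientFunctions

/-- The homogeneous extension `e^{-v/2} f_u` of a density `f_u` of weight `-1/2`. -/
def ambientDensity {X : Type*} (f : X × ℝ → ℝ) (p : ℝ × X × ℝ) : ℝ :=
  Real.exp (-p.1 / 2) * f p.2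

variable {E : Type*} [NormedAddCommGroup E] [NormedSpace ℝ E] {f φ : E × ℝ → ℝ} {q : ℝ × E × ℝ}

theorem contDiffAt_ambientPotential {k : WithTop ℕ∞} (hφ : ContDiffAt ℝ k φ q.2) :
    ContDiffAt ℝ k (ambientPotential φ) q :=
  (hφ.comp q contDiffAt_snd).sub contDiffAt_fst

theorem contDiffAt_ambientDensity {k : WithTop ℕ∞} (hf : ContDiffAt ℝ k f q.2) :
    ContDiffAt ℝ k (ambientDensity f) q :=
  (contDiffAt_fst.neg.div_const 2).exp.mul (hf.comp q contDiffAt_snd)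

theorem fderiv_ambientPotential (hφ : DifferentiableAt ℝ φ q.2) (X : ℝ × E × ℝ) :
    fderiv ℝ (ambientPotential φ) q X = fderiv ℝ φ q.2 X.2 - X.1 := by
  have hasFDerivAt_potential : HasFDerivAt (ambientPotential φ) _ q :=
    (hφ.hasFDerivAt.comp q hasFDerivAt_snd).sub hasFDerivAt_fst
  rw [hasFDerivAt_potential.fderiv]
  rfl

theorem fderiv_ambientDensity (hf : DifferentiableAt ℝ f q.2) (X : ℝ × E × ℝ) :
    fderiv ℝ (ambientDensity f) q X =
      -2⁻¹ * X.1 * ambientDensity f q + Real.exp (-q.1 / 2) * fderiv ℝ f q.2 X.2 := by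
  have weight_deriv : HasFDerivAt (fun q : ℝ × E × ℝ => Real.exp (-q.1 / 2))
      (Real.exp (-q.1 / 2) • (2⁻¹ : ℝ) • -ContinuousLinearMap.fst ℝ ℝ (E × ℝ)) q :=
    ((hasFDerivAt_fst (p := q)).neg.mul_const (2⁻¹ : ℝ)).exp
  have hasFDerivAt_density : HasFDerivAt (ambientDensity f) _ q :=
    weight_deriv.mul (hf.hasFDerivAt.comp q hasFDerivAt_snd)
  rw [hasFDerivAt_density.fderiv, ambientDensity]
  change Real.exp (-q.1 / 2) * fderiv ℝ f q.2 X.2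
    + f q.2 * (Real.exp (-q.1 / 2) * (2⁻¹ * -X.1)) = _
  ring

theorem fderiv_ambientPotential_fst (hφ : DifferentiableAt ℝ φ q.2) :
    fderiv ℝ (ambientPotential φ) q (1, 0, 0) = -1 := by
  have middle_zero : ((0 : E), (0 : ℝ)) = 0 := rfl
  rw [fderiv_ambientPotential hφ, middle_zero, map_zero, zero_sub]

theorem fderiv_ambientDensity_fst (hf : DifferentiableAt ℝ f q.2) :
    fderiv ℝ (ambientDensity f) q (1, 0, 0) = -2⁻¹ * ambientDensity f q := by
  have middle_zero : ((0 : E), (0 : ℝ)) = 0 := rfl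
  rw [fderiv_ambientDensity hf, middle_zero, map_zero, mul_zero, add_zero, mul_one]

theorem fderiv_ambientPotential_snd_snd (hφ : DifferentiableAt ℝ φ q.2) :
    fderiv ℝ (ambientPotential φ) q (0, 0, 1) = fderiv ℝ φ q.2 (0, 1) := by
  rw [fderiv_ambientPotential hφ, sub_zero]

theorem fderiv_ambientDensity_snd_snd (hf : DifferentiableAt ℝ f q.2) :
    fderiv ℝ (ambientDensity f) q (0, 0, 1) = Real.exp (-q.1 / 2) * fderiv ℝ f q.2 (0, 1) := by
  rw [fderiv_ambientDensity hf, mul_zero, zero_mul, zero_add]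

end AmbientFunctions

section AmbientNormality

variable {E : Type*} [NormedAddCommGroup E] [NormedSpace ℝ E]

theorem hessianForm_sub_const (G : E → E →L[ℝ] E →L[ℝ] ℝ) (f : E → ℝ) (c : ℝ) (y : E) :
    hessianForm G (fun z => f z - c) y = hessianForm G f y := by
  have fderiv_eq : fderiv ℝ (fun z => f z - c) = fderiv ℝ f := funext fun z => fderiv_sub_const c
  ext X Y
  rw [hessianForm_apply, hessianForm_apply, fderiv_eq]

theorem eventually_differentiableAt_snd {f : E × ℝ → ℝ} {q : ℝ × E × ℝ}
    (hf : ContDiffAt ℝ 2 f q.2) : ∀ᶠ p in 𝓝 q, DifferentiableAt ℝ f p.2 :=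
  continuousAt_snd.eventually (eventually_differentiableAt hf)

theorem contDiffAt_two_slice {f : E × ℝ → ℝ} {u : ℝ} {y : E} (hf : ContDiffAt ℝ 2 f (y, u)) :
    ContDiffAt ℝ 2 (fun y => f (y, u)) y :=
  hf.comp y (f := fun y => (y, u)) (contDiffAt_id.prodMk contDiffAt_const)

variable [FiniteDimensional ℝ E]

namespace IsAmbientOn

variable {G : ℝ × E × ℝ → (ℝ × E × ℝ) →L[ℝ] (ℝ × E × ℝ) →L[ℝ] ℝ}
  {γ : E × ℝ → E →L[ℝ] E →L[ℝ] ℝ} {W : Set (E × ℝ)} {v u : ℝ} {y : E} {f φ : E × ℝ → ℝ}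

theorem coordLaplacian_ambientPotential (h : IsAmbientOn G γ W)
    (hφ : ContDiffAt ℝ 2 φ (y, u)) (hy : (y, u) ∈ W) :
    coordLaplacian G (ambientPotential φ) (v, y, u) =
      coordLaplacian (fun y => γ (y, u)) (fun y => φ (y, u)) y
        - 2⁻¹ * variationTrace γ (y, u) := by
  have fderiv_fst : ∀ᶠ q in 𝓝 (v, y, u), fderiv ℝ (ambientPotential φ) q (1, 0, 0) =
      0 * ambientPotential φ q + -1 :=
    (eventually_differentiableAt_snd (q := (v, y, u)) hφ).mono fun q hq => by
      rw [fderiv_ambientPotential_fst hq, zero_mul, zero_add]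
  have laplacian_slice : coordLaplacian (fun y => γ (y, u))
      (fun y => ambientPotential φ (v, y, u)) y =
      coordLaplacian (fun y => γ (y, u)) (fun y => φ (y, u)) y :=
    congrArg _ (hessianForm_sub_const _ (fun y => φ (y, u)) v y)
  rw [h.coordLaplacian_of_fderiv_fst (contDiffAt_ambientPotential hφ) hy fderiv_fst,
    laplacian_slice]
  ring

theorem coordLaplacian_ambientDensity (h : IsAmbientOn G γ W)
    (hf : ContDiffAt ℝ 2 f (y, u)) (hy : (y, u) ∈ W) :
    coordLaplacian G (ambientDensity f) (v, y, u) = Real.exp (-v / 2) *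
      (coordLaplacian (fun y => γ (y, u)) (fun y => f (y, u)) y - fderiv ℝ f (y, u) (0, 1)
        - 4⁻¹ * f (y, u) * variationTrace γ (y, u)) := by
  have hf_snd : DifferentiableAt ℝ f ((v, y, u) : ℝ × E × ℝ).2 :=
    hf.differentiableAt two_ne_zero
  have fderiv_fst : ∀ᶠ q in 𝓝 (v, y, u), fderiv ℝ (ambientDensity f) q (1, 0, 0) =
      -2⁻¹ * ambientDensity f q + 0 :=
    (eventually_differentiableAt_snd (q := (v, y, u)) hf).mono fun q hq => by
      rw [fderiv_ambientDensity_fst hq, add_zero]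
  have laplacian_slice : coordLaplacian (fun y => γ (y, u))
      (fun y => ambientDensity f (v, y, u)) y =
      Real.exp (-v / 2) * coordLaplacian (fun y => γ (y, u)) (fun y => f (y, u)) y :=
    coordLaplacian_const_mul (contDiffAt_two_slice hf) (Real.exp (-v / 2))
  rw [h.coordLaplacian_of_fderiv_fst (contDiffAt_ambientDensity hf) hy fderiv_fst,
    laplacian_slice, fderiv_ambientDensity_snd_snd hf_snd, ambientDensity]
  ring

theorem coordGradInner_ambientPotential (h : IsAmbientOn G γ W)
    (hφ : DifferentiableAt ℝ φ (y, u)) (hy : (y, u) ∈ W) :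
    coordGradInner G (ambientPotential φ) (ambientPotential φ) (v, y, u) =
      coordGradInner (fun y => γ (y, u)) (fun y => φ (y, u)) (fun y => φ (y, u)) y
        - 2 * fderiv ℝ φ (y, u) (0, 1) := by
  have hφ_snd : DifferentiableAt ℝ φ ((v, y, u) : ℝ × E × ℝ).2 := hφ
  have potential_diff : DifferentiableAt ℝ (ambientPotential φ) (v, y, u) := by
    unfold ambientPotential
    fun_prop
  have grad_slice : coordGradInner (fun y => γ (y, u)) (fun y => ambientPotential φ (v, y, u))
      (fun y => ambientPotential φ (v, y, u)) y =
      coordGradInner (fun y => γ (y, u)) (fun y => φ (y, u)) (fun y => φ (y, u)) y := by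
    simp only [ambientPotential, coordGradInner, fderiv_sub_const]
  rw [h.coordGradInner_eq potential_diff potential_diff hy, grad_slice,
    fderiv_ambientPotential_fst hφ_snd, fderiv_ambientPotential_snd_snd hφ_snd]
  ring

theorem coordGradInner_ambientDensity (h : IsAmbientOn G γ W)
    (hφ : DifferentiableAt ℝ φ (y, u)) (hf : DifferentiableAt ℝ f (y, u)) (hy : (y, u) ∈ W) :
    coordGradInner G (ambientPotential φ) (ambientDensity f) (v, y, u) =
      Real.exp (-v / 2) * (coordGradInner (fun y => γ (y, u)) (fun y => φ (y, u))
        (fun y => f (y, u)) y - fderiv ℝ f (y, u) (0, 1)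
        - 2⁻¹ * f (y, u) * fderiv ℝ φ (y, u) (0, 1)) := by
  have hφ_snd : DifferentiableAt ℝ φ ((v, y, u) : ℝ × E × ℝ).2 := hφ
  have hf_snd : DifferentiableAt ℝ f ((v, y, u) : ℝ × E × ℝ).2 := hf
  have potential_diff : DifferentiableAt ℝ (ambientPotential φ) (v, y, u) := by
    unfold ambientPotential
    fun_prop
  have density_diff : DifferentiableAt ℝ (ambientDensity f) (v, y, u) := by
    unfold ambientDensity
    fun_prop
  have grad_slice : coordGradInner (fun y => γ (y, u)) (fun y => ambientPotential φ (v, y, u))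
      (fun y => ambientDensity f (v, y, u)) y = Real.exp (-v / 2) *
        coordGradInner (fun y => γ (y, u)) (fun y => φ (y, u)) (fun y => f (y, u)) y := by
    simp only [ambientPotential, ambientDensity]
    rw [coordGradInner_const_mul_right (by fun_prop), coordGradInner, fderiv_sub_const]
    rfl
  rw [h.coordGradInner_eq potential_diff density_diff hy, grad_slice,
    fderiv_ambientPotential_fst hφ_snd, fderiv_ambientPotential_snd_snd hφ_snd,
    fderiv_ambientDensity_fst hf_snd, fderiv_ambientDensity_snd_snd hf_snd, ambientDensity]
  ring

-- The `u`-derivatives of `f` cancel: this is what singles out the weight `-1/2`.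
theorem coordWeightedLaplacian_ambientDensity (h : IsAmbientOn G γ W)
    (hφ : DifferentiableAt ℝ φ (y, u)) (hf : ContDiffAt ℝ 2 f (y, u)) (hy : (y, u) ∈ W) :
    coordWeightedLaplacian G (ambientPotential φ) (ambientDensity f) (v, y, u) =
      Real.exp (-v / 2) *
        (coordWeightedLaplacian (fun y => γ (y, u)) (fun y => φ (y, u)) (fun y => f (y, u)) y
          + (2⁻¹ * fderiv ℝ φ (y, u) (0, 1) - 4⁻¹ * variationTrace γ (y, u)) * f (y, u)) := by
  rw [coordWeightedLaplacian, h.coordLaplacian_ambientDensity hf hy,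
    h.coordGradInner_ambientDensity hφ (hf.differentiableAt two_ne_zero) hy,
    coordWeightedLaplacian]
  ring

theorem ricciForm_slice_of_normal (h : IsAmbientOn G γ W) (hφ : ContDiffAt ℝ 2 φ (y, u))
    (hy : (y, u) ∈ W)
    (hP : ricciForm G (v, y, u) + hessianForm G (ambientPotential φ) (v, y, u) = 0) :
    ricciForm (fun y => γ (y, u)) y =
      (2⁻¹ : ℝ) • (fderiv ℝ γ (y, u) (0, 1)).toBilinForm
        - hessianForm (fun y => γ (y, u)) (fun y => φ (y, u)) y := by
  have hφ_snd : DifferentiableAt ℝ φ ((v, y, u) : ℝ × E × ℝ).2 :=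
    hφ.differentiableAt two_ne_zero
  have hessian_slice : hessianForm (fun y => γ (y, u)) (fun y => ambientPotential φ (v, y, u)) y =
      hessianForm (fun y => γ (y, u)) (fun y => φ (y, u)) y :=
    hessianForm_sub_const _ (fun y => φ (y, u)) v y
  ext X Y
  have hP_mid := LinearMap.congr_fun₂ hP (midIncl E X) (midIncl E Y)
  rw [LinearMap.add_apply, LinearMap.add_apply, h.ricciForm_mid hy,
    h.hessianForm_mid (contDiffAt_ambientPotential hφ) hy, hessian_slice,
    fderiv_ambientPotential_fst hφ_snd, LinearMap.zero_apply, LinearMap.zero_apply] at hP_mid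
  rw [LinearMap.sub_apply, LinearMap.sub_apply, LinearMap.smul_apply, LinearMap.smul_apply,
    ContinuousLinearMap.toBilinForm_apply, smul_eq_mul]
  linear_combination hP_mid

theorem coordScalarCurvature_slice_of_normal (h : IsAmbientOn G γ W)
    (hφ : ContDiffAt ℝ 2 φ (y, u)) (hy : (y, u) ∈ W)
    (hP : ricciForm G (v, y, u) + hessianForm G (ambientPotential φ) (v, y, u) = 0) :
    coordScalarCurvature (fun y => γ (y, u)) y = 2⁻¹ * variationTrace γ (y, u)
      - coordLaplacian (fun y => γ (y, u)) (fun y => φ (y, u)) y := by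
  rw [coordScalarCurvature, h.ricciForm_slice_of_normal hφ hy hP, metricTrace_sub,
    metricTrace_smul]
  rfl

theorem coordWeightedLaplacian_ambientDensity_of_normal (h : IsAmbientOn G γ W)
    (hφ : ContDiffAt ℝ 2 φ (y, u)) (hf : ContDiffAt ℝ 2 f (y, u)) (hy : (y, u) ∈ W)
    (hP : ricciForm G (v, y, u) + hessianForm G (ambientPotential φ) (v, y, u) = 0)
    (hN : coordWeightedLaplacian G (ambientPotential φ) (ambientPotential φ) (v, y, u) = 0) :
    coordWeightedLaplacian G (ambientPotential φ) (ambientDensity f) (v, y, u) =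
      Real.exp (-v / 2) *
        coordGjmsFactor (fun y => γ (y, u)) (fun y => φ (y, u)) (fun y => f (y, u)) y := by
  have hφ_diff := hφ.differentiableAt two_ne_zero
  rw [coordWeightedLaplacian, h.coordLaplacian_ambientPotential hφ hy,
    h.coordGradInner_ambientPotential hφ_diff hy] at hN
  rw [h.coordWeightedLaplacian_ambientDensity hφ_diff hf hy, coordGjmsFactor,
    coordWeightedScalarCurvature, h.coordScalarCurvature_slice_of_normal hφ hy hP]
  linear_combination (Real.exp (-v / 2) * f (y, u) / 4) * hN

end IsAmbientOn

end AmbientNormality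

/-! ### Normal ambient spaces -/

theorem gjmsFactor_eq_coordGjmsFactor {E : Type*} [NormedAddCommGroup E] [NormedSpace ℝ E]
    [FiniteDimensional ℝ E] {H : Type*} [TopologicalSpace H] (I : ModelWithCorners ℝ E H)
    {M : Type*} [TopologicalSpace M] [ChartedSpace H M]
    (g : ∀ x : M, TangentSpace I x →L[ℝ] TangentSpace I x →L[ℝ] ℝ) (φ f : M → ℝ) (x : M) :
    gjmsFactor I g φ f x = coordGjmsFactor (chartMetric I g x) (φ ∘ (extChartAt I x).symm)
      (f ∘ (extChartAt I x).symm) (extChartAt I x x) := by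
  rw [coordGjmsFactor, Function.comp_apply, extChartAt_to_inv]
  rfl

theorem eq_zero_of_isBigO_pow_one {F : ℝ → ℝ} (hF : F =O[𝓝 0] fun u : ℝ => u ^ 1) : F 0 = 0 :=
  Asymptotics.IsBigO.eq_zero_of_norm_pow (n := 1) (by simpa using hF.norm_right) one_ne_zero

namespace NormalAmbientSpace

variable {n : ℕ} {M : Type*} [TopologicalSpace M] [ChartedSpace (EuclideanSpace ℝ (Fin n)) M]

theorem ambientMetric_apply
    (gu : ∀ x : M, ℝ → TangentSpace (𝓡 n) x →L[ℝ] TangentSpace (𝓡 n) x →L[ℝ] ℝ) (p : ℝ × M × ℝ)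
    (X Y : ℝ × EuclideanSpace ℝ (Fin n) × ℝ) :
    (show (ℝ × EuclideanSpace ℝ (Fin n) × ℝ) →L[ℝ] (ℝ × EuclideanSpace ℝ (Fin n) × ℝ) →L[ℝ] ℝ from
      ambientMetric gu p) X Y = X.1 * Y.2.2 + X.2.2 * Y.1 +
        (show EuclideanSpace ℝ (Fin n) →L[ℝ] EuclideanSpace ℝ (Fin n) →L[ℝ] ℝ from
          gu p.2.1 p.2.2) X.2.1 Y.2.1 := rfl

theorem extChartAt_ambient (v : ℝ) (x : M) (u : ℝ) : extChartAt (ambientModel n) (v, x, u) =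
    (PartialEquiv.refl ℝ).prod ((extChartAt (𝓡 n) x).prod (PartialEquiv.refl ℝ)) := by
  rw [extChartAt_prod, extChartAt_prod, extChartAt_model_space_eq_id, extChartAt_model_space_eq_id]

theorem extChartAt_ambient_symm_apply (v : ℝ) (x : M) (u : ℝ)
    (q : ℝ × EuclideanSpace ℝ (Fin n) × ℝ) :
    (extChartAt (ambientModel n) (v, x, u)).symm q =
      (q.1, (extChartAt (𝓡 n) x).symm q.2.1, q.2.2) := by
  rw [extChartAt_ambient]
  rfl

theorem mem_extChartAt_ambient_target (v : ℝ) (x : M) (u : ℝ)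
    (q : ℝ × EuclideanSpace ℝ (Fin n) × ℝ) :
    q ∈ (extChartAt (ambientModel n) (v, x, u)).target ↔
      q.2.1 ∈ (extChartAt (𝓡 n) x).target := by
  rw [extChartAt_ambient, PartialEquiv.prod_target, PartialEquiv.prod_target]
  exact ⟨fun h => h.2.1, fun h => ⟨trivial, h, trivial⟩⟩

theorem extChartAt_ambient_apply_self (v : ℝ) (x : M) (u : ℝ) :
    extChartAt (ambientModel n) (v, x, u) (v, x, u) = (v, extChartAt (𝓡 n) x x, u) := by
  rw [extChartAt_ambient]
  rfl

/-- The expression of a function on `M × ℝ` in the chart of `M` at `x`. -/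
def chartExpr (x : M) (f : M × ℝ → ℝ) (w : EuclideanSpace ℝ (Fin n) × ℝ) : ℝ :=
  f ((extChartAt (𝓡 n) x).symm w.1, w.2)

theorem ambientPotential_comp_extChartAt_symm (f : M × ℝ → ℝ) (v : ℝ) (x : M) (u : ℝ) :
    ambientPotential f ∘ (extChartAt (ambientModel n) (v, x, u)).symm =
      ambientPotential (chartExpr x f) :=
  funext fun q => congrArg (ambientPotential f) (extChartAt_ambient_symm_apply v x u q)

theorem ambientDensity_comp_extChartAt_symm (f : M × ℝ → ℝ) (v : ℝ) (x : M) (u : ℝ) :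
    ambientDensity f ∘ (extChartAt (ambientModel n) (v, x, u)).symm =
      ambientDensity (chartExpr x f) :=
  funext fun q => congrArg (ambientDensity f) (extChartAt_ambient_symm_apply v x u q)

variable [IsManifold (𝓡 n) ∞ M]

theorem chartDeriv_ambient (v : ℝ) (x : M) (u : ℝ) {q : ℝ × EuclideanSpace ℝ (Fin n) × ℝ}
    (hq : q.2.1 ∈ (extChartAt (𝓡 n) x).target) (X : ℝ × EuclideanSpace ℝ (Fin n) × ℝ) :
    chartDeriv (ambientModel n) (v, x, u) q X = (X.1, chartDeriv (𝓡 n) x q.2.1 X.2.1, X.2.2) := by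
  have fst_deriv : HasMFDerivAt 𝓘(ℝ, ℝ × EuclideanSpace ℝ (Fin n) × ℝ) 𝓘(ℝ, ℝ)
      (fun q : ℝ × EuclideanSpace ℝ (Fin n) × ℝ => q.1) q
      (ContinuousLinearMap.fst ℝ ℝ (EuclideanSpace ℝ (Fin n) × ℝ)) := hasFDerivAt_fst.hasMFDerivAt
  have mid_deriv : HasMFDerivAt 𝓘(ℝ, ℝ × EuclideanSpace ℝ (Fin n) × ℝ)
      𝓘(ℝ, EuclideanSpace ℝ (Fin n)) (fun q : ℝ × EuclideanSpace ℝ (Fin n) × ℝ => q.2.1) q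
      (ContinuousLinearMap.fst ℝ (EuclideanSpace ℝ (Fin n)) ℝ ∘L
        ContinuousLinearMap.snd ℝ ℝ (EuclideanSpace ℝ (Fin n) × ℝ)) :=
    (hasFDerivAt_fst.comp q hasFDerivAt_snd).hasMFDerivAt
  have last_deriv : HasMFDerivAt 𝓘(ℝ, ℝ × EuclideanSpace ℝ (Fin n) × ℝ) 𝓘(ℝ, ℝ)
      (fun q : ℝ × EuclideanSpace ℝ (Fin n) × ℝ => q.2.2) q
      (ContinuousLinearMap.snd ℝ (EuclideanSpace ℝ (Fin n)) ℝ ∘L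
        ContinuousLinearMap.snd ℝ ℝ (EuclideanSpace ℝ (Fin n) × ℝ)) :=
    (hasFDerivAt_snd.comp q hasFDerivAt_snd).hasMFDerivAt
  have base_deriv := (mdifferentiableAt_extChartAt_symm hq).hasMFDerivAt.comp q mid_deriv
  have chart_symm_eq : (extChartAt (ambientModel n) (v, x, u)).symm =
      fun q : ℝ × EuclideanSpace ℝ (Fin n) × ℝ =>
        (q.1, (extChartAt (𝓡 n) x).symm q.2.1, q.2.2) :=
    funext (extChartAt_ambient_symm_apply v x u)
  rw [chartDeriv, chart_symm_eq]
  exact congrArg (fun T : (ℝ × EuclideanSpace ℝ (Fin n) × ℝ) →L[ℝ]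
    (ℝ × EuclideanSpace ℝ (Fin n) × ℝ) => T X)
    (fst_deriv.prodMk (base_deriv.prodMk last_deriv)).mfderiv

variable {g : RMetric n M} {φ : SmoothFn n M} (S : NormalAmbientSpace g φ) {f : M × ℝ → ℝ}

/-- The domain of the ambient metric. -/
def carrier : Set (ℝ × M × ℝ) := {p | p.2 ∈ S.dom}

/-- The expression of `dom` in the chart of `M` at `x`. -/
def chartDom (x : M) : Set (EuclideanSpace ℝ (Fin n) × ℝ) :=
  {w | w.1 ∈ (extChartAt (𝓡 n) x).target ∧ ((extChartAt (𝓡 n) x).symm w.1, w.2) ∈ S.dom}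

/-- The family of metrics `g_u` in the chart of `M` at `x`. -/
def chartFamily (x : M) (w : EuclideanSpace ℝ (Fin n) × ℝ) :
    EuclideanSpace ℝ (Fin n) →L[ℝ] EuclideanSpace ℝ (Fin n) →L[ℝ] ℝ :=
  chartMetric (𝓡 n) (fun z => S.gu z w.2) x w.1

theorem isOpen_carrier : IsOpen S.carrier := S.isOpen_dom.preimage continuous_snd

theorem isSmoothMetricOn :
    IsSmoothMetricOn (ambientModel n) (ambientMetric S.gu) S.carrier where
  isOpen := S.isOpen_carrier
  contMDiffOn := S.smooth_metric
  symm p hp X Y := by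
    refine (ambientMetric_apply S.gu p X Y).trans (.trans ?_ (ambientMetric_apply S.gu p Y X).symm)
    exact congrArg₂ (· + ·) (by ring) (S.gu_symm p.2.1 p.2.2 hp X.2.1 Y.2.1)
  nondegenerate p hp X hX := by
    obtain ⟨a, X, b⟩ := X
    have b_eq := (ambientMetric_apply S.gu p (a, X, b) (1, 0, 0)).symm.trans (hX (1, 0, 0))
    have a_eq := (ambientMetric_apply S.gu p (a, X, b) (0, 0, 1)).symm.trans (hX (0, 0, 1))
    have norm_eq := (ambientMetric_apply S.gu p (a, X, b) (0, X, 0)).symm.trans (hX (0, X, 0))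
    simp only [mul_one, mul_zero, add_zero, map_zero, zero_add] at a_eq b_eq norm_eq
    have X_eq : X = 0 := by
      by_contra hX_ne
      exact (S.gu_pos p.2.1 p.2.2 hp X hX_ne).ne' norm_eq
    rw [a_eq, b_eq, X_eq]
    rfl

theorem chartSet_carrier (v : ℝ) (x : M) (u : ℝ) :
    chartSet (ambientModel n) (v, x, u) S.carrier = {q | q.2 ∈ S.chartDom x} := by
  ext q
  rw [chartSet, Set.mem_inter_iff, mem_extChartAt_ambient_target, Set.mem_preimage,
    extChartAt_ambient_symm_apply]
  rfl

theorem isOpen_chartDom (x : M) : IsOpen (S.chartDom x) := by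
  have isOpen_chartSet_carrier := isOpen_chartSet (I := ambientModel n) (0, x, 0) S.isOpen_carrier
  rw [S.chartSet_carrier] at isOpen_chartSet_carrier
  exact isOpen_chartSet_carrier.preimage (f := fun w => ((0 : ℝ), w)) (by fun_prop)

theorem mem_chartDom {x : M} {u : ℝ} (h : (x, u) ∈ S.dom) :
    (extChartAt (𝓡 n) x x, u) ∈ S.chartDom x :=
  ⟨_root_.mem_extChartAt_target x, by rwa [extChartAt_to_inv]⟩

theorem isAmbientOn (v : ℝ) (x : M) (u : ℝ) :
    IsAmbientOn (chartMetric (ambientModel n) (ambientMetric S.gu) (v, x, u)) (S.chartFamily x)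
      (S.chartDom x) where
  isOpen := S.isOpen_chartDom x
  isMetricOn := by
    rw [← S.chartSet_carrier v x u]
    exact S.isSmoothMetricOn.isMetricOn_chartMetric (v, x, u)
  apply_eq q hq X Y := by
    rw [chartMetric_apply, chartDeriv_ambient v x u hq.1, chartDeriv_ambient v x u hq.1,
      extChartAt_ambient_symm_apply]
    rfl

theorem contDiffOn_chartExpr (hf : ContMDiffOn ((𝓡 n).prod 𝓘(ℝ, ℝ)) 𝓘(ℝ, ℝ) ∞ f S.dom) (x : M) :
    ContDiffOn ℝ ∞ (chartExpr x f) (S.chartDom x) := by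
  rw [← contMDiffOn_iff_contDiffOn]
  have base_smooth : ContMDiffOn 𝓘(ℝ, EuclideanSpace ℝ (Fin n) × ℝ) (𝓡 n) ∞
      (fun w : EuclideanSpace ℝ (Fin n) × ℝ => (extChartAt (𝓡 n) x).symm w.1) (S.chartDom x) :=
    (contMDiffOn_extChartAt_symm x).comp
      (contMDiffOn_iff_contDiffOn.2 contDiff_fst.contDiffOn) fun w hw => hw.1
  have snd_smooth : ContMDiffOn 𝓘(ℝ, EuclideanSpace ℝ (Fin n) × ℝ) 𝓘(ℝ, ℝ) ∞
      (fun w : EuclideanSpace ℝ (Fin n) × ℝ => w.2) (S.chartDom x) :=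
    contMDiffOn_iff_contDiffOn.2 contDiff_snd.contDiffOn
  exact hf.comp (base_smooth.prodMk snd_smooth) fun w hw => hw.2

theorem contDiffAt_chartExpr (hf : ContMDiffOn ((𝓡 n).prod 𝓘(ℝ, ℝ)) 𝓘(ℝ, ℝ) ∞ f S.dom)
    {x : M} {u : ℝ} (h : (x, u) ∈ S.dom) :
    ContDiffAt ℝ 2 (chartExpr x f) (extChartAt (𝓡 n) x x, u) :=
  contDiffAt_two_of_contDiffOn (S.isOpen_chartDom x) (S.contDiffOn_chartExpr hf x)
    (S.mem_chartDom h)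

theorem contMDiffOn_ambientPotential :
    ContMDiffOn (ambientModel n) 𝓘(ℝ, ℝ) ∞ (ambientPotential S.φu) S.carrier :=
  (S.smooth_potential.comp contMDiffOn_snd fun _ hp => hp).sub contMDiffOn_fst

theorem contMDiffOn_ambientDensity
    (hf : ContMDiffOn ((𝓡 n).prod 𝓘(ℝ, ℝ)) 𝓘(ℝ, ℝ) ∞ f S.dom) :
    ContMDiffOn (ambientModel n) 𝓘(ℝ, ℝ) ∞ (ambientDensity f) S.carrier := by
  have weight_smooth : ContDiff ℝ ∞ fun v : ℝ => Real.exp (-v / 2) := by fun_prop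
  exact (weight_smooth.contMDiff.comp_contMDiffOn contMDiffOn_fst).mul
    (hf.comp contMDiffOn_snd fun _ hp => hp)

theorem weightedLaplacian_ambientDensity_eq_coord (f : M × ℝ → ℝ) (v : ℝ) (x : M) (u : ℝ) :
    S.weightedLaplacian (ambientDensity f) (v, x, u) =
      coordWeightedLaplacian (chartMetric (ambientModel n) (ambientMetric S.gu) (v, x, u))
        (ambientPotential (chartExpr x S.φu)) (ambientDensity (chartExpr x f))
        (v, extChartAt (𝓡 n) x x, u) := by
  rw [← extChartAt_ambient_apply_self, ← ambientPotential_comp_extChartAt_symm S.φu v x u,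
    ← ambientDensity_comp_extChartAt_symm f v x u]
  rfl

theorem weightedLaplacian_ambientDensity
    (hf : ContMDiffOn ((𝓡 n).prod 𝓘(ℝ, ℝ)) 𝓘(ℝ, ℝ) ∞ f S.dom)
    {v : ℝ} {x : M} {u : ℝ} (h : (x, u) ∈ S.dom) :
    S.weightedLaplacian (ambientDensity f) (v, x, u) = Real.exp (-v / 2) *
      S.weightedLaplacian (ambientDensity f) (0, x, u) := by
  have coord_eq (v : ℝ) := (S.isAmbientOn v x u).coordWeightedLaplacian_ambientDensity (v := v)
    ((S.contDiffAt_chartExpr S.smooth_potential h).differentiableAt two_ne_zero)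
    (S.contDiffAt_chartExpr hf h) (S.mem_chartDom h)
  rw [weightedLaplacian_ambientDensity_eq_coord, weightedLaplacian_ambientDensity_eq_coord,
    coord_eq, coord_eq, neg_zero, zero_div, Real.exp_zero, one_mul]

theorem ricciForm_add_hessianForm_ambientPotential_zero (x : M) :
    ricciForm (chartMetric (ambientModel n) (ambientMetric S.gu) (0, x, 0))
        (0, extChartAt (𝓡 n) x x, 0) +
      hessianForm (chartMetric (ambientModel n) (ambientMetric S.gu) (0, x, 0))
        (ambientPotential (chartExpr x S.φu)) (0, extChartAt (𝓡 n) x x, 0) = 0 := by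
  rw [← extChartAt_ambient_apply_self, ← ambientPotential_comp_extChartAt_symm S.φu 0 x 0]
  exact LinearMap.ext₂ fun X Y => eq_zero_of_isBigO_pow_one (S.P_vanishes 0 x X Y 1)

theorem coordWeightedLaplacian_ambientPotential_zero (x : M) :
    coordWeightedLaplacian (chartMetric (ambientModel n) (ambientMetric S.gu) (0, x, 0))
      (ambientPotential (chartExpr x S.φu)) (ambientPotential (chartExpr x S.φu))
      (0, extChartAt (𝓡 n) x x, 0) = 0 := by
  rw [← extChartAt_ambient_apply_self, ← ambientPotential_comp_extChartAt_symm S.φu 0 x 0]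
  exact eq_zero_of_isBigO_pow_one (S.F_vanishes 0 x 1)

theorem weightedLaplacian_ambientDensity_zero
    (hf : ContMDiffOn ((𝓡 n).prod 𝓘(ℝ, ℝ)) 𝓘(ℝ, ℝ) ∞ f S.dom) (x : M) :
    S.weightedLaplacian (ambientDensity f) (0, x, 0) =
      gjmsFactor (𝓡 n) g.inner φ (fun z => f (z, 0)) x := by
  have chartFamily_zero : (fun y => S.chartFamily x (y, 0)) = chartMetric (𝓡 n) g.inner x :=
    funext fun y => by simp only [chartFamily, S.gu_zero]
  have potential_zero : (fun y => chartExpr x S.φu (y, 0)) = φ ∘ (extChartAt (𝓡 n) x).symm :=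
    funext fun y => S.φu_zero _
  rw [weightedLaplacian_ambientDensity_eq_coord,
    (S.isAmbientOn 0 x 0).coordWeightedLaplacian_ambientDensity_of_normal
      (S.contDiffAt_chartExpr S.smooth_potential (S.zero_mem x))
      (S.contDiffAt_chartExpr hf (S.zero_mem x)) (S.mem_chartDom (S.zero_mem x))
      (S.ricciForm_add_hessianForm_ambientPotential_zero x)
      (S.coordWeightedLaplacian_ambientPotential_zero x),
    gjmsFactor_eq_coordGjmsFactor, chartFamily_zero, potential_zero, neg_zero, zero_div,
    Real.exp_zero, one_mul]
  rfl

theorem exists_iterate_weightedLaplacian_eq_ambientDensity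
    (hf : ContMDiffOn ((𝓡 n).prod 𝓘(ℝ, ℝ)) 𝓘(ℝ, ℝ) ∞ f S.dom) (k : ℕ) :
    ∃ h : M × ℝ → ℝ, ContMDiffOn ((𝓡 n).prod 𝓘(ℝ, ℝ)) 𝓘(ℝ, ℝ) ∞ h S.dom ∧
      Set.EqOn (S.weightedLaplacian^[k] (ambientDensity f)) (ambientDensity h) S.carrier ∧
      (fun x => h (x, 0)) = (gjmsFactor (𝓡 n) g.inner φ)^[k] fun x => f (x, 0) := by
  induction k with
  | zero => exact ⟨f, hf, fun _ _ => rfl, rfl⟩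
  | succ k ih =>
    obtain ⟨h, hh, h_eq, h_zero⟩ := ih
    refine ⟨fun w => S.weightedLaplacian (ambientDensity h) (0, w), ?_, ?_, ?_⟩
    · exact (S.isSmoothMetricOn.contMDiffOn_weightedLaplacian S.contMDiffOn_ambientPotential
        (S.contMDiffOn_ambientDensity hh)).comp (contMDiffOn_const.prodMk contMDiffOn_id)
          fun w hw => hw
    · rintro ⟨v, x, u⟩ hp
      rw [Function.iterate_succ_apply']
      have h_eq_near := h_eq.eventuallyEq_of_mem (S.isOpen_carrier.mem_nhds hp)
      exact (weightedLaplacian_congr h_eq_near).trans (S.weightedLaplacian_ambientDensity hh hp)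
    · rw [Function.iterate_succ_apply', ← h_zero]
      exact funext fun x => S.weightedLaplacian_ambientDensity_zero hh x

theorem exp_mul_iterate_weightedLaplacian_ambientDensity
    (hf : ContMDiffOn ((𝓡 n).prod 𝓘(ℝ, ℝ)) 𝓘(ℝ, ℝ) ∞ f S.dom) (k : ℕ) (v : ℝ) (x : M) :
    Real.exp (v / 2) * (S.weightedLaplacian^[k] (ambientDensity f)) (v, x, 0) =
      ((gjmsFactor (𝓡 n) g.inner φ)^[k] fun x => f (x, 0)) x := by
  obtain ⟨h, -, h_eq, h_zero⟩ := S.exists_iterate_weightedLaplacian_eq_ambientDensity hf k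
  rw [h_eq (S.zero_mem x), ← h_zero, ambientDensity, ← mul_assoc, ← Real.exp_add, neg_div,
    add_neg_cancel, Real.exp_zero, one_mul]

end NormalAmbientSpace

/-! ### The operators and their conformal covariance -/

section Order

variable {A : Type*} [CommRing A] [Algebra ℝ A]

namespace IsDiffOpOfOrderLT

theorem zero (m : ℕ) : IsDiffOpOfOrderLT m (0 : Module.End ℝ A) := by
  induction m with
  | zero => rfl
  | succ m ih => exact fun a => by rwa [zero_mul, mul_zero, sub_zero]

theorem add {m : ℕ} {D D' : Module.End ℝ A} (h : IsDiffOpOfOrderLT m D)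
    (h' : IsDiffOpOfOrderLT m D') : IsDiffOpOfOrderLT m (D + D') := by
  induction m generalizing D D' with
  | zero =>
    obtain rfl : D = 0 := h
    rwa [zero_add]
  | succ m ih =>
    intro a
    rw [add_mul, mul_add, add_sub_add_comm]
    exact ih (h a) (h' a)

theorem succ {m : ℕ} {D : Module.End ℝ A} (h : IsDiffOpOfOrderLT m D) :
    IsDiffOpOfOrderLT (m + 1) D := by
  induction m generalizing D with
  | zero =>
    obtain rfl : D = 0 := h
    exact zero 1
  | succ m ih => exact fun a => ih (h a)

theorem mul {p q r : ℕ} {D D' : Module.End ℝ A} (h : IsDiffOpOfOrderLT p D)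
    (h' : IsDiffOpOfOrderLT q D') (hr : p + q ≤ r + 1) : IsDiffOpOfOrderLT r (D * D') := by
  induction p generalizing D D' q r with
  | zero =>
    obtain rfl : D = 0 := h
    rw [zero_mul]
    exact zero r
  | succ p ihp =>
    induction q generalizing D' r with
    | zero =>
      obtain rfl : D' = 0 := h'
      rw [mul_zero]
      exact zero r
    | succ q ihq =>
      obtain ⟨r, rfl⟩ : ∃ s, r = s + 1 := ⟨r - 1, by omega⟩
      intro a
      have commutator_mul : D * D' * LinearMap.mulLeft ℝ a - LinearMap.mulLeft ℝ a * (D * D') =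
          D * (D' * LinearMap.mulLeft ℝ a - LinearMap.mulLeft ℝ a * D') +
            (D * LinearMap.mulLeft ℝ a - LinearMap.mulLeft ℝ a * D) * D' := by
        noncomm_ring
      rw [commutator_mul]
      exact (ihq (h' a) (by omega)).add (ihp (h a) h' (by omega))

theorem mulLeft (a : A) : IsDiffOpOfOrderLT 1 (LinearMap.mulLeft ℝ a) := by
  intro b
  refine LinearMap.ext fun f => sub_eq_zero.2 ?_
  exact mul_left_comm a b f

theorem one : IsDiffOpOfOrderLT 1 (1 : Module.End ℝ A) :=
  fun a => by rw [one_mul, mul_one, sub_self]; rfl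

theorem pow {m : ℕ} {D : Module.End ℝ A} (h : IsDiffOpOfOrderLT (m + 1) D) (k : ℕ) :
    IsDiffOpOfOrderLT (m * k + 1) (D ^ k) := by
  induction k with
  | zero => exact one
  | succ k ih =>
    rw [pow_succ']
    exact h.mul ih (by linarith)

theorem pow_add_sub_pow {m : ℕ} {D B : Module.End ℝ A} (hD : IsDiffOpOfOrderLT (m + 1) D)
    (hB : IsDiffOpOfOrderLT m B) (k : ℕ) : IsDiffOpOfOrderLT (m * k) ((D + B) ^ k - D ^ k) := by
  induction k with
  | zero =>
    rw [pow_zero, pow_zero, sub_self]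
    exact zero _
  | succ k ih =>
    have telescope : (D + B) ^ (k + 1) - D ^ (k + 1) =
        (D + B) * ((D + B) ^ k - D ^ k) + B * D ^ k := by
      rw [pow_succ', pow_succ']
      noncomm_ring
    rw [telescope]
    exact ((hD.add hB.succ).mul ih (by linarith)).add (hB.mul (hD.pow k) (by linarith))

end IsDiffOpOfOrderLT

end Order

section Operators

variable {n : ℕ} {M : Type*} [TopologicalSpace M] [ChartedSpace (EuclideanSpace ℝ (Fin n)) M]

theorem extChartAt_mem_chartSet_univ (x : M) :
    extChartAt (𝓡 n) x x ∈ chartSet (𝓡 n) x Set.univ :=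
  mem_chartSet (Set.mem_univ x) (mem_extChartAt_source x)

theorem SmoothFn.comp_extChartAt_symm_self (f : SmoothFn n M) (x : M) :
    (f ∘ (extChartAt (𝓡 n) x).symm) (extChartAt (𝓡 n) x x) = f x :=
  congrArg f (extChartAt_to_inv x)

theorem coe_pow_apply_of_coe_apply {D : Module.End ℝ (SmoothFn n M)}
    {F : (M → ℝ) → M → ℝ} (hD : ∀ f, ⇑(D f) = F f) (f : SmoothFn n M) (k : ℕ) :
    ⇑((D ^ k) f) = F^[k] f := by
  induction k with
  | zero => rfl
  | succ k ih => rw [pow_succ', Module.End.mul_apply, hD, ih, Function.iterate_succ_apply']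

variable [IsManifold (𝓡 n) ∞ M] (g : RMetric n M)

theorem RMetric.isSmoothMetricOn : IsSmoothMetricOn (𝓡 n) g.inner (Set.univ : Set M) where
  isOpen := isOpen_univ
  contMDiffOn := g.contMDiff.contMDiffOn
  symm x _ X Y := g.symm x X Y
  nondegenerate x _ X hX := by
    by_contra hX_ne
    exact (g.pos x X hX_ne).ne' (hX X)

theorem RMetric.isMetricOn (x : M) : IsMetricOn (chartMetric (𝓡 n) g.inner x)
    (chartSet (𝓡 n) x Set.univ) :=
  g.isSmoothMetricOn.isMetricOn_chartMetric x

theorem SmoothFn.contDiffOn_chart (f : SmoothFn n M) (x : M) :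
    ContDiffOn ℝ ∞ (f ∘ (extChartAt (𝓡 n) x).symm) (chartSet (𝓡 n) x Set.univ) :=
  contDiffOn_comp_symm f.contMDiff.contMDiffOn x

theorem SmoothFn.contDiffAt_chart (f : SmoothFn n M) (x : M) :
    ContDiffAt ℝ 2 (f ∘ (extChartAt (𝓡 n) x).symm) (extChartAt (𝓡 n) x x) :=
  contDiffAt_two_of_contDiffOn (isOpen_chartSet x isOpen_univ) (f.contDiffOn_chart x)
    (extChartAt_mem_chartSet_univ x)

/-- The function `g(∇f, ∇h)` as a smooth function. -/
def gradInnerFn (f h : SmoothFn n M) : SmoothFn n M :=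
  ⟨gradInner (𝓡 n) g.inner f h, contMDiffOn_univ.1
    (g.isSmoothMetricOn.contMDiffOn_gradInner f.contMDiff.contMDiffOn
      h.contMDiff.contMDiffOn)⟩

/-- The zeroth order term `¼ R_φ` of the operator `Δ_φ - ¼ R_φ`. -/
def quarterCurvature (φ : SmoothFn n M) : SmoothFn n M :=
  ⟨fun x => 1 / 4 * weightedScalarCurvature (𝓡 n) g.inner φ x, contMDiff_const.mul
    (contMDiffOn_univ.1 (g.isSmoothMetricOn.contMDiffOn_weightedScalarCurvature
      φ.contMDiff.contMDiffOn))⟩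

/-- The weighted Laplacian `Δ_φ` as an endomorphism of the space of smooth functions. -/
def weightedLaplacianEnd (φ : SmoothFn n M) : Module.End ℝ (SmoothFn n M) where
  toFun f := ⟨weightedLaplacian (𝓡 n) g.inner φ f,
    contMDiffOn_univ.1 (g.isSmoothMetricOn.contMDiffOn_weightedLaplacian
      φ.contMDiff.contMDiffOn f.contMDiff.contMDiffOn)⟩
  map_add' f h := by
    ext x
    exact coordWeightedLaplacian_add (f.contDiffAt_chart x) (h.contDiffAt_chart x)
  map_smul' c f := by
    ext x
    exact coordWeightedLaplacian_const_mul (f.contDiffAt_chart x) c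

/-- The operator `Δ_φ - ¼ R_φ` on smooth functions, whose `k`-th power is `L_{2k,φ}`. -/
def gjmsEnd (φ : SmoothFn n M) : Module.End ℝ (SmoothFn n M) :=
  weightedLaplacianEnd g φ + LinearMap.mulLeft ℝ (-quarterCurvature g φ)

theorem gjmsEnd_apply (φ f : SmoothFn n M) :
    ⇑(gjmsEnd g φ f) = gjmsFactor (𝓡 n) g.inner φ f := by
  ext1 x
  change weightedLaplacian (𝓡 n) g.inner φ f x +
    -(1 / 4 * weightedScalarCurvature (𝓡 n) g.inner φ x) * f x = _
  rw [gjmsFactor]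
  ring

theorem gjmsEnd_pow_apply (φ f : SmoothFn n M) (k : ℕ) :
    ⇑((gjmsEnd g φ ^ k) f) = (gjmsFactor (𝓡 n) g.inner φ)^[k] f :=
  coe_pow_apply_of_coe_apply (gjmsEnd_apply g φ) f k

theorem weightedLaplacianEnd_pow_apply (φ f : SmoothFn n M) (k : ℕ) :
    ⇑((weightedLaplacianEnd g φ ^ k) f) = (weightedLaplacian (𝓡 n) g.inner φ)^[k] f :=
  coe_pow_apply_of_coe_apply (fun _ => rfl) f k

theorem gradInnerFn_comm (f h : SmoothFn n M) : gradInnerFn g f h = gradInnerFn g h f := by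
  ext x
  exact (g.isMetricOn x).coordGradInner_comm _ _ (extChartAt_mem_chartSet_univ x)

theorem gradInnerFn_mul_right (a b f : SmoothFn n M) :
    gradInnerFn g a (b * f) = b * gradInnerFn g a f + f * gradInnerFn g a b := by
  ext x
  have product_rule := coordGradInner_mul_right (G := chartMetric (𝓡 n) g.inner x)
    (h := a ∘ (extChartAt (𝓡 n) x).symm) ((b.contDiffAt_chart x).differentiableAt two_ne_zero)
    ((f.contDiffAt_chart x).differentiableAt two_ne_zero)
  rwa [b.comp_extChartAt_symm_self, f.comp_extChartAt_symm_self] at product_rule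

theorem weightedLaplacianEnd_mul (φ a f : SmoothFn n M) :
    weightedLaplacianEnd g φ (a * f) = a * weightedLaplacianEnd g φ f
      + f * weightedLaplacianEnd g φ a + (gradInnerFn g a f + gradInnerFn g f a) := by
  ext x
  have product_rule := coordWeightedLaplacian_mul (G := chartMetric (𝓡 n) g.inner x)
    (φ := φ ∘ (extChartAt (𝓡 n) x).symm) (a.contDiffAt_chart x) (f.contDiffAt_chart x)
  rwa [a.comp_extChartAt_symm_self, f.comp_extChartAt_symm_self] at product_rule

theorem isDiffOpOfOrderLT_weightedLaplacianEnd (φ : SmoothFn n M) :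
    IsDiffOpOfOrderLT 3 (weightedLaplacianEnd g φ) := by
  intro a b
  have double_commutator : (weightedLaplacianEnd g φ * LinearMap.mulLeft ℝ a -
      LinearMap.mulLeft ℝ a * weightedLaplacianEnd g φ) * LinearMap.mulLeft ℝ b -
      LinearMap.mulLeft ℝ b * (weightedLaplacianEnd g φ * LinearMap.mulLeft ℝ a -
      LinearMap.mulLeft ℝ a * weightedLaplacianEnd g φ) =
      LinearMap.mulLeft ℝ (2 * gradInnerFn g a b) := by
    refine LinearMap.ext fun f => ?_
    simp only [LinearMap.sub_apply, Module.End.mul_apply, LinearMap.mulLeft_apply,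
      weightedLaplacianEnd_mul, gradInnerFn_mul_right, gradInnerFn_comm g _ a]
    ring
  rw [double_commutator]
  exact IsDiffOpOfOrderLT.mulLeft _

theorem isDiffOpOfOrderLT_gjmsEnd_pow_sub (φ : SmoothFn n M) (k : ℕ) :
    IsDiffOpOfOrderLT (2 * k) (gjmsEnd g φ ^ k - weightedLaplacianEnd g φ ^ k) :=
  (isDiffOpOfOrderLT_weightedLaplacianEnd g φ).pow_add_sub_pow
    (IsDiffOpOfOrderLT.mulLeft _).succ k

/-- The conformal factor `e^{-v/2}` of densities of weight `-1/2`. -/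
def expNegHalf (v : SmoothFn n M) : SmoothFn n M :=
  ⟨fun x => Real.exp (-1 / 2 * v x), by
    have exp_smooth : ContDiff ℝ ∞ fun t : ℝ => Real.exp (-1 / 2 * t) := by fun_prop
    exact exp_smooth.contMDiff.comp v.contMDiff⟩

theorem gjmsEnd_conformal (φ v f : SmoothFn n M) :
    gjmsEnd g (φ - v) (expNegHalf v * f) = expNegHalf v * gjmsEnd g φ f := by
  ext x
  have conformal := (g.isMetricOn x).coordGjmsFactor_conformal
    (extChartAt_mem_chartSet_univ x) (φ.contDiffAt_chart x) (v.contDiffAt_chart x)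
    (f.contDiffAt_chart x)
  rw [v.comp_extChartAt_symm_self] at conformal
  change _ = expNegHalf v x * gjmsEnd g φ f x
  rw [gjmsEnd_apply, gjmsEnd_apply, gjmsFactor_eq_coordGjmsFactor, gjmsFactor_eq_coordGjmsFactor]
  exact conformal

theorem gjmsEnd_pow_conformal (φ v f : SmoothFn n M) (k : ℕ) :
    (gjmsEnd g (φ - v) ^ k) (expNegHalf v * f) = expNegHalf v * (gjmsEnd g φ ^ k) f := by
  induction k with
  | zero => rfl
  | succ k ih =>
    rw [pow_succ', Module.End.mul_apply, ih, gjmsEnd_conformal, pow_succ', Module.End.mul_apply]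

/-- The map that `L_{2k}` induces on densities of weight `-1/2`. -/
def gjmsDensityMap (φ : SmoothFn n M) (k : ℕ) :
    ConformalDensity φ (-1 / 2) →ₗ[ℝ] ConformalDensity φ (-1 / 2) where
  toFun f := ⟨fun ψ => (gjmsEnd g (ψ : SmoothFn n M) ^ k) (f.1 ψ), fun ψ ψ' v hv x => by
    have density_eq : f.1 ψ' = expNegHalf v * f.1 ψ := by
      ext x
      exact f.2 ψ ψ' v hv x
    change (gjmsEnd g (ψ' : SmoothFn n M) ^ k) (f.1 ψ') x = _
    rw [density_eq, hv, gjmsEnd_pow_conformal]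
    rfl⟩
  map_add' f f' := by
    ext ψ : 2
    exact map_add (gjmsEnd g (ψ : SmoothFn n M) ^ k) _ _
  map_smul' c f := by
    ext ψ : 2
    exact map_smul (gjmsEnd g (ψ : SmoothFn n M) ^ k) _ _

end Operators

/-! ### The divergence theorem and Green's identity in coordinates -/

section Divergence

variable {E : Type*} [NormedAddCommGroup E] [NormedSpace ℝ E]

/-- The divergence of a vector field with respect to Lebesgue measure. -/
def coordDiv (V : E → E) (y : E) : ℝ := LinearMap.trace ℝ E (fderiv ℝ V y : E →ₗ[ℝ] E)

/-- The gradient of a function in coordinates. -/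
def coordGrad (G : E → E →L[ℝ] E →L[ℝ] ℝ) (f : E → ℝ) (y : E) : E :=
  (G y).inverse (fderiv ℝ f y)

/-- The vector field `ρ (h ∇f - f ∇h)`, whose flux is the boundary term of Green's identity. -/
def greenField (G : E → E →L[ℝ] E →L[ℝ] ℝ) (ρ f h : E → ℝ) : E → E :=
  (ρ * h) • coordGrad G f - (ρ * f) • coordGrad G h

theorem greenField_eq_zero {G : E → E →L[ℝ] E →L[ℝ] ℝ} {ρ f h : E → ℝ} {y : E}
    (hf : f =ᶠ[𝓝 y] 0) : greenField G ρ f h y = 0 := by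
  have grad_zero : coordGrad G f y = 0 := by
    rw [coordGrad, hf.fderiv_eq, fderiv_zero, Pi.zero_apply, map_zero]
  simp [greenField, grad_zero, hf.self_of_nhds]

theorem coordDiv_sub {V V' : E → E} {y : E} (hV : DifferentiableAt ℝ V y)
    (hV' : DifferentiableAt ℝ V' y) : coordDiv (V - V') y = coordDiv V y - coordDiv V' y := by
  rw [coordDiv, fderiv_sub hV hV', coordDiv, coordDiv, ← map_sub]
  rfl

theorem integrable_fderiv_apply [MeasurableSpace E] [BorelSpace E] (μ : Measure E)
    [μ.IsAddHaarMeasure] {f : E → ℝ} (hf : ContDiff ℝ 1 f) (hc : HasCompactSupport f) (w : E) :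
    Integrable (fun y => fderiv ℝ f y w) μ :=
  ((hf.continuous_fderiv one_ne_zero).clm_apply
    continuous_const).integrable_of_hasCompactSupport (hc.fderiv_apply ℝ w)

variable [FiniteDimensional ℝ E]

theorem coordDiv_smul {c : E → ℝ} {V : E → E} {y : E} (hc : DifferentiableAt ℝ c y)
    (hV : DifferentiableAt ℝ V y) :
    coordDiv (c • V) y = fderiv ℝ c y (V y) + c y * coordDiv V y := by
  have product_rule : (fderiv ℝ (c • V) y : E →ₗ[ℝ] E) =
      c y • (fderiv ℝ V y : E →ₗ[ℝ] E) + (fderiv ℝ c y : E →ₗ[ℝ] ℝ).smulRight (V y) := by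
    rw [(hc.hasFDerivAt.smul hV.hasFDerivAt).fderiv]
    rfl
  rw [coordDiv, product_rule, map_add, map_smul, LinearMap.trace_smulRight, add_comm]
  rfl

section Integral

variable [MeasurableSpace E] [BorelSpace E] (μ : Measure E) [μ.IsAddHaarMeasure]

theorem integral_fderiv_apply_eq_zero {f : E → ℝ} (hf : ContDiff ℝ 1 f)
    (hc : HasCompactSupport f) (w : E) : ∫ y, fderiv ℝ f y w ∂μ = 0 := by
  have by_parts := integral_mul_fderiv_eq_neg_fderiv_mul_of_integrable (μ := μ)
    (f := fun _ : E => (1 : ℝ)) (g := f) (v := w) (by simp)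
    (by simpa using integrable_fderiv_apply μ hf hc w)
    (by simpa using hf.continuous.integrable_of_hasCompactSupport hc)
    (fun _ _ => differentiableAt_const _) (fun y _ => hf.differentiable one_ne_zero y)
  simpa using by_parts

theorem integral_coordDiv_eq_zero {V : E → E} (hV : ContDiff ℝ 1 V) (hc : HasCompactSupport V) :
    ∫ y, coordDiv V y ∂μ = 0 := by
  let b := Module.finBasis ℝ E
  let component (i : Fin (Module.finrank ℝ E)) : E →L[ℝ] ℝ :=
    LinearMap.toContinuousLinearMap (b.coord i)
  have coordDiv_eq_sum (y : E) :
      coordDiv V y = ∑ i, fderiv ℝ (component i ∘ V) y (b i) := by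
    rw [coordDiv, trace_eq_sum_coord b]
    refine Finset.sum_congr rfl fun i _ => ?_
    rw [((component i).hasFDerivAt.comp y (hV.differentiable one_ne_zero y).hasFDerivAt).fderiv]
    rfl
  have smooth (i) : ContDiff ℝ 1 (component i ∘ V) := (component i).contDiff.comp hV
  have compactSupport (i) : HasCompactSupport (component i ∘ V) :=
    hc.comp_left (map_zero (component i))
  simp only [coordDiv_eq_sum]
  rw [integral_finsetSum _ fun i _ => integrable_fderiv_apply μ (smooth i) (compactSupport i) _]
  exact Finset.sum_eq_zero fun i _ =>
    integral_fderiv_apply_eq_zero μ (smooth i) (compactSupport i) _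

theorem setIntegral_coordDiv_eq_zero {U K : Set E} (hU : IsOpen U) (hK : IsCompact K)
    (hKU : K ⊆ U) {V : E → E} (hV : ContDiffOn ℝ 1 V U) (V_eq_zero : ∀ y ∈ U \ K, V y = 0) :
    ∫ y in U, coordDiv V y ∂μ = 0 := by
  have eq_zero_near : ∀ y ∉ U, U.indicator V =ᶠ[𝓝 y] 0 := fun y hy => by
    filter_upwards [hK.isClosed.isOpen_compl.mem_nhds fun h => hy (hKU h)] with z hz
    exact Set.indicator_apply_eq_zero.2 fun hzU => V_eq_zero z ⟨hzU, hz⟩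
  have eq_near : ∀ y ∈ U, U.indicator V =ᶠ[𝓝 y] V := fun y hy =>
    (Set.eqOn_indicator (s := U)).eventuallyEq_of_mem (hU.mem_nhds hy)
  have indicator_smooth : ContDiff ℝ 1 (U.indicator V) := contDiff_iff_contDiffAt.2 fun y => by
    by_cases hy : y ∈ U
    · exact (hV.contDiffAt (hU.mem_nhds hy)).congr_of_eventuallyEq (eq_near y hy)
    · exact contDiffAt_const.congr_of_eventuallyEq (eq_zero_near y hy)
  have indicator_compactSupport : HasCompactSupport (U.indicator V) :=
    HasCompactSupport.intro hK fun y hy =>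
      Set.indicator_apply_eq_zero.2 fun hyU => V_eq_zero y ⟨hyU, hy⟩
  have coordDiv_indicator : U.indicator (coordDiv V) = coordDiv (U.indicator V) := by
    ext y
    by_cases hy : y ∈ U
    · rw [Set.indicator_of_mem hy, coordDiv, coordDiv, (eq_near y hy).fderiv_eq]
    · rw [Set.indicator_of_notMem hy, coordDiv, (eq_zero_near y hy).fderiv_eq]
      simp
  rw [← integral_indicator hU.measurableSet, coordDiv_indicator]
  exact integral_coordDiv_eq_zero μ indicator_smooth indicator_compactSupport

end Integral

namespace IsMetricOn

variable {G : E → E →L[ℝ] E →L[ℝ] ℝ} {U : Set E} {f h : E → ℝ} {y : E}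

theorem metricTrace_flip (hG : IsMetricOn G U) (hy : y ∈ U) (T : LinearMap.BilinForm ℝ E) :
    metricTrace (G y) T.flip = metricTrace (G y) T := by
  let raise : Module.Dual ℝ E →ₗ[ℝ] E := ((G y).inverse : (E →L[ℝ] ℝ) →ₗ[ℝ] E) ∘ₗ
    (LinearMap.toContinuousLinearMap : (E →ₗ[ℝ] ℝ) ≃ₗ[ℝ] (E →L[ℝ] ℝ)).toLinearMap
  have transpose_raise : Module.Dual.transpose (R := ℝ) (raise ∘ₗ T) = T.flip ∘ₗ raise := by
    ext α X
    exact hG.apply_inverse_comm hy (LinearMap.toContinuousLinearMap α)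
      (LinearMap.toContinuousLinearMap (T X))
  calc metricTrace (G y) T.flip
      = LinearMap.trace ℝ E (raise ∘ₗ T.flip) := rfl
    _ = LinearMap.trace ℝ _ (T.flip ∘ₗ raise) := LinearMap.trace_comp_comm' _ _
    _ = LinearMap.trace ℝ E (raise ∘ₗ T) := by
      rw [← transpose_raise, LinearMap.trace_transpose']

theorem contDiffOn_coordGrad (hG : IsMetricOn G U) (hf : ContDiffOn ℝ ∞ f U) :
    ContDiffOn ℝ ∞ (coordGrad G f) U :=
  hG.contDiffOn_inverse.clm_apply (contDiffOn_fderiv hG.isOpen hf)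

theorem contDiffOn_greenField (hG : IsMetricOn G U) {ρ : E → ℝ} (hρ : ContDiffOn ℝ ∞ ρ U)
    (hf : ContDiffOn ℝ ∞ f U) (hh : ContDiffOn ℝ ∞ h U) :
    ContDiffOn ℝ ∞ (greenField G ρ f h) U :=
  ((hρ.mul hh).smul (hG.contDiffOn_coordGrad hf)).sub
    ((hρ.mul hf).smul (hG.contDiffOn_coordGrad hh))

theorem differentiableAt_coordGrad (hG : IsMetricOn G U) (hf : ContDiffAt ℝ 2 f y)
    (hy : y ∈ U) : DifferentiableAt ℝ (coordGrad G f) y :=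
  (differentiableAt_of_contDiffOn hG.isOpen hG.contDiffOn_inverse hy).clm_apply
    (differentiableAt_fderiv hf)

theorem fderiv_coordGrad (hG : IsMetricOn G U) (hf : ContDiffAt ℝ 2 f y) (hy : y ∈ U) (W : E) :
    fderiv ℝ (coordGrad G f) y W = (G y).inverse
      (fderiv ℝ (fderiv ℝ f) y W - fderiv ℝ G y W (coordGrad G f y)) := by
  have product_rule := (hG.differentiableAt hy).hasFDerivAt.clm_apply
    (hG.differentiableAt_coordGrad hf hy).hasFDerivAt
  have lower_grad : (fun z => G z (coordGrad G f z)) =ᶠ[𝓝 y] fderiv ℝ f := by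
    filter_upwards [hG.isOpen.mem_nhds hy] with z hz
    rw [coordGrad, (hG.isInvertible z hz).self_apply_inverse]
  have second_deriv := DFunLike.congr_fun ((product_rule.congr_of_eventuallyEq
    lower_grad.symm).unique (differentiableAt_fderiv hf).hasFDerivAt) W
  simp only [add_apply, ContinuousLinearMap.comp_apply,
    ContinuousLinearMap.flip_apply] at second_deriv
  rw [eq_comm, (hG.isInvertible y hy).inverse_apply_eq, ← second_deriv, add_sub_cancel_right]

theorem coordDiv_coordGrad (hG : IsMetricOn G U) (hf : ContDiffAt ℝ 2 f y) (hy : y ∈ U) :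
    coordDiv (coordGrad G f) y = coordLaplacian G f y
      - 2⁻¹ * metricTrace (G y) (fderiv ℝ G y (coordGrad G f y)).toBilinForm := by
  set N := coordGrad G f y
  let T : LinearMap.BilinForm ℝ E :=
    (fderiv ℝ (fderiv ℝ f) y - (fderiv ℝ G y).flip N).toBilinForm
  let A : LinearMap.BilinForm ℝ E := ((fderiv ℝ G y).flip N).toBilinForm
  have coordDiv_eq : coordDiv (coordGrad G f) y = metricTrace (G y) T := by
    rw [coordDiv, metricTrace]
    congr 1
    ext W
    exact hG.fderiv_coordGrad hf hy W
  have fderiv_christoffel (W Z : E) :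
      fderiv ℝ f y (christoffel G y W Z) = christoffelLower G y W Z N := by
    rw [christoffel_apply, hG.apply_inverse_comm hy]
    rfl
  have hessian_eq : hessianForm G f y + (2⁻¹ : ℝ) • A.flip = T + (2⁻¹ : ℝ) • A
      + (2⁻¹ : ℝ) • (fderiv ℝ G y N).toBilinForm := by
    ext W Z
    have hT : T W Z = fderiv ℝ (fderiv ℝ f) y W Z - fderiv ℝ G y W N Z := rfl
    have hA : A W Z = fderiv ℝ G y W N Z := rfl
    have hA_flip : A.flip W Z = fderiv ℝ G y Z N W := rfl
    simp only [LinearMap.add_apply, LinearMap.smul_apply, hT, hA, hA_flip, hessianForm_apply,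
      fderiv_christoffel, christoffelLower_apply, ContinuousLinearMap.toBilinForm_apply,
      smul_eq_mul, hG.fderiv_symm hy _ N]
    ring
  have trace_eq := congrArg (metricTrace (G y)) hessian_eq
  simp only [metricTrace_add, metricTrace_smul, hG.metricTrace_flip hy] at trace_eq
  rw [coordDiv_eq, coordLaplacian]
  linarith

/-- Green's identity, for a density `ρ` whose logarithmic derivative `½ tr_G (D_N G) - Dφ(N)` is
that of `√(det G) e^{-φ}`. -/
theorem coordDiv_greenField (hG : IsMetricOn G U) {ρ φ : E → ℝ} (hρ : DifferentiableAt ℝ ρ y)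
    (fderiv_ρ : ∀ N, fderiv ℝ ρ y N =
      ρ y * (2⁻¹ * metricTrace (G y) (fderiv ℝ G y N).toBilinForm - fderiv ℝ φ y N))
    (hf : ContDiffAt ℝ 2 f y) (hh : ContDiffAt ℝ 2 h y) (hy : y ∈ U) :
    coordDiv (greenField G ρ f h) y =
      ρ y * (h y * coordWeightedLaplacian G φ f y - f y * coordWeightedLaplacian G φ h y) := by
  have hf' := hf.differentiableAt two_ne_zero
  have hh' := hh.differentiableAt two_ne_zero
  have grad_f := hG.differentiableAt_coordGrad hf hy
  have grad_h := hG.differentiableAt_coordGrad hh hy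
  have h_grad_f : fderiv ℝ h y (coordGrad G f y) = coordGradInner G h f y := rfl
  have f_grad_h : fderiv ℝ f y (coordGrad G h y) = coordGradInner G h f y :=
    hG.coordGradInner_comm f h hy
  have φ_grad_f : fderiv ℝ φ y (coordGrad G f y) = coordGradInner G φ f y := rfl
  have φ_grad_h : fderiv ℝ φ y (coordGrad G h y) = coordGradInner G φ h y := rfl
  rw [greenField, coordDiv_sub ((hρ.mul hh').smul grad_f) ((hρ.mul hf').smul grad_h),
    coordDiv_smul (hρ.mul hh') grad_f, coordDiv_smul (hρ.mul hf') grad_h,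
    hG.coordDiv_coordGrad hf hy, hG.coordDiv_coordGrad hh hy, fderiv_mul hρ hh',
    fderiv_mul hρ hf', coordWeightedLaplacian, coordWeightedLaplacian]
  simp only [add_apply, smul_apply, smul_eq_mul, fderiv_ρ, h_grad_f, f_grad_h, φ_grad_f,
    φ_grad_h, Pi.mul_apply]
  ring

end IsMetricOn

end Divergence

section Determinant

variable {ι : Type*} [Fintype ι] [DecidableEq ι]

theorem contDiff_det : ContDiff ℝ ∞ fun A : ι → ι → ℝ => Matrix.det (Matrix.of A) := by
  simp only [Matrix.det_apply, Matrix.of_apply]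
  fun_prop

theorem hasDerivAt_det_one_add_smul (A : Matrix ι ι ℝ) :
    HasDerivAt (fun t : ℝ => Matrix.det (1 + t • A)) A.trace 0 := by
  have det_eq_eval : (fun t : ℝ => Matrix.det (1 + t • A)) = fun t => Polynomial.eval t
      (Matrix.det (1 + (Polynomial.X : Polynomial ℝ) • A.map Polynomial.C)) := by
    ext t
    simp [eval_det, ← Matrix.smul_eq_mul_diagonal]
  rw [det_eq_eval, ← Matrix.derivative_det_one_add_X_smul]
  exact Polynomial.hasDerivAt _ 0

theorem fderiv_det_one (A : ι → ι → ℝ) :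
    fderiv ℝ (fun A : ι → ι → ℝ => Matrix.det (Matrix.of A))
      (Matrix.of.symm (1 : Matrix ι ι ℝ)) A = ∑ i, A i i := by
  rw [← (contDiff_det.differentiable (by simp) _).lineDeriv_eq_fderiv]
  exact (hasDerivAt_det_one_add_smul (Matrix.of A)).deriv

end Determinant

section Density

variable {n : ℕ}

/-- The determinant of the Gram matrix of the standard basis. -/
def gramDet (B : EuclideanSpace ℝ (Fin n) →L[ℝ] EuclideanSpace ℝ (Fin n) →L[ℝ] ℝ) : ℝ :=
  Matrix.det (Matrix.of fun i j : Fin n =>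
    B (EuclideanSpace.single i 1) (EuclideanSpace.single j 1))

theorem sum_smul_single (X : EuclideanSpace ℝ (Fin n)) :
    ∑ k, X k • EuclideanSpace.single k (1 : ℝ) = X := by
  ext i
  simp [Pi.single_apply]

theorem contDiff_gramDet : ContDiff ℝ ∞ (gramDet (n := n)) := by
  refine contDiff_det.comp (f := fun B : EuclideanSpace ℝ (Fin n) →L[ℝ]
    EuclideanSpace ℝ (Fin n) →L[ℝ] ℝ => fun i j : Fin n =>
    B (EuclideanSpace.single i 1) (EuclideanSpace.single j 1)) ?_
  fun_prop

theorem gramDet_comp_left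
    {B B' : EuclideanSpace ℝ (Fin n) →L[ℝ] EuclideanSpace ℝ (Fin n) →L[ℝ] ℝ}
    {T : EuclideanSpace ℝ (Fin n) → EuclideanSpace ℝ (Fin n)} (h : ∀ X Y, B' X Y = B (T X) Y) :
    gramDet B' = Matrix.det (Matrix.of fun i j => T (EuclideanSpace.single i 1) j) * gramDet B := by
  rw [gramDet, gramDet, ← Matrix.det_mul]
  congr 1
  ext i j
  rw [Matrix.of_apply, Matrix.mul_apply, h]
  conv_lhs => rw [← sum_smul_single (T (EuclideanSpace.single i 1))]
  simp

theorem gramDet_pos {B : EuclideanSpace ℝ (Fin n) →L[ℝ] EuclideanSpace ℝ (Fin n) →L[ℝ] ℝ}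
    (symm : ∀ X Y, B X Y = B Y X) (pos : ∀ X, X ≠ 0 → 0 < B X X) : 0 < gramDet B := by
  refine Matrix.PosDef.det_pos (Matrix.PosDef.of_dotProduct_mulVec_pos ?_ fun x hx => ?_)
  · ext i j
    simp [Matrix.conjTranspose_apply, symm (EuclideanSpace.single j 1)]
  · have pos_x := pos (WithLp.toLp 2 x) (by simpa using hx)
    rw [← sum_smul_single (WithLp.toLp 2 x)] at pos_x
    simp only [map_sum, map_smul, sum_apply, smul_apply, smul_eq_mul, Finset.mul_sum] at pos_x
    simp only [dotProduct, Matrix.mulVec, Matrix.of_apply, Pi.star_apply, star_trivial,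
      Finset.mul_sum]
    refine pos_x.trans_eq (Finset.sum_congr rfl fun i _ => Finset.sum_congr rfl fun j _ => ?_)
    rw [symm]
    ring

/-- The density `√(det g_{ij}) e^{-φ}`. -/
def weightedDensity (G : EuclideanSpace ℝ (Fin n) → EuclideanSpace ℝ (Fin n) →L[ℝ]
    EuclideanSpace ℝ (Fin n) →L[ℝ] ℝ) (φ : EuclideanSpace ℝ (Fin n) → ℝ)
    (y : EuclideanSpace ℝ (Fin n)) : ℝ :=
  Real.sqrt (gramDet (G y)) * Real.exp (-φ y)

namespace IsMetricOn

variable {G : EuclideanSpace ℝ (Fin n) → EuclideanSpace ℝ (Fin n) →L[ℝ]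
    EuclideanSpace ℝ (Fin n) →L[ℝ] ℝ} {U : Set (EuclideanSpace ℝ (Fin n))}
    {φ : EuclideanSpace ℝ (Fin n) → ℝ} {y : EuclideanSpace ℝ (Fin n)}

-- Jacobi's formula: the Gram matrix of `G z` is that of `G y` multiplied by the matrix of
-- `(G y)⁻¹ ∘ G z`, which is the identity at `z = y`.
theorem fderiv_gramDet (hG : IsMetricOn G U) (hy : y ∈ U) (N : EuclideanSpace ℝ (Fin n)) :
    fderiv ℝ (fun z => gramDet (G z)) y N =
      gramDet (G y) * metricTrace (G y) (fderiv ℝ G y N).toBilinForm := by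
  let T (z : EuclideanSpace ℝ (Fin n)) (i j : Fin n) : ℝ :=
    (G y).inverse (G z (EuclideanSpace.single i 1)) j
  have gramDet_eq : (fun z => gramDet (G z)) =
      fun z => Matrix.det (Matrix.of (T z)) * gramDet (G y) :=
    funext fun z => gramDet_comp_left (T := fun X => (G y).inverse (G z X)) fun X Y =>
      (hG.apply_inverse hy _ _).symm
  have hT : HasFDerivAt T (ContinuousLinearMap.pi fun i => ContinuousLinearMap.pi fun j =>
      (EuclideanSpace.proj j ∘L (G y).inverse) ∘L
        ((fderiv ℝ G y).flip (EuclideanSpace.single i 1))) y :=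
    hasFDerivAt_pi.2 fun i => hasFDerivAt_pi.2 fun j =>
      (EuclideanSpace.proj j ∘L (G y).inverse).hasFDerivAt.comp y
        (hasFDerivAt_clm_apply_const (hG.differentiableAt hy).hasFDerivAt
          (EuclideanSpace.single i 1))
  have T_self : T y = Matrix.of.symm (1 : Matrix (Fin n) (Fin n) ℝ) := by
    ext i j
    simp only [T, (hG.isInvertible y hy).inverse_apply_self]
    simp [Matrix.one_apply, eq_comm]
  have chain_rule : fderiv ℝ (fun z => Matrix.det (Matrix.of (T z)) * gramDet (G y)) y = _ :=
    (((contDiff_det.differentiable (by simp) (T y)).hasFDerivAt.comp y hT).mul_const _).fderiv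
  rw [gramDet_eq, chain_rule, T_self]
  simp only [smul_apply, ContinuousLinearMap.comp_apply, smul_eq_mul]
  rw [fderiv_det_one, metricTrace,
    trace_eq_sum_coord (EuclideanSpace.basisFun (Fin n) ℝ).toBasis]
  congr 1
  refine Finset.sum_congr rfl fun i _ => ?_
  simp
  rfl

theorem contDiffOn_weightedDensity (hG : IsMetricOn G U)
    (pos : ∀ y ∈ U, ∀ X, X ≠ 0 → 0 < G y X X) (hφ : ContDiffOn ℝ ∞ φ U) :
    ContDiffOn ℝ ∞ (weightedDensity G φ) U :=
  ((contDiff_gramDet.comp_contDiffOn hG.contDiffOn).sqrt fun y hy =>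
    (gramDet_pos (hG.symm y hy) (pos y hy)).ne').mul hφ.neg.exp

theorem fderiv_weightedDensity (hG : IsMetricOn G U) (hy : y ∈ U)
    (pos : ∀ X, X ≠ 0 → 0 < G y X X) (hφ : DifferentiableAt ℝ φ y)
    (N : EuclideanSpace ℝ (Fin n)) :
    fderiv ℝ (weightedDensity G φ) y N = weightedDensity G φ y *
      (2⁻¹ * metricTrace (G y) (fderiv ℝ G y N).toBilinForm - fderiv ℝ φ y N) := by
  have gramDet_pos := gramDet_pos (hG.symm y hy) pos
  have gramDet_diff : DifferentiableAt ℝ (fun z => gramDet (G z)) y :=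
    differentiableAt_of_contDiffOn hG.isOpen (contDiff_gramDet.comp_contDiffOn hG.contDiffOn) hy
  have product_rule : fderiv ℝ (weightedDensity G φ) y = _ :=
    ((gramDet_diff.hasFDerivAt.sqrt gramDet_pos.ne').mul hφ.hasFDerivAt.neg.exp).fderiv
  rw [product_rule]
  simp only [add_apply, smul_apply, neg_apply, smul_eq_mul, hG.fderiv_gramDet hy, weightedDensity,
    Pi.neg_apply]
  have sqrt_ne_zero := (Real.sqrt_pos.2 gramDet_pos).ne'
  have sq_sqrt := Real.sq_sqrt gramDet_pos.le
  generalize Real.sqrt (gramDet (G y)) = s at sqrt_ne_zero sq_sqrt ⊢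
  rw [← sq_sqrt]
  field_simp
  ring

end IsMetricOn

end Density

/-! ### The weighted volume in a chart -/

section MeasureGluing

variable {α β ι : Type*} [MeasurableSpace α] [MeasurableSpace β]

theorem exists_measure_restrict_eq {s : ι → Set α} (hs : ∀ i, MeasurableSet (s i))
    {μ : ι → Measure α} (agree : ∀ i j, (μ i).restrict (s j) = (μ j).restrict (s i))
    {e : ℕ → ι} (cover : ⋃ k, s (e k) = Set.univ) :
    ∃ ν : Measure α, ∀ i, ν.restrict (s i) = μ i := by
  let D := disjointed fun k => s (e k)
  have measurableSet_D : ∀ k, MeasurableSet (D k) := MeasurableSet.disjointed fun k => hs (e k)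
  refine ⟨Measure.sum fun k => (μ (e k)).restrict (D k), fun i => ?_⟩
  have restrict_piece (k : ℕ) :
      ((μ (e k)).restrict (D k)).restrict (s i) = (μ i).restrict (D k) := by
    have D_subset : D k ⊆ s (e k) := disjointed_subset _ k
    rw [Measure.restrict_comm (hs i), agree, Measure.restrict_restrict_of_subset D_subset]
  calc (Measure.sum fun k => (μ (e k)).restrict (D k)).restrict (s i)
      = Measure.sum fun k => (μ i).restrict (D k) := by
        rw [Measure.restrict_sum _ (hs i)]
        exact congrArg Measure.sum (funext restrict_piece)
    _ = μ i := by
        rw [← Measure.restrict_iUnion (disjoint_disjointed _) measurableSet_D, iUnion_disjointed,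
          cover, Measure.restrict_univ]

theorem iSup_restrict_eq_of_agree {s : ι → Set α} (hs : ∀ i, MeasurableSet (s i))
    {μ : ι → Measure α} (agree : ∀ i j, (μ i).restrict (s j) = (μ j).restrict (s i))
    {e : ℕ → ι} (cover : ⋃ k, s (e k) = Set.univ) (i : ι) :
    (⨆ j, μ j).restrict (s i) = μ i := by
  obtain ⟨ν, hν⟩ := exists_measure_restrict_eq hs agree cover
  have iSup_le_glued : ⨆ j, μ j ≤ ν :=
    iSup_le fun j => (hν j).symm.trans_le Measure.restrict_le_self
  have restrict_self : (μ i).restrict (s i) = μ i := by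
    rw [← hν i, Measure.restrict_restrict (hs i), Set.inter_self]
  refine le_antisymm ((Measure.restrict_mono_measure iSup_le_glued _).trans_eq (hν i)) ?_
  exact restrict_self.symm.trans_le (Measure.restrict_mono_measure (le_iSup μ i) _)

theorem withDensity_map {μ : Measure α} {f : α → β} (hf : AEMeasurable f μ)
    {h : β → ENNReal} (hh : Measurable h) :
    (μ.map f).withDensity h = (μ.withDensity (h ∘ f)).map f := by
  ext A hA
  rw [withDensity_apply _ hA, Measure.restrict_map_of_aemeasurable hf hA,
    lintegral_map' hh.aemeasurable hf.restrict, Measure.map_apply_of_aemeasurable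
      (hf.mono_ac (withDensity_absolutelyContinuous _ _)) hA,
    withDensity_apply₀ _ (hf.nullMeasurableSet_preimage hA)]
  rfl

end MeasureGluing

theorem gramDet_eq_of_pullback {n : ℕ}
    {B B' : EuclideanSpace ℝ (Fin n) →L[ℝ] EuclideanSpace ℝ (Fin n) →L[ℝ] ℝ}
    {T : EuclideanSpace ℝ (Fin n) →L[ℝ] EuclideanSpace ℝ (Fin n)}
    (pullback : ∀ X Y, B' X Y = B (T X) (T Y)) : gramDet B' = T.det ^ 2 * gramDet B := by
  have det_matrix : Matrix.det (Matrix.of fun i j => T (EuclideanSpace.single i 1) j) = T.det := by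
    rw [ContinuousLinearMap.det, ← Matrix.det_transpose,
      ← LinearMap.det_toMatrix (EuclideanSpace.basisFun (Fin n) ℝ).toBasis]
    congr 1
  have gramDet_flip (C : EuclideanSpace ℝ (Fin n) →L[ℝ] EuclideanSpace ℝ (Fin n) →L[ℝ] ℝ) :
      gramDet C.flip = gramDet C := by
    rw [gramDet, gramDet, ← Matrix.det_transpose]
    rfl
  calc gramDet B'
      = T.det * gramDet (B.flip ∘L T).flip := by
        rw [← det_matrix]
        exact gramDet_comp_left pullback
    _ = T.det * (T.det * gramDet B.flip) := by
        rw [gramDet_flip, ← det_matrix]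
        exact congrArg _ (gramDet_comp_left fun _ _ => rfl)
    _ = T.det ^ 2 * gramDet B := by
        rw [gramDet_flip]
        ring

section ChartVolume

variable {n : ℕ} {M : Type*} [TopologicalSpace M] [ChartedSpace (EuclideanSpace ℝ (Fin n)) M]

theorem chartSet_univ (x : M) : chartSet (𝓡 n) x Set.univ = (extChartAt (𝓡 n) x).target := by
  rw [chartSet, Set.preimage_univ, Set.inter_univ]

theorem chartChange_image_chartSet {x x' : M} {A : Set M}
    (hA : A ⊆ (extChartAt (𝓡 n) x).source ∩ (extChartAt (𝓡 n) x').source) :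
    (extChartAt (𝓡 n) x' ∘ (extChartAt (𝓡 n) x).symm) '' chartSet (𝓡 n) x A =
      chartSet (𝓡 n) x' A := by
  ext z
  constructor
  · rintro ⟨y, hy, rfl⟩
    exact mem_chartSet hy.2 (hA hy.2).2
  · intro hz
    refine ⟨extChartAt (𝓡 n) x ((extChartAt (𝓡 n) x').symm z), mem_chartSet hz.2 (hA hz.2).1, ?_⟩
    rw [Function.comp_apply, (extChartAt (𝓡 n) x).left_inv (hA hz.2).1,
      (extChartAt (𝓡 n) x').right_inv hz.1]

theorem injOn_chartChange {x x' : M} {A : Set M} (hA : A ⊆ (extChartAt (𝓡 n) x').source) :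
    Set.InjOn (extChartAt (𝓡 n) x' ∘ (extChartAt (𝓡 n) x).symm) (chartSet (𝓡 n) x A) :=
  fun _ hy _ hz h => (extChartAt (𝓡 n) x).symm.injOn hy.1 hz.1
    ((extChartAt (𝓡 n) x').injOn (hA hy.2) (hA hz.2) h)

variable [MeasurableSpace M] [BorelSpace M]

theorem aemeasurable_extChartAt_symm (x : M) :
    AEMeasurable (extChartAt (𝓡 n) x).symm (volume.restrict (extChartAt (𝓡 n) x).target) :=
  (continuousOn_extChartAt_symm x).aemeasurable (isOpen_extChartAt_target x).measurableSet

theorem measurableSet_chartSet (x : M) {A : Set M} (hA : MeasurableSet A) :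
    MeasurableSet (chartSet (𝓡 n) x A) := by
  have preimage_measurable := (continuousOn_iff_continuous_domRestrict.1
    (continuousOn_extChartAt_symm (I := 𝓡 n) x)).measurable hA
  have image_measurable :=
    (isOpen_extChartAt_target (I := 𝓡 n) x).measurableSet.subtype_image preimage_measurable
  rwa [Set.domRestrict_eq, Set.preimage_comp, Subtype.image_preimage_coe] at image_measurable

theorem chartVolume_apply (g : ∀ x : M, TangentSpace (𝓡 n) x →L[ℝ] TangentSpace (𝓡 n) x →L[ℝ] ℝ)
    (x : M) {A : Set M} (hA : MeasurableSet A) :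
    chartVolume g x A = ∫⁻ y in chartSet (𝓡 n) x A,
      ENNReal.ofReal (Real.sqrt (gramDet (chartMetric (𝓡 n) g x y))) := by
  rw [chartVolume, Measure.map_apply_of_aemeasurable
    ((aemeasurable_extChartAt_symm x).mono_ac (withDensity_absolutelyContinuous _ _)) hA,
    withDensity_apply', Measure.restrict_restrict' (isOpen_extChartAt_target x).measurableSet,
    Set.inter_comm]
  rfl

theorem chartVolume_inter_source
    (g : ∀ x : M, TangentSpace (𝓡 n) x →L[ℝ] TangentSpace (𝓡 n) x →L[ℝ] ℝ) (x : M) {A : Set M}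
    (hA : MeasurableSet A) :
    chartVolume g x (A ∩ (extChartAt (𝓡 n) x).source) = chartVolume g x A := by
  rw [chartVolume_apply g x hA,
    chartVolume_apply g x (hA.inter (isOpen_extChartAt_source x).measurableSet)]
  congr 2
  ext y
  exact ⟨fun hy => ⟨hy.1, hy.2.1⟩, fun hy => ⟨hy.1, hy.2, (extChartAt (𝓡 n) x).map_target hy.1⟩⟩

end ChartVolume

section Volume

variable {n : ℕ} {M : Type*} [TopologicalSpace M] [ChartedSpace (EuclideanSpace ℝ (Fin n)) M]
  [IsManifold (𝓡 n) ∞ M] (g : RMetric n M)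

theorem RMetric.chartMetric_pos {x : M} {y : EuclideanSpace ℝ (Fin n)}
    (hy : y ∈ (extChartAt (𝓡 n) x).target) {X : EuclideanSpace ℝ (Fin n)} (hX : X ≠ 0) :
    0 < chartMetric (𝓡 n) g.inner x y X X :=
  g.pos _ _ fun h => hX ((isInvertible_chartDeriv (I := 𝓡 n) hy).injective
    (h.trans (map_zero (chartDeriv (𝓡 n) x y)).symm))

/-- The density of `e^{-φ} dvol_g` in the coordinates of the chart at `x`. -/
def RMetric.chartDensity (φ : SmoothFn n M) (x : M) : EuclideanSpace ℝ (Fin n) → ℝ :=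
  weightedDensity (chartMetric (𝓡 n) g.inner x) (φ ∘ (extChartAt (𝓡 n) x).symm)

theorem RMetric.contDiffOn_chartDensity (φ : SmoothFn n M) (x : M) :
    ContDiffOn ℝ ∞ (g.chartDensity φ x) (extChartAt (𝓡 n) x).target := by
  rw [← chartSet_univ]
  exact (g.isMetricOn x).contDiffOn_weightedDensity
    (fun y hy X hX => g.chartMetric_pos hy.1 hX) (φ.contDiffOn_chart x)

theorem RMetric.aemeasurable_chartDensity (φ : SmoothFn n M) (x : M) :
    AEMeasurable (fun y => ENNReal.ofReal (g.chartDensity φ x y))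
      (volume.restrict (extChartAt (𝓡 n) x).target) :=
  ((g.contDiffOn_chartDensity φ x).continuousOn.aemeasurable
    (isOpen_extChartAt_target x).measurableSet).ennreal_ofReal

variable [MeasurableSpace M] [BorelSpace M]

theorem RMetric.chartVolume_eq_of_subset {x x' : M} {A : Set M}
    (hA : A ⊆ (extChartAt (𝓡 n) x).source ∩ (extChartAt (𝓡 n) x').source) (hm : MeasurableSet A) :
    chartVolume g.inner x A = chartVolume g.inner x' A := by
  have isometry := g.isSmoothMetricOn.isIsometryOn_chartChange x x'
  have mem_overlap : ∀ y ∈ chartSet (𝓡 n) x A,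
      y ∈ chartSet (𝓡 n) x (Set.univ ∩ (extChartAt (𝓡 n) x').source) := fun y hy =>
    ⟨hy.1, Set.mem_univ _, (hA hy.2).2⟩
  rw [chartVolume_apply _ _ hm, chartVolume_apply _ _ hm, ← chartChange_image_chartSet hA,
    lintegral_image_eq_lintegral_abs_det_fderiv_mul volume (measurableSet_chartSet x hm)
      (fun y hy => (differentiableAt_of_contDiffOn isometry.source.isOpen isometry.contDiffOn
        (mem_overlap y hy)).hasFDerivAt.hasFDerivWithinAt)
      (injOn_chartChange (hA.trans Set.inter_subset_right))]
  refine setLIntegral_congr_fun (measurableSet_chartSet x hm) fun y hy => ?_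
  rw [gramDet_eq_of_pullback (isometry.pullback y (mem_overlap y hy)),
    Real.sqrt_mul (sq_nonneg _), Real.sqrt_sq_eq_abs, ENNReal.ofReal_mul (abs_nonneg _)]

theorem RMetric.chartVolume_restrict_comm (x x' : M) :
    (chartVolume g.inner x).restrict (extChartAt (𝓡 n) x').source =
      (chartVolume g.inner x').restrict (extChartAt (𝓡 n) x).source := by
  have hs (x : M) : MeasurableSet (extChartAt (𝓡 n) x).source :=
    (isOpen_extChartAt_source x).measurableSet
  ext A hA
  rw [Measure.restrict_apply hA, Measure.restrict_apply hA,
    ← chartVolume_inter_source g.inner x (hA.inter (hs x')),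
    ← chartVolume_inter_source g.inner x' (hA.inter (hs x)), Set.inter_right_comm]
  exact g.chartVolume_eq_of_subset (fun z hz => ⟨hz.1.2, hz.2⟩)
    ((hA.inter (hs x)).inter (hs x'))

variable [SecondCountableTopology M]

theorem RMetric.riemannianVolume_restrict (x : M) :
    (riemannianVolume g.inner).restrict (extChartAt (𝓡 n) x).source = chartVolume g.inner x := by
  obtain ⟨t, t_countable, cover⟩ := TopologicalSpace.countable_cover_nhds
    fun x : M => extChartAt_source_mem_nhds (I := 𝓡 n) x
  have t_nonempty : t.Nonempty := by
    have mem_cover : x ∈ ⋃ z ∈ t, (extChartAt (𝓡 n) z).source := cover ▸ Set.mem_univ x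
    obtain ⟨z, hz, -⟩ := Set.mem_iUnion₂.1 mem_cover
    exact ⟨z, hz⟩
  obtain ⟨e, rfl⟩ := t_countable.exists_eq_range t_nonempty
  rw [Set.biUnion_range] at cover
  exact iSup_restrict_eq_of_agree (fun x => (isOpen_extChartAt_source x).measurableSet)
    g.chartVolume_restrict_comm cover x

theorem RMetric.weightedVolume_restrict (φ : SmoothFn n M) (x : M) :
    (weightedVolume g.inner φ).restrict (extChartAt (𝓡 n) x).source =
      ((volume.restrict (extChartAt (𝓡 n) x).target).withDensity fun y =>
        ENNReal.ofReal (g.chartDensity φ x y)).map (extChartAt (𝓡 n) x).symm := by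
  have measurable_weight : Measurable fun z => ENNReal.ofReal (Real.exp (-φ z)) :=
    (Real.continuous_exp.comp φ.contMDiff.continuous.neg).measurable.ennreal_ofReal
  have aemeasurable_symm := aemeasurable_extChartAt_symm (n := n) x
  have aemeasurable_sqrt : AEMeasurable
      (fun y => ENNReal.ofReal (Real.sqrt (gramDet (chartMetric (𝓡 n) g.inner x y))))
      (volume.restrict (extChartAt (𝓡 n) x).target) := by
    refine (ContinuousOn.aemeasurable ?_ (isOpen_extChartAt_target x).measurableSet).ennreal_ofReal
    rw [← chartSet_univ]
    exact (contDiff_gramDet.continuous.comp_continuousOn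
      (g.isMetricOn x).contDiffOn.continuousOn).sqrt
  rw [weightedVolume, restrict_withDensity (isOpen_extChartAt_source x).measurableSet,
    RMetric.riemannianVolume_restrict, chartVolume, withDensity_map
      (aemeasurable_symm.mono_ac (withDensity_absolutelyContinuous _ _)) measurable_weight]
  congr 1
  refine (withDensity_mul₀ aemeasurable_sqrt
    (measurable_weight.comp_aemeasurable aemeasurable_symm)).symm.trans ?_
  congr 1
  ext y
  exact (ENNReal.ofReal_mul (Real.sqrt_nonneg _)).symm

theorem RMetric.setIntegral_weightedVolume (φ : SmoothFn n M) (x : M) {F : M → ℝ}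
    (hF : Continuous F) :
    ∫ z in (extChartAt (𝓡 n) x).source, F z ∂(weightedVolume g.inner φ) =
      ∫ y in (extChartAt (𝓡 n) x).target,
        g.chartDensity φ x y * F ((extChartAt (𝓡 n) x).symm y) := by
  have toReal_density (y : EuclideanSpace ℝ (Fin n)) :
      (ENNReal.ofReal (g.chartDensity φ x y)).toReal = g.chartDensity φ x y :=
    ENNReal.toReal_ofReal (mul_nonneg (Real.sqrt_nonneg _) (Real.exp_nonneg _))
  rw [g.weightedVolume_restrict, integral_map ((aemeasurable_extChartAt_symm x).mono_ac
      (withDensity_absolutelyContinuous _ _)) hF.aestronglyMeasurable,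
    integral_withDensity_eq_integral_toReal_smul₀ (g.aemeasurable_chartDensity φ x) (by simp)]
  simp only [toReal_density, smul_eq_mul]

theorem RMetric.weightedVolume_apply (φ : SmoothFn n M) {x : M} {A : Set M}
    (hA : MeasurableSet A) (hAx : A ⊆ (extChartAt (𝓡 n) x).source) :
    weightedVolume g.inner φ A =
      ∫⁻ y in chartSet (𝓡 n) x A, ENNReal.ofReal (g.chartDensity φ x y) := by
  rw [← Measure.restrict_eq_self _ hAx, g.weightedVolume_restrict,
    Measure.map_apply_of_aemeasurable
      ((aemeasurable_extChartAt_symm x).mono_ac (withDensity_absolutelyContinuous _ _)) hA,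
    withDensity_apply', Measure.restrict_restrict' (isOpen_extChartAt_target x).measurableSet,
    Set.inter_comm]
  rfl

theorem RMetric.isLocallyFiniteMeasure_weightedVolume (φ : SmoothFn n M) :
    IsLocallyFiniteMeasure (weightedVolume g.inner φ) := by
  refine ⟨fun x => ?_⟩
  obtain ⟨r, r_pos, closedBall_subset⟩ := Metric.nhds_basis_closedBall.mem_iff.1
    (extChartAt_target_mem_nhds (I := 𝓡 n) x)
  let e := extChartAt (𝓡 n) x
  let A : Set M := e.source ∩ e ⁻¹' Metric.ball (e x) r
  have isOpen_A : IsOpen A := isOpen_extChartAt_preimage' x Metric.isOpen_ball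
  have chartSet_subset : chartSet (𝓡 n) x A ⊆ Metric.closedBall (e x) r := fun y hy => by
    have hball : e (e.symm y) ∈ Metric.ball (e x) r := hy.2.2
    rw [e.right_inv hy.1] at hball
    exact Metric.ball_subset_closedBall hball
  have integrable_density : IntegrableOn (g.chartDensity φ x) (Metric.closedBall (e x) r) :=
    ((g.contDiffOn_chartDensity φ x).continuousOn.mono closedBall_subset).integrableOn_compact
      (isCompact_closedBall _ _)
  refine ⟨A, isOpen_A.mem_nhds ⟨mem_extChartAt_source x, Metric.mem_ball_self r_pos⟩, ?_⟩
  rw [g.weightedVolume_apply φ isOpen_A.measurableSet Set.inter_subset_left]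
  exact Integrable.lintegral_lt_top (integrable_density.mono_set chartSet_subset)

end Volume

/-! ### Self-adjointness -/

section SelfAdjoint

variable {n : ℕ} {M : Type*} [TopologicalSpace M] [ChartedSpace (EuclideanSpace ℝ (Fin n)) M]
  [IsManifold (𝓡 n) ∞ M] (g : RMetric n M)

theorem weightedLaplacianEnd_comp_extChartAt_symm (φ f : SmoothFn n M) {x : M}
    {y : EuclideanSpace ℝ (Fin n)} (hy : y ∈ (extChartAt (𝓡 n) x).target) :
    weightedLaplacianEnd g φ f ((extChartAt (𝓡 n) x).symm y) =
      coordWeightedLaplacian (chartMetric (𝓡 n) g.inner x) (φ ∘ (extChartAt (𝓡 n) x).symm)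
        (f ∘ (extChartAt (𝓡 n) x).symm) y := by
  have mem_source := (extChartAt (𝓡 n) x).map_target hy
  change laplacian (𝓡 n) g.inner f _ - gradInner (𝓡 n) g.inner φ f _ = _
  rw [g.isSmoothMetricOn.laplacian_eq f.contMDiff.contMDiffOn (Set.mem_univ _) mem_source,
    g.isSmoothMetricOn.gradInner_eq φ.contMDiff.contMDiffOn f.contMDiff.contMDiffOn
      (Set.mem_univ _) mem_source, (extChartAt (𝓡 n) x).right_inv hy, coordWeightedLaplacian]

theorem weightedLaplacianEnd_eq_zero_of_notMem_tsupport (φ : SmoothFn n M) {f : SmoothFn n M}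
    {z : M} (hz : z ∉ tsupport f) : weightedLaplacianEnd g φ f z = 0 :=
  calc weightedLaplacianEnd g φ f z = weightedLaplacianEnd g φ 0 z :=
        weightedLaplacian_congr (notMem_tsupport_iff_eventuallyEq.1 hz)
    _ = 0 := by rw [map_zero]; rfl

theorem hasCompactSupport_gjmsEnd (φ : SmoothFn n M) {f : SmoothFn n M}
    (hf : HasCompactSupport f) : HasCompactSupport (gjmsEnd g φ f) := by
  refine hf.mono' fun z hz => ?_
  by_contra hz'
  refine hz ?_
  change weightedLaplacianEnd g φ f z + -quarterCurvature g φ z * f z = 0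
  rw [weightedLaplacianEnd_eq_zero_of_notMem_tsupport g φ hz',
    image_eq_zero_of_notMem_tsupport hz', mul_zero, add_zero]

/-- The integrand `(Δ_φ f) h - f Δ_φ h` of Green's identity, as a linear function of `f`. -/
def greenIntegrand (φ h : SmoothFn n M) : SmoothFn n M →ₗ[ℝ] SmoothFn n M :=
  LinearMap.mulRight ℝ h ∘ₗ weightedLaplacianEnd g φ -
    LinearMap.mulRight ℝ (weightedLaplacianEnd g φ h)

theorem greenIntegrand_apply (φ h f : SmoothFn n M) (z : M) :
    greenIntegrand g φ h f z =
      weightedLaplacianEnd g φ f z * h z - f z * weightedLaplacianEnd g φ h z :=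
  rfl

theorem greenIntegrand_eq_zero_of_notMem_tsupport (φ h : SmoothFn n M) {f : SmoothFn n M}
    {z : M} (hz : z ∉ tsupport f) : greenIntegrand g φ h f z = 0 := by
  rw [greenIntegrand_apply, weightedLaplacianEnd_eq_zero_of_notMem_tsupport g φ hz,
    image_eq_zero_of_notMem_tsupport hz, zero_mul, zero_mul, sub_zero]

theorem coordDiv_greenField_chart (φ h f : SmoothFn n M) {x : M}
    {y : EuclideanSpace ℝ (Fin n)} (hy : y ∈ (extChartAt (𝓡 n) x).target) :
    coordDiv (greenField (chartMetric (𝓡 n) g.inner x) (g.chartDensity φ x)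
        (f ∘ (extChartAt (𝓡 n) x).symm) (h ∘ (extChartAt (𝓡 n) x).symm)) y =
      g.chartDensity φ x y * greenIntegrand g φ h f ((extChartAt (𝓡 n) x).symm y) := by
  have metric := g.isMetricOn x
  have hy' : y ∈ chartSet (𝓡 n) x Set.univ := by rwa [chartSet_univ]
  have smooth (F : SmoothFn n M) : ContDiffAt ℝ 2 (F ∘ (extChartAt (𝓡 n) x).symm) y :=
    contDiffAt_two_of_contDiffOn metric.isOpen (F.contDiffOn_chart x) hy'
  have density_diff : DifferentiableAt ℝ (g.chartDensity φ x) y :=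
    differentiableAt_of_contDiffOn (isOpen_extChartAt_target (I := 𝓡 n) x)
      (g.contDiffOn_chartDensity φ x) hy
  rw [metric.coordDiv_greenField density_diff (metric.fderiv_weightedDensity hy'
      (fun _ hX => g.chartMetric_pos hy hX) ((smooth φ).differentiableAt two_ne_zero))
    (smooth f) (smooth h) hy', greenIntegrand_apply,
    weightedLaplacianEnd_comp_extChartAt_symm g φ f hy,
    weightedLaplacianEnd_comp_extChartAt_symm g φ h hy]
  simp only [Function.comp_apply]
  ring

theorem exists_finset_sum_eq_of_hasCompactSupport [T2Space M] [SecondCountableTopology M]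
    {f : SmoothFn n M} (hf : HasCompactSupport f) :
    ∃ (t : Finset M) (q : M → SmoothFn n M), f = ∑ i ∈ t, q i ∧ ∀ i,
      HasCompactSupport (q i) ∧ tsupport (q i) ⊆ (extChartAt (𝓡 n) i).source := by
  have : LocallyCompactSpace M := Manifold.locallyCompact_of_finiteDimensional (𝓡 n)
  obtain ⟨p, p_subordinate⟩ := SmoothPartitionOfUnity.exists_isSubordinate_chartAt_source (𝓡 n) M
  have finite_meet := p.locallyFinite.finite_nonempty_inter_compact hf.isCompact
  refine ⟨finite_meet.toFinset, fun i => p i * f, ?_, fun i => ⟨hf.mul_left, ?_⟩⟩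
  · ext z
    have sum_apply : (∑ i ∈ finite_meet.toFinset, p i * f) z =
        (∑ i ∈ finite_meet.toFinset, p i z) * f z := by
      rw [← Finset.sum_mul, ContMDiffMap.coe_mul, Pi.mul_apply,
        ← ContMDiffMap.coeFnAddMonoidHom_apply, map_sum, Finset.sum_apply]
      rfl
    rw [sum_apply]
    by_cases hz : z ∈ tsupport f
    · have support_subset : (Function.support fun i => p i z) ⊆ finite_meet.toFinset :=
        fun i hi => finite_meet.mem_toFinset.2 ⟨z, hi, hz⟩
      rw [← finsum_eq_sum_of_support_subset _ support_subset, p.sum_eq_one (Set.mem_univ z),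
        one_mul]
    · rw [image_eq_zero_of_notMem_tsupport hz, mul_zero]
  · rw [extChartAt_source]
    exact (tsupport_mul_subset_left (f := p i) (g := f)).trans (p_subordinate i)

variable [MeasurableSpace M] [BorelSpace M] [SecondCountableTopology M]

theorem integrable_weightedVolume (φ : SmoothFn n M) {F : SmoothFn n M}
    (hF : HasCompactSupport F) : Integrable F (weightedVolume g.inner φ) :=
  have := g.isLocallyFiniteMeasure_weightedVolume φ
  F.contMDiff.continuous.integrable_of_hasCompactSupport hF

theorem integral_greenIntegrand_of_tsupport_subset (φ h : SmoothFn n M) {f : SmoothFn n M}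
    (hf : HasCompactSupport f) {x : M} (hfx : tsupport f ⊆ (extChartAt (𝓡 n) x).source) :
    ∫ z, greenIntegrand g φ h f z ∂(weightedVolume g.inner φ) = 0 := by
  let e := extChartAt (𝓡 n) x
  let V := greenField (chartMetric (𝓡 n) g.inner x) (g.chartDensity φ x) (f ∘ e.symm) (h ∘ e.symm)
  have isCompact_image : IsCompact (e '' tsupport f) :=
    hf.isCompact.image_of_continuousOn ((continuousOn_extChartAt x).mono hfx)
  have image_subset : e '' tsupport f ⊆ e.target :=
    (Set.image_mono hfx).trans e.image_source_eq_target.subset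
  have smooth (F : SmoothFn n M) : ContDiffOn ℝ ∞ (F ∘ e.symm) (chartSet (𝓡 n) x Set.univ) :=
    F.contDiffOn_chart x
  have V_smooth : ContDiffOn ℝ ∞ V e.target := by
    have density_smooth := g.contDiffOn_chartDensity φ x
    rw [← chartSet_univ] at density_smooth ⊢
    exact (g.isMetricOn x).contDiffOn_greenField density_smooth (smooth f) (smooth h)
  have V_eq_zero : ∀ y ∈ e.target \ e '' tsupport f, V y = 0 := fun y ⟨hy, hy_image⟩ => by
    have symm_notMem : e.symm y ∉ tsupport f := fun hf_y =>
      hy_image ⟨e.symm y, hf_y, e.right_inv hy⟩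
    exact greenField_eq_zero ((continuousAt_extChartAt_symm'' hy).eventually
      (notMem_tsupport_iff_eventuallyEq.1 symm_notMem))
  calc ∫ z, greenIntegrand g φ h f z ∂(weightedVolume g.inner φ)
      = ∫ z in e.source, greenIntegrand g φ h f z ∂(weightedVolume g.inner φ) :=
        (setIntegral_eq_integral_of_forall_compl_eq_zero fun z hz =>
          greenIntegrand_eq_zero_of_notMem_tsupport g φ h fun hz' => hz (hfx hz')).symm
    _ = ∫ y in e.target, g.chartDensity φ x y * greenIntegrand g φ h f (e.symm y) :=
        g.setIntegral_weightedVolume φ x (greenIntegrand g φ h f).contMDiff.continuous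
    _ = ∫ y in e.target, coordDiv V y :=
        setIntegral_congr_fun (isOpen_extChartAt_target x).measurableSet fun y hy =>
          (coordDiv_greenField_chart g φ h f hy).symm
    _ = 0 := setIntegral_coordDiv_eq_zero volume (isOpen_extChartAt_target x) isCompact_image
        image_subset (V_smooth.of_le (by exact_mod_cast le_top)) V_eq_zero

variable [T2Space M]

theorem integral_greenIntegrand (φ h : SmoothFn n M) {f : SmoothFn n M}
    (hf : HasCompactSupport f) :
    ∫ z, greenIntegrand g φ h f z ∂(weightedVolume g.inner φ) = 0 := by
  obtain ⟨t, q, rfl, hq⟩ := exists_finset_sum_eq_of_hasCompactSupport hf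
  have integrable (i : M) : Integrable (greenIntegrand g φ h (q i)) (weightedVolume g.inner φ) :=
    integrable_weightedVolume g φ (HasCompactSupport.intro (hq i).1.isCompact fun _ hz =>
      greenIntegrand_eq_zero_of_notMem_tsupport g φ h hz)
  have sum_apply (z : M) : greenIntegrand g φ h (∑ i ∈ t, q i) z =
      ∑ i ∈ t, greenIntegrand g φ h (q i) z := by
    rw [map_sum, ← ContMDiffMap.coeFnAddMonoidHom_apply, map_sum, Finset.sum_apply]
    rfl
  simp only [sum_apply]
  rw [integral_finsetSum _ fun i _ => integrable i]
  exact Finset.sum_eq_zero fun i _ =>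
    integral_greenIntegrand_of_tsupport_subset g φ h (hq i).1 (hq i).2

theorem integral_gjmsEnd_mul (φ h : SmoothFn n M) {f : SmoothFn n M} (hf : HasCompactSupport f) :
    ∫ z, gjmsEnd g φ f z * h z ∂(weightedVolume g.inner φ) =
      ∫ z, f z * gjmsEnd g φ h z ∂(weightedVolume g.inner φ) := by
  have integrable_left : Integrable (gjmsEnd g φ f * h : SmoothFn n M) (weightedVolume g.inner φ) :=
    integrable_weightedVolume g φ (hasCompactSupport_gjmsEnd g φ hf).mul_right
  have integrable_right :
      Integrable (f * gjmsEnd g φ h : SmoothFn n M) (weightedVolume g.inner φ) :=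
    integrable_weightedVolume g φ hf.mul_right
  have potential_cancels (z : M) :
      gjmsEnd g φ f z * h z - f z * gjmsEnd g φ h z = greenIntegrand g φ h f z := by
    change (weightedLaplacianEnd g φ f z + -quarterCurvature g φ z * f z) * h z -
      f z * (weightedLaplacianEnd g φ h z + -quarterCurvature g φ z * h z) = _
    rw [greenIntegrand_apply]
    ring
  have integral_sub := integral_sub integrable_left integrable_right
  rw [← sub_eq_zero, ← integral_greenIntegrand g φ h hf]
  exact integral_sub.symm.trans (integral_congr_ae (.of_forall potential_cancels))

theorem integral_gjmsEnd_pow_mul (φ : SmoothFn n M) (k : ℕ) (f h : SmoothFn n M)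
    (hf : HasCompactSupport f) :
    ∫ z, (gjmsEnd g φ ^ k) f z * h z ∂(weightedVolume g.inner φ) =
      ∫ z, f z * (gjmsEnd g φ ^ k) h z ∂(weightedVolume g.inner φ) := by
  induction k generalizing f with
  | zero => rfl
  | succ k ih =>
    calc ∫ z, (gjmsEnd g φ ^ (k + 1)) f z * h z ∂(weightedVolume g.inner φ)
        = ∫ z, gjmsEnd g φ f z * (gjmsEnd g φ ^ k) h z ∂(weightedVolume g.inner φ) := by
          rw [pow_succ]
          exact ih _ (hasCompactSupport_gjmsEnd g φ hf)
      _ = ∫ z, f z * (gjmsEnd g φ ^ (k + 1)) h z ∂(weightedVolume g.inner φ) := by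
          rw [pow_succ']
          exact integral_gjmsEnd_mul g φ _ hf

end SelfAdjoint

end WeightedGJMS

end

theorem theorem1p15 {n : ℕ} {M : Type*} [TopologicalSpace M] [T2Space M]
    [SecondCountableTopology M] [ChartedSpace (EuclideanSpace ℝ (Fin n)) M]
    [IsManifold (𝓡 n) ∞ M] [MeasurableSpace M] [BorelSpace M]
    (g : RMetric n M) (k : ℕ) :
    ∃ L : SmoothFn n M → Module.End ℝ (SmoothFn n M),
      -- the operator equals `(Δ_φ - ¼ R_φ)^k`
      (∀ (φ f : SmoothFn n M), ⇑(L φ f) = (gjmsFactor (𝓡 n) g.inner φ)^[k] f) ∧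
      -- conformal invariance: the operators define a map of densities of weight `-1/2`
      (∀ φ : SmoothFn n M, ∃ T : ConformalDensity φ (-1 / 2) →ₗ[ℝ] ConformalDensity φ (-1 / 2),
        ∀ (f : ConformalDensity φ (-1 / 2)) (ψ : conformalClass φ),
          (T f).1 ψ = L ψ (f.1 ψ)) ∧
      -- formal self-adjointness with respect to `e^{-φ} dvol_g`
      (∀ φ f h : SmoothFn n M, HasCompactSupport f → HasCompactSupport h →
        ∫ x, L φ f x * h x ∂(weightedVolume g.inner φ) =
          ∫ x, f x * L φ h x ∂(weightedVolume g.inner φ)) ∧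
      -- the leading term is `Δ_φ^k`
      (∀ φ : SmoothFn n M, ∃ D : Module.End ℝ (SmoothFn n M), IsDiffOpOfOrderLT (2 * k) D ∧
        ∀ f : SmoothFn n M,
          ⇑(L φ f) = (weightedLaplacian (𝓡 n) g.inner φ)^[k] f + ⇑(D f)) ∧
      -- the operator is obtained from the `k`-th power of the ambient weighted Laplacian,
      -- for every normal ambient space and every smooth extension `fu` of `f`
      (∀ (φ : SmoothFn n M) (S : NormalAmbientSpace g φ) (f : SmoothFn n M) (fu : M × ℝ → ℝ),
        ContMDiffOn ((𝓡 n).prod 𝓘(ℝ, ℝ)) 𝓘(ℝ, ℝ) ∞ fu S.dom → (∀ x, fu (x, 0) = f x) →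
        ∀ (v : ℝ) (x : M),
          Real.exp (v / 2) *
            (S.weightedLaplacian^[k] fun p => Real.exp (-p.1 / 2) * fu p.2) (v, x, 0) =
          L φ f x) := by
  refine ⟨fun φ => gjmsEnd g φ ^ k, fun φ f => gjmsEnd_pow_apply g φ f k,
    fun φ => ⟨gjmsDensityMap g φ k, fun f ψ => rfl⟩,
    fun φ f h hf _ => integral_gjmsEnd_pow_mul g φ k f h hf,
    fun φ => ⟨gjmsEnd g φ ^ k - weightedLaplacianEnd g φ ^ k,
      isDiffOpOfOrderLT_gjmsEnd_pow_sub g φ k, fun f => ?_⟩,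
    fun φ S f fu hfu fu_zero v x => ?_⟩
  · rw [← weightedLaplacianEnd_pow_apply, ← ContMDiffMap.coe_add, LinearMap.sub_apply,
      add_sub_cancel]
  · rw [gjmsEnd_pow_apply, ← funext fu_zero]
    exact S.exp_mul_iterate_weightedLaplacian_ambientDensity hfu k v x
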